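/- For $L>0$ let $f_L$ be the hyperbolic Gaussian analytic function of intensity $L$, $$f_L(z)=\sum_{n=0}^\infty a_n\binom{L+n-1}{n}^{1/2}z^n,\qquad |z|<1,\qquad \binom{L+n-1}{n}=\frac{\Gamma(L+n)}{\Gamma(n+1)\Gamma(L)},$$ where $(a_n)_{n\ge 0}$ are i.i.d. standard complex normal random variables (independent centred real Gaussian real and imaginary parts, each of variance $1/2$). For $0<r<1$ let $n_L(r)$ be the number of zeros of $f_L$ in the open disc $D(0,r)=\{|z|<r\}$, counted with multiplicity. Then $n_L(r)$ is square integrable for all $L>0$ and $0<r<1$, and its variance satisfies the following. (a) For each fixed $L>1/2$, as $r\to1^-$, $$\mathrm{Var}[n_L(r)]=\frac{c_L}{1-r}(1+o(1)),$$ where $$c_L=\frac{L^2}{2\pi}\int_0^\infty\frac{1}{(1+x^2)^L-1}\,\frac{x^2}{1+x^2}\,dx=\frac{L^2}{8\sqrt\pi}\sum_{n=1}^\infty\frac{\Gamma(Ln-\frac12)}{\Gamma(Ln+1)},$$ the integral and the series being convergent. Moreover, the $o(1)$ is uniform in $L$ for all $L>1$: for every $\varepsilon>0$ there is $\delta>0$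 such that $\left|\mathrm{Var}[n_L(r)]\,(1-r)/c_L-1\right|<\varepsilon$ for all $L>1$ and all $r\in(0,1)$ with $1-\delta<r<1$. (b) As $r\to1^-$, $$\mathrm{Var}[n_{1/2}(r)]=\frac1{8\pi}\,\frac1{1-r}\,\log\frac1{1-r}\,(1+o(1)).$$ (c) For each fixed $0<L<1/2$, as $r\to1^-$, $$\mathrm{Var}[n_L(r)]=\frac{c_L}{(1-r)^{2-2L}}(1+o(1)),\qquad c_L=\frac{L^2\,\Gamma(\frac12-L)}{4\sqrt\pi\,\Gamma(1-L)}.$$ -/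

import Mathlib

open MeasureTheory ProbabilityTheory Filter Topology

namespace HyperbolicGAF

/-- The standard complex normal distribution: real and imaginary parts are independent centred real
Gaussians of variance `1/2`, so that `E|ζ|² = 1`. -/
noncomputable def stdComplexNormal : Measure ℂ :=
  ((gaussianReal 0 (1 / 2)).prod (gaussianReal 0 (1 / 2))).map Complex.measurableEquivRealProd.symm

/-- The binomial coefficient `(L+n-1 choose n) = Γ(L+n) / (Γ(n+1) Γ(L))`. -/
noncomputable def binom (L : ℝ) (n : ℕ) : ℝ :=
  Real.Gamma (L + n) / (Real.Gamma (n + 1) * Real.Gamma L)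

/-- The power series `f_L(z) = ∑ aₙ (L+n-1 choose n)^{1/2} zⁿ`. For i.i.d. standard complex normal
coefficients it converges on the unit disc almost surely; only its values there are used. -/
noncomputable def gaf (L : ℝ) (a : ℕ → ℂ) (z : ℂ) : ℂ :=
  ∑' n : ℕ, a n * (Real.sqrt (binom L n) : ℂ) * z ^ n

/-- The number of zeros of `f` in the open disc `D(0,r)`, counted with multiplicity. -/
noncomputable def zeroCount (f : ℂ → ℂ) (r : ℝ) : ℕ :=
  ∑ᶠ z ∈ Metric.ball (0 : ℂ) r, analyticOrderNatAt f z

/-- The random variable `n_L(r)`, for the random coefficient sequence `a`. -/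
noncomputable def numZeros {Ω : Type*} (a : ℕ → Ω → ℂ) (L r : ℝ) (ω : Ω) : ℝ :=
  zeroCount (gaf L (fun n => a n ω)) r

/-- The integrand `1 / ((1+x²)^L - 1) · x² / (1+x²)`. -/
noncomputable def integrand (L x : ℝ) : ℝ :=
  1 / ((1 + x ^ 2) ^ L - 1) * (x ^ 2 / (1 + x ^ 2))

/-- The constant `c_L` for `L > 1/2`, as an integral. -/
noncomputable def cHigh (L : ℝ) : ℝ :=
  L ^ 2 / (2 * Real.pi) * ∫ x in Set.Ioi (0 : ℝ), integrand L x

/-- The summand `Γ(Ln - 1/2) / Γ(Ln + 1)`. -/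
noncomputable def gammaTerm (L : ℝ) (n : ℕ) : ℝ :=
  Real.Gamma (L * n - 1 / 2) / Real.Gamma (L * n + 1)

/-- The constant `c_L` for `L < 1/2`. -/
noncomputable def cLow (L : ℝ) : ℝ :=
  L ^ 2 * Real.Gamma (1 / 2 - L) / (4 * Real.sqrt Real.pi * Real.Gamma (1 - L))

end HyperbolicGAF

/-! The variance has a closed form for every r in (0,1), and the three regimes are read off from it.
Write g for `integrand L` and l = 2r/(1-r²). Then Var n_L(r) = (L²/π)(l/2)² ∫_0^π g(l sin(θ/2)) dθ;
this is `varianceFormula`, and `memLp_numZeros_and_variance` establishes it.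

The closed form comes from Jensen's formula: as a function of log s, the average of log|f_L| over
|z| = s is piecewise linear and convex, with left slope n_L(r) at s = r. So n_L(r) is a limit of
difference quotients, dominated by a square integrable quotient over a slightly larger annulus, and
variances pass to the limit (`IsRegularSeq.memLp_and_variance`). The variance of a quotient is a
second difference of covariances of circle averages. At two points with squared correlation ρ, the
covariance of the log moduli is ¼ Σ ρ^m/m² (from `IsGaussianPair.integral_log_mul_log`). Since ρ^m
is the squared correlation of parameter Lm, Parseval on circles applies for each m and turns the
second difference into Σ m⁻² times the mean over α of |p_σ^m - p_τ^m|², where p_τ(α) =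
(1+τ(1-e^{iα}))^{-L} and τ = s²/(1-s²) (`corrAverage_second_difference`). After division by (σ-τ)²,
letting τ → σ cancels the weight m⁻² and leaves the geometric series Σ |p|^{2(m-1)}|p'|², which sums
to a multiple of g (`tendsto_diffSeries`).

For the asymptotics, l(1-r) → 1, while g is decreasing on (0,∞) and behaves like x^{-2L} at
infinity. Comparing sin x with x yields (l/2)∫_0^π g(l sin(θ/2)) dθ ≈ ∫_0^l g (`le_arcIntegral`,
`arcIntegral_le`) as long as angles away from 0 are negligible. For L > 1/2 the limit is ∫_0^∞ g,
uniformly in L > 1 because the tails are uniformly small relative to the full integral; for L = 1/2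
it is log l. For L < 1/2 all angles contribute, and l^{2L} g(l sin(θ/2)) converges to
sin(θ/2)^{-2L}, whose integral is a Beta value. -/

namespace HyperbolicGAF

/-! ### The function g_L: monotonicity, bounds, integrability. -/

lemma one_lt_one_add_sq_rpow {L x : ℝ} (hL : 0 < L) (hx : x ≠ 0) : 1 < (1 + x ^ 2) ^ L :=
  Real.one_lt_rpow (by have := pow_pos (abs_pos.2 hx) 2; rw [sq_abs] at this; linarith) hL

lemma integrand_zero (L : ℝ) : integrand L 0 = 0 := by simp [integrand]

lemma integrand_nonneg {L : ℝ} (hL : 0 < L) (x : ℝ) : 0 ≤ integrand L x := by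
  have h : (1 : ℝ) ≤ (1 + x ^ 2) ^ L :=
    Real.one_le_rpow (by nlinarith [sq_nonneg x]) hL.le
  unfold integrand
  exact mul_nonneg (div_nonneg zero_le_one (by linarith)) (by positivity)

lemma integrand_pos {L x : ℝ} (hL : 0 < L) (hx : x ≠ 0) : 0 < integrand L x := by
  have h := one_lt_one_add_sq_rpow hL hx
  have h2 : 0 < x ^ 2 := by positivity
  unfold integrand
  exact mul_pos (div_pos one_pos (by linarith)) (by positivity)

lemma measurable_integrand (L : ℝ) : Measurable (integrand L) := by
  unfold integrand
  fun_prop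

lemma integrand_eq_div {L x : ℝ} :
    integrand L x = x ^ 2 / ((1 + x ^ 2) ^ (L + 1) - (1 + x ^ 2)) := by
  have h : (0 : ℝ) < 1 + x ^ 2 := by positivity
  unfold integrand
  rw [Real.rpow_add h, Real.rpow_one, div_mul_div_comm, one_mul]
  congr 1; ring

/-- With w = 1+x², the reciprocal of the integrand is the slope of the chord of w ↦ w^{L+1} - w from
1 to w, as this function vanishes at 1. Chord slopes of a convex function increase. -/
lemma integrand_antitoneOn {L : ℝ} (hL : 0 < L) : AntitoneOn (integrand L) (Set.Ioi 0) := by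
  intro x hx y hy hxy
  have hx : 0 < x := hx
  have hy : 0 < y := hy
  rcases hxy.eq_or_lt with rfl | hlt
  · exact le_rfl
  have hcv : ConvexOn ℝ (Set.Ici (0 : ℝ)) (fun w : ℝ => w ^ (L + 1) - w) :=
    (convexOn_rpow (by linarith)).sub (concaveOn_id (convex_Ici 0))
  have hsq : x ^ 2 < y ^ 2 := by gcongr
  have hx2 : 0 < x ^ 2 := by positivity
  have hsec := hcv.secant_mono (a := 1) (x := 1 + x ^ 2) (y := 1 + y ^ 2)
    (by simp) (by simp; positivity) (by simp; positivity)
    (by linarith) (by linarith) (by linarith)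
  simp only [Real.one_rpow, sub_self, sub_zero, add_sub_cancel_left] at hsec
  rw [integrand_eq_div, integrand_eq_div]
  have h1 := one_lt_one_add_sq_rpow hL hx.ne'
  have hpos : 0 < (1 + x ^ 2) ^ (L + 1) - (1 + x ^ 2) := by
    rw [Real.rpow_add (by positivity), Real.rpow_one]
    nlinarith
  rw [← inv_div, ← inv_div _ (x ^ 2)]
  exact inv_anti₀ (by positivity) hsec

/-- Bernoulli's inequality in both cases: for L ≤ 1 it is applied to ((1+x²)⁻¹)^L, for L ≥ 1 to
(1+x²)^L. The exponent is integrable exactly when L > 1/2, and it is the sharp decay rate for L ≤ 1.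
-/
lemma integrand_le_rpow {L : ℝ} (hL : 0 < L) (x : ℝ) :
    integrand L x ≤ 1 / L * (1 + x ^ 2) ^ (-min L 1) := by
  rcases eq_or_ne x 0 with rfl | hx
  · rw [integrand_zero]; positivity
  have h1 := one_lt_one_add_sq_rpow hL hx
  have hx2 : 0 < x ^ 2 := by positivity
  have hw : (0 : ℝ) < 1 + x ^ 2 := by positivity
  unfold integrand
  rw [div_mul_div_comm, one_mul, Real.rpow_neg hw.le, ← one_div, div_mul_div_comm, one_mul]
  rw [div_le_div_iff₀ (mul_pos (by linarith) hw) (by positivity), one_mul]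
  rcases le_total L 1 with hL1 | hL1
  · rw [min_eq_left hL1]
    have hb := rpow_one_add_le_one_add_mul_self (s := (1 + x ^ 2)⁻¹ - 1)
      (by have : 0 < (1 + x ^ 2)⁻¹ := by positivity
          linarith) hL.le hL1
    rw [add_sub_cancel, Real.inv_rpow hw.le] at hb
    have hwL : 0 < (1 + x ^ 2) ^ L := by positivity
    have e : (1 + x ^ 2)⁻¹ - 1 = - (x ^ 2 / (1 + x ^ 2)) := by field_simp; ring
    rw [e] at hb
    have := mul_le_mul_of_nonneg_left hb (mul_pos hwL hw).le
    have e1 : (1 + x ^ 2) ^ L * (1 + x ^ 2) * ((1 + x ^ 2) ^ L)⁻¹ = 1 + x ^ 2 := by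
      field_simp
    have e2 : (1 + x ^ 2) ^ L * (1 + x ^ 2) * (1 + L * -(x ^ 2 / (1 + x ^ 2)))
      = (1 + x ^ 2) ^ L * (1 + x ^ 2) - (x ^ 2 * (L * (1 + x ^ 2) ^ L)) := by
      field_simp; ring
    rw [e1, e2] at this
    linarith
  · rw [min_eq_right hL1, Real.rpow_one]
    have hb := one_add_mul_self_le_rpow_one_add (s := x ^ 2) (by linarith) hL1
    nlinarith

lemma integrand_le_inv {L : ℝ} (hL : 0 < L) (x : ℝ) : integrand L x ≤ 1 / L := by
  refine (integrand_le_rpow hL x).trans ?_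
  have : (1 + x ^ 2) ^ (-min L 1) ≤ 1 :=
    Real.rpow_le_one_of_one_le_of_nonpos (by nlinarith [sq_nonneg x])
      (by simp [hL.le])
  exact mul_le_of_le_one_right (by positivity) this

/-- Bernoulli with exponent (L+1)/2, then squared, makes the denominator quadratic in L. The factor
L⁻² matters: the full integral is bounded below only by order L^{-3/2}, so a tail bound of order 1/L
would not be uniform. -/
lemma integrand_le_inv_sq {L x : ℝ} (hL : 1 ≤ L) (hx : 0 < x) :
    integrand L x ≤ 4 / L ^ 2 * x ^ (-2 : ℝ) := by
  have hw : (0 : ℝ) < 1 + x ^ 2 := by positivity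
  rw [integrand_eq_div, Real.rpow_neg hx.le, Real.rpow_two, ← one_div, div_mul_div_comm, mul_one]
  have hb := one_add_mul_self_le_rpow_one_add (s := x ^ 2) (p := (L + 1) / 2)
    (by nlinarith [sq_nonneg x]) (by linarith)
  have hpos : 0 ≤ 1 + (L + 1) / 2 * x ^ 2 := by positivity
  have h2 := pow_le_pow_left₀ hpos hb 2
  have e : ((1 + x ^ 2) ^ ((L + 1) / 2)) ^ 2 = (1 + x ^ 2) ^ (L + 1) := by
    rw [← Real.rpow_mul_natCast hw.le]; congr 1; push_cast; ring
  rw [e] at h2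
  have key : L ^ 2 * x ^ 4 / 4 ≤ (1 + x ^ 2) ^ (L + 1) - (1 + x ^ 2) := by
    nlinarith [mul_pos (show 0 < L by linarith) (pow_pos hx 2), pow_pos hx 4,
      mul_pos (show 0 < L by linarith) (pow_pos hx 4)]
  rw [div_le_div_iff₀ (lt_of_lt_of_le (by positivity) key) (by positivity)]
  nlinarith

lemma integrableOn_one_add_sq_rpow_neg {p : ℝ} (hp : 1 / 2 < p) :
    Integrable (fun x : ℝ => (1 + x ^ 2) ^ (-p)) := by
  have := integrable_rpow_neg_one_add_norm_sq (E := ℝ) (μ := volume) (r := 2 * p)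
    (by simp; linarith)
  convert this using 2 with x
  · rw [Real.norm_eq_abs, sq_abs]
    congr 1; ring

lemma integrableOn_integrand {L : ℝ} (hL : 1 / 2 < L) :
    Integrable (integrand L) := by
  have hp : 1 / 2 < min L 1 := lt_min hL (by norm_num)
  refine ((integrableOn_one_add_sq_rpow_neg hp).const_mul (1 / L)).mono'
    (measurable_integrand L).aestronglyMeasurable (ae_of_all _ fun x => ?_)
  rw [Real.norm_of_nonneg (integrand_nonneg (by linarith) x)]
  exact integrand_le_rpow (by linarith) x

/-! ### The two expressions for c_L when L > 1/2. -/

lemma integrableOn_sq_mul_rpow {p : ℝ} (hp : 1 / 2 < p) :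
    IntegrableOn (fun y : ℝ => y ^ 2 * (1 + y ^ 2) ^ (-(p + 1))) (Set.Ioi 0) := by
  refine ((integrableOn_one_add_sq_rpow_neg hp).mono'
    (by fun_prop) (ae_of_all _ fun x => ?_)).integrableOn
  have hw : (0 : ℝ) < 1 + x ^ 2 := by positivity
  rw [Real.norm_of_nonneg (by positivity), neg_add, Real.rpow_add hw, Real.rpow_neg_one]
  have : 0 < (1 + x ^ 2) ^ (-p) := by positivity
  rw [← div_eq_mul_inv, ← mul_div_assoc, div_le_iff₀ hw]
  nlinarith [sq_nonneg x]

/-- The power of 1+y² is written as a Gamma integral over t. After exchanging integrals the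
y-integral is a Gaussian second moment, and the remaining t-integral is again a Gamma integral. -/
lemma integral_sq_mul_rpow {p : ℝ} (hp : 1 / 2 < p) :
    ∫ y in Set.Ioi (0 : ℝ), y ^ 2 * (1 + y ^ 2) ^ (-(p + 1)) =
      Real.sqrt Real.pi / 4 * (Real.Gamma (p - 1 / 2) / Real.Gamma (p + 1)) := by
  have hG : 0 < Real.Gamma (p + 1) := Real.Gamma_pos_of_pos (by linarith)
  set F : ℝ → ℝ → ℝ := fun y t => y ^ 2 * (t ^ (p + 1 - 1) * Real.exp (-((1 + y ^ 2) * t)))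
  have hFt (y : ℝ) : ∫ t in Set.Ioi (0 : ℝ), F y t =
      Real.Gamma (p + 1) * (y ^ 2 * (1 + y ^ 2) ^ (-(p + 1))) := by
    have hw : (0 : ℝ) < 1 + y ^ 2 := by positivity
    rw [integral_const_mul, Real.integral_rpow_mul_exp_neg_mul_Ioi (by linarith) hw,
      one_div, Real.inv_rpow hw.le, ← Real.rpow_neg hw.le]
    ring
  have hFy (t : ℝ) (ht : 0 < t) : ∫ y in Set.Ioi (0 : ℝ), F y t =
      Real.sqrt Real.pi / 4 * (t ^ (p - 1 / 2 - 1) * Real.exp (-(1 * t))) := by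
    have h := integral_rpow_mul_exp_neg_mul_rpow (p := 2) (q := 2) (b := t) (by norm_num)
      (by norm_num) ht
    have e : ∀ y : ℝ, F y t = t ^ (p + 1 - 1) * Real.exp (-t) *
        (y ^ (2 : ℝ) * Real.exp (-t * y ^ (2 : ℝ))) := by
      intro y
      simp only [F, Real.rpow_two]
      rw [show -((1 + y ^ 2) * t) = -t + -t * y ^ 2 by ring, Real.exp_add]
      ring
    simp_rw [e]
    rw [integral_const_mul, h]
    have hg : Real.Gamma ((2 + 1) / 2) = Real.sqrt Real.pi / 2 := by
      rw [show ((2 : ℝ) + 1) / 2 = 1 / 2 + 1 by norm_num, Real.Gamma_add_one (by norm_num),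
        Real.Gamma_one_half_eq]
      ring
    rw [hg, show p - 1 / 2 - 1 = (p + 1 - 1) + (-(2 + 1) / 2) by ring, Real.rpow_add ht, one_mul]
    ring
  have hm : Measurable (Function.uncurry F) := by
    simp only [F, Function.uncurry_def]; fun_prop
  have hint : Integrable (Function.uncurry F)
      ((volume.restrict (Set.Ioi (0 : ℝ))).prod (volume.restrict (Set.Ioi (0 : ℝ)))) := by
    rw [integrable_prod_iff hm.aestronglyMeasurable]
    constructor
    · refine ae_of_all _ fun y => ?_
      have hw : (0 : ℝ) < 1 + y ^ 2 := by positivity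
      have := integrableOn_rpow_mul_exp_neg_mul_rpow (p := 1) (s := p + 1 - 1) (b := 1 + y ^ 2)
        (by linarith) one_pos hw
      simp only [Real.rpow_one] at this
      refine (Integrable.const_mul this (y ^ 2)).congr (ae_of_all _ fun t => ?_)
      simp only [F, Function.uncurry_apply_pair]
      rw [neg_mul]
    · refine (((integrableOn_sq_mul_rpow hp).const_mul (Real.Gamma (p + 1)))).congr
        (ae_of_all _ fun y => ?_)
      simp only
      rw [← hFt y]
      refine setIntegral_congr_fun measurableSet_Ioi fun t (ht : 0 < t) => ?_
      simp only [Function.uncurry_apply_pair]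
      rw [Real.norm_of_nonneg (by simp only [F]; positivity)]
  have hsw := integral_integral_swap hint
  simp_rw [hFt] at hsw
  rw [setIntegral_congr_fun measurableSet_Ioi fun t ht => hFy t ht, integral_const_mul,
    integral_const_mul, Real.integral_rpow_mul_exp_neg_mul_Ioi (by linarith) one_pos] at hsw
  simp only [div_one, Real.one_rpow, one_mul] at hsw
  rw [← mul_div_assoc, eq_div_iff hG.ne', ← hsw]
  ring

/-- Expansion of 1/(w^L - 1) as a geometric series in w^{-L}, where w = 1+y² > 1. -/
lemma hasSum_integrand {L y : ℝ} (hL : 0 < L) (hy : y ≠ 0) :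
    HasSum (fun n : ℕ => y ^ 2 * (1 + y ^ 2) ^ (-(L * (n + 1) + 1))) (integrand L y) := by
  have h1 := one_lt_one_add_sq_rpow hL hy
  have hw : (0 : ℝ) < 1 + y ^ 2 := by positivity
  have hg := (hasSum_geometric_of_lt_one (r := ((1 + y ^ 2) ^ L)⁻¹) (by positivity)
    (inv_lt_one_of_one_lt₀ h1)).mul_left (y ^ 2 * ((1 + y ^ 2) ^ L)⁻¹ * (1 + y ^ 2)⁻¹)
  refine (congrArg₂ (fun f a => HasSum (L := .unconditional ℕ) f a) ?_ ?_).mpr hg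
  · ext n
    rw [neg_add, Real.rpow_add hw, Real.rpow_neg_one, Real.rpow_neg hw.le, mul_add, mul_one,
      Real.rpow_add hw, Real.rpow_mul hw.le, Real.rpow_natCast, mul_inv, inv_pow]
    ring
  · unfold integrand
    have : (1 + y ^ 2) ^ L - 1 ≠ 0 := by linarith
    field_simp

lemma hasSum_gammaTerm {L : ℝ} (hL : 1 / 2 < L) :
    HasSum (fun n : ℕ => Real.sqrt Real.pi / 4 * gammaTerm L (n + 1))
      (∫ x in Set.Ioi (0 : ℝ), integrand L x) := by
  have hL0 : 0 < L := by linarith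
  have hp (n : ℕ) : 1 / 2 < L * (n + 1) := by
    have : (0 : ℝ) ≤ n := n.cast_nonneg
    nlinarith
  set F : ℕ → ℝ → ℝ := fun n y => y ^ 2 * (1 + y ^ 2) ^ (-(L * (n + 1) + 1))
  have hF0 (n : ℕ) (y : ℝ) : 0 ≤ F n y := by simp only [F]; positivity
  have hFi (n : ℕ) : IntegrableOn (F n) (Set.Ioi 0) := integrableOn_sq_mul_rpow (hp n)
  have hFn (n : ℕ) : ∫ y in Set.Ioi (0 : ℝ), F n y =
      Real.sqrt Real.pi / 4 * gammaTerm L (n + 1) := by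
    simp only [F, gammaTerm]
    rw [integral_sq_mul_rpow (hp n)]
    push_cast; rfl
  -- All terms are nonnegative, so the partial sums of the integrals are bounded by the integral of
  -- the full series; no asymptotics of Gamma quotients is needed.
  have hsum : Summable fun n => ∫ y in Set.Ioi (0 : ℝ), ‖F n y‖ := by
    refine summable_of_sum_le (c := ∫ x in Set.Ioi (0 : ℝ), integrand L x)
      (fun n => integral_nonneg fun y => norm_nonneg _) fun u => ?_
    rw [← integral_finsetSum _ fun n _ => (hFi n).norm]
    refine setIntegral_mono_on (integrable_finsetSum _ fun n _ => (hFi n).norm)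
      (integrableOn_integrand hL).integrableOn measurableSet_Ioi fun y (hy : 0 < y) => ?_
    have := hasSum_integrand hL0 hy.ne'
    rw [← this.tsum_eq]
    simp_rw [Real.norm_of_nonneg (hF0 _ y)]
    exact this.summable.sum_le_tsum u fun n _ => hF0 n y
  have h := hasSum_integral_of_summable_integral_norm hFi hsum
  simp_rw [hFn] at h
  rwa [setIntegral_congr_fun measurableSet_Ioi fun y (hy : 0 < y) =>
    (hasSum_integrand hL0 hy.ne').tsum_eq] at h

lemma cHigh_eq_tsum {L : ℝ} (hL : 1 / 2 < L) :
    cHigh L = L ^ 2 / (8 * Real.sqrt Real.pi) * ∑' n : ℕ, gammaTerm L (n + 1) := by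
  rw [cHigh, ← (hasSum_gammaTerm hL).tsum_eq, tsum_mul_left]
  have h : Real.sqrt Real.pi ≠ 0 := by positivity
  nth_rewrite 1 [← Real.mul_self_sqrt Real.pi_pos.le]
  field_simp
  ring

lemma summable_gammaTerm {L : ℝ} (hL : 1 / 2 < L) :
    Summable fun n : ℕ => gammaTerm L (n + 1) := by
  have h : Real.sqrt Real.pi / 4 ≠ 0 := by positivity
  exact (summable_mul_left_iff h).1 (hasSum_gammaTerm hL).summable

lemma integral_integrand_pos {L : ℝ} (hL : 1 / 2 < L) :
    0 < ∫ x in Set.Ioi (0 : ℝ), integrand L x := by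
  rw [setIntegral_pos_iff_support_of_nonneg_ae
    (ae_of_all _ fun x => integrand_nonneg (by linarith) x)
    (integrableOn_integrand hL).integrableOn]
  have : Set.Ioi (0 : ℝ) ⊆ Function.support (integrand L) := fun x (hx : 0 < x) =>
    (integrand_pos (by linarith) hx.ne').ne'
  rw [Set.inter_eq_right.2 this]
  simp

/-! ### Comparison of the arc integral with a half-line integral. -/

/-- The half-circle integral `∫₀^π g_L(l sin(θ/2)) dθ`. -/
noncomputable def arcIntegral (L l : ℝ) : ℝ :=
  ∫ θ in (0 : ℝ)..Real.pi, integrand L (l * Real.sin (θ / 2))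

/-- The closed form of the variance of `n_L(r)`. -/
noncomputable def varianceFormula (L r : ℝ) : ℝ :=
  L ^ 2 * (r / (1 - r ^ 2)) ^ 2 * (1 / Real.pi * arcIntegral L (2 * (r / (1 - r ^ 2))))

lemma intervalIntegrable_integrand_comp {L : ℝ} (hL : 0 < L) {φ : ℝ → ℝ} (hφ : Measurable φ)
    (a b : ℝ) : IntervalIntegrable (fun x => integrand L (φ x)) volume a b := by
  have h : IntegrableOn (fun x => integrand L (φ x)) (Set.uIoc a b) := by
    refine Integrable.mono' (g := fun _ => 1 / L) (integrableOn_const (by simp))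
      ((measurable_integrand L).comp hφ).aestronglyMeasurable (ae_of_all _ fun x => ?_)
    rw [Real.norm_of_nonneg (integrand_nonneg hL _)]
    exact integrand_le_inv hL _
  exact intervalIntegrable_iff.2 h

lemma intervalIntegrable_integrand {L : ℝ} (hL : 0 < L) (a b : ℝ) :
    IntervalIntegrable (integrand L) volume a b :=
  intervalIntegrable_integrand_comp hL measurable_id a b

/-- Since sin(θ/2) ≤ θ/2 and g decreases, rescaling gives the integral of g up to lπ/2, which
exceeds l. -/
lemma le_arcIntegral {L l : ℝ} (hL : 0 < L) (hl : 0 < l) :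
    ∫ y in (0 : ℝ)..l, integrand L y ≤ l / 2 * arcIntegral L l := by
  have h1 : ∫ θ in (0 : ℝ)..Real.pi, integrand L (l / 2 * θ) ≤ arcIntegral L l := by
    refine intervalIntegral.integral_mono_on_of_le_Ioo Real.pi_pos.le
      (intervalIntegrable_integrand_comp hL (by fun_prop) _ _)
      (intervalIntegrable_integrand_comp hL (by fun_prop) _ _) fun θ hθ => ?_
    have hs : 0 < Real.sin (θ / 2) :=
      Real.sin_pos_of_pos_of_lt_pi (by linarith [hθ.1]) (by linarith [hθ.1, hθ.2])
    have hs2 := Real.sin_le (x := θ / 2) (by linarith [hθ.1])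
    refine integrand_antitoneOn hL (mul_pos hl hs) (mul_pos (half_pos hl) hθ.1) ?_
    nlinarith
  rw [intervalIntegral.integral_comp_mul_left _ (by positivity)] at h1
  have h2 := mul_le_mul_of_nonneg_left h1 (half_pos hl).le
  rw [smul_eq_mul, mul_inv_cancel_left₀ (by positivity), mul_zero] at h2
  refine le_trans ?_ h2
  have hpi := Real.pi_gt_three
  refine intervalIntegral.integral_mono_interval le_rfl hl.le (by nlinarith)
    (ae_of_all _ fun y => integrand_nonneg hL y) (intervalIntegrable_integrand hL _ _)

/-- The arc is cut at θ = 2η. Below the cut sin x ≥ kx costs only the factor 1/k, which can be taken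
close to 1. Above it the cruder Jordan bound sin x ≥ 2x/π suffices, because the resulting integral
starts at a point proportional to l. -/
lemma arcIntegral_le {L l k η : ℝ} (hL : 0 < L) (hl : 0 < l) (hk : 0 < k) (hη : 0 < η)
    (hη2 : η ≤ 1) (hsin : ∀ x, 0 < x → x ≤ η → k * x ≤ Real.sin x) :
    l / 2 * arcIntegral L l ≤ 1 / k * (∫ y in (0 : ℝ)..(k * l * η), integrand L y) +
      Real.pi / 2 * ∫ y in (2 * l * η / Real.pi)..l, integrand L y := by
  have hpi := Real.pi_gt_three
  have hsplit : arcIntegral L l = (∫ θ in (0 : ℝ)..(2 * η), integrand L (l * Real.sin (θ / 2))) +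
      ∫ θ in (2 * η)..Real.pi, integrand L (l * Real.sin (θ / 2)) :=
    (intervalIntegral.integral_add_adjacent_intervals
      (intervalIntegrable_integrand_comp hL (by fun_prop) _ _)
      (intervalIntegrable_integrand_comp hL (by fun_prop) _ _)).symm
  have h1 : ∫ θ in (0 : ℝ)..(2 * η), integrand L (l * Real.sin (θ / 2)) ≤
      ∫ θ in (0 : ℝ)..(2 * η), integrand L (k * l / 2 * θ) := by
    refine intervalIntegral.integral_mono_on_of_le_Ioo (by linarith)
      (intervalIntegrable_integrand_comp hL (by fun_prop) _ _)
      (intervalIntegrable_integrand_comp hL (by fun_prop) _ _) fun θ hθ => ?_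
    have hs := hsin (θ / 2) (by linarith [hθ.1]) (by linarith [hθ.2])
    have h0 : 0 < k * (θ / 2) := mul_pos hk (by linarith [hθ.1])
    refine integrand_antitoneOn hL (mul_pos (by positivity) hθ.1)
      (mul_pos hl (by linarith)) ?_
    nlinarith
  have h2 : ∫ θ in (2 * η)..Real.pi, integrand L (l * Real.sin (θ / 2)) ≤
      ∫ θ in (2 * η)..Real.pi, integrand L (l / Real.pi * θ) := by
    refine intervalIntegral.integral_mono_on_of_le_Ioo (by linarith)
      (intervalIntegrable_integrand_comp hL (by fun_prop) _ _)
      (intervalIntegrable_integrand_comp hL (by fun_prop) _ _) fun θ hθ => ?_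
    have hθ0 : 0 < θ := by linarith [hθ.1]
    have hs := Real.mul_le_sin (x := θ / 2) (by linarith) (by linarith [hθ.2])
    have e : 2 / Real.pi * (θ / 2) = θ / Real.pi := by ring
    rw [e] at hs
    have h0 : 0 < θ / Real.pi := by positivity
    have h3 : 0 < l / Real.pi * θ := by positivity
    refine integrand_antitoneOn hL h3 (mul_pos hl (by linarith)) ?_
    calc l / Real.pi * θ = l * (θ / Real.pi) := by ring
      _ ≤ _ := by gcongr
  rw [intervalIntegral.integral_comp_mul_left _ (by positivity), smul_eq_mul] at h1 h2
  rw [hsplit, mul_add]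
  refine add_le_add ?_ ?_
  · refine (mul_le_mul_of_nonneg_left h1 (half_pos hl).le).trans (le_of_eq ?_)
    rw [mul_zero, show k * l / 2 * (2 * η) = k * l * η by ring]
    field_simp
  · refine (mul_le_mul_of_nonneg_left h2 (half_pos hl).le).trans (le_of_eq ?_)
    rw [show l / Real.pi * (2 * η) = 2 * l * η / Real.pi by ring, div_mul_cancel₀ _ (by positivity)]
    field_simp

lemma exists_mul_le_sin {k : ℝ} (hk : k < 1) :
    ∃ η : ℝ, 0 < η ∧ η ≤ 1 ∧ ∀ x, 0 < x → x ≤ η → k * x ≤ Real.sin x := by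
  refine ⟨min 1 (1 - k), lt_min one_pos (by linarith), min_le_left _ _, fun x hx hxη => ?_⟩
  have h1 : x ≤ 1 := hxη.trans (min_le_left _ _)
  have h2 : x ≤ 1 - k := hxη.trans (min_le_right _ _)
  have h3 := Real.sin_gt_sub_cube hx
  have h4 : x ^ 3 ≤ (1 - k) * x := by nlinarith [mul_pos hx hx]
  have h5 : 0 < x ^ 3 := by positivity
  nlinarith

/-- Splits off the factor (l/2) · `arcIntegral`, the quantity comparable to the integral of g over
[0,l]; one power of l remains and accounts for 1/(1-r). -/
lemma varianceFormula_eq (L r : ℝ) :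
    varianceFormula L r = L ^ 2 / (2 * Real.pi) * (2 * (r / (1 - r ^ 2))) *
      ((2 * (r / (1 - r ^ 2))) / 2 * arcIntegral L (2 * (r / (1 - r ^ 2)))) := by
  unfold varianceFormula
  field_simp

/-- Tails of the integral are uniformly negligible over `S`. -/
def UniformTails (S : Set ℝ) : Prop :=
  ∀ ε : ℝ, 0 < ε → ∃ B₀ : ℝ, 0 < B₀ ∧ ∀ L ∈ S, ∀ B, B₀ ≤ B →
    ∫ x in Set.Ioi B, integrand L x ≤ ε * ∫ x in Set.Ioi (0 : ℝ), integrand L x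

/-- The ratio to be controlled is l(1-r) · I/J with J the full integral of g and I = (l/2) ·
`arcIntegral`. The first factor does not involve L, and the second depends on L only through the
tails, so uniform tails give a δ independent of L. -/
lemma varianceFormula_uniform {S : Set ℝ} (hS : ∀ L ∈ S, 1 / 2 < L) (ht : UniformTails S) (ε : ℝ)
    (hε : 0 < ε) : ∃ δ : ℝ, 0 < δ ∧ ∀ L ∈ S, ∀ r : ℝ, 0 < r → 1 - δ < r → r < 1 →
      |varianceFormula L r / (cHigh L / (1 - r)) - 1| < ε := by
  -- The final bounds are (1-e)² from below and 1+3e from above, so e = ε/8 leaves room to spare.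
  set e : ℝ := min ε 1 / 8 with he
  have he0 : 0 < e := by positivity
  have he1 : e ≤ 1 / 8 := by
    have := min_le_right ε 1; linarith
  have hee : 8 * e ≤ ε := by
    have := min_le_left ε 1; linarith
  have hk1 : (1 + e)⁻¹ < 1 := inv_lt_one_of_one_lt₀ (by linarith)
  obtain ⟨η, hη, hη1, hsin⟩ := exists_mul_le_sin hk1
  obtain ⟨B₀, hB₀, hB⟩ := ht e he0
  -- Once l ≥ Λ, both tails in play, the one from l and the one from 2lη/π, start beyond B₀.
  set Λ : ℝ := max B₀ (B₀ * Real.pi / (2 * η)) with hΛ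
  have hΛ0 : 0 < Λ := lt_max_of_lt_left hB₀
  refine ⟨min e (1 / (2 * Λ)), by positivity, fun L hL r hr0 hrδ hr1 => ?_⟩
  have hL' := hS L hL
  have hLp : 0 < L := by linarith
  have hr2 : 1 - r < e := by
    have := min_le_left e (1 / (2 * Λ)); linarith
  have hr3 : 1 - r < 1 / (2 * Λ) := by
    have := min_le_right e (1 / (2 * Λ)); linarith
  set l : ℝ := 2 * (r / (1 - r ^ 2)) with hl
  have h1r : 0 < 1 - r := by linarith
  have h1r2 : 0 < 1 - r ^ 2 := by nlinarith
  have hl0 : 0 < l := by positivity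
  have hlr : l * (1 - r) = 2 * r / (1 + r) := by
    rw [hl, show 1 - r ^ 2 = (1 - r) * (1 + r) by ring]
    field_simp
  have hκ1 : l * (1 - r) ≤ 1 := by
    rw [hlr, div_le_one (by linarith)]; linarith
  have hκ2 : 1 - e ≤ l * (1 - r) := by
    rw [hlr, le_div_iff₀ (by linarith)]; nlinarith
  have hΛl : Λ ≤ l := by
    rw [lt_div_iff₀ (by positivity)] at hr3
    by_contra hcon
    push Not at hcon
    have : l * (1 - r) < Λ * (1 - r) := by gcongr
    nlinarith
  set J := ∫ x in Set.Ioi (0 : ℝ), integrand L x with hJ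
  have hJ0 : 0 < J := integral_integrand_pos hL'
  have hgi := integrableOn_integrand hL'
  have hsplit (b : ℝ) (hb : 0 ≤ b) :
      ∫ y in (0 : ℝ)..b, integrand L y = J - ∫ x in Set.Ioi b, integrand L x := by
    rw [intervalIntegral.integral_of_le hb, hJ, ← Set.Ioc_union_Ioi_eq_Ioi hb,
      setIntegral_union Set.Ioc_disjoint_Ioi_same measurableSet_Ioi hgi.integrableOn
        hgi.integrableOn]
    ring
  have htail (b : ℝ) : 0 ≤ ∫ x in Set.Ioi b, integrand L x :=
    integral_nonneg fun x => integrand_nonneg hLp x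
  have hlow := le_arcIntegral hLp hl0
  have hup := arcIntegral_le hLp hl0 (inv_pos.2 (by linarith : 0 < 1 + e)) hη hη1 hsin
  set I := l / 2 * arcIntegral L l with hI
  have hlow' : (1 - e) * J ≤ I := by
    rw [hsplit l hl0.le] at hlow
    have := hB L hL l ((le_max_left _ _).trans hΛl)
    linarith
  have hup' : I ≤ (1 + 3 * e) * J := by
    have h1 : ∫ y in (0 : ℝ)..((1 + e)⁻¹ * l * η), integrand L y ≤ J := by
      rw [hsplit _ (by positivity)]
      linarith [htail ((1 + e)⁻¹ * l * η)]
    have h2 : ∫ y in (2 * l * η / Real.pi)..l, integrand L y ≤ e * J := by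
      have hle : 2 * l * η / Real.pi ≤ l := by
        rw [div_le_iff₀ Real.pi_pos]; nlinarith [Real.pi_gt_three]
      rw [intervalIntegral.integral_of_le hle]
      refine (setIntegral_mono_set hgi.integrableOn (ae_of_all _ fun x => integrand_nonneg hLp x)
        Set.Ioc_subset_Ioi_self.eventuallyLE).trans (hB L hL _ ?_)
      have h3 : B₀ * Real.pi / (2 * η) ≤ l := (le_max_right _ _).trans hΛl
      rw [div_le_iff₀ (by positivity)] at h3
      rw [le_div_iff₀ Real.pi_pos]
      linarith
    rw [one_div, inv_inv] at hup
    have hpi := Real.pi_lt_four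
    have h4 : (1 + e) * ∫ y in (0 : ℝ)..((1 + e)⁻¹ * l * η), integrand L y ≤ (1 + e) * J := by
      gcongr
    have h5 : Real.pi / 2 * ∫ y in (2 * l * η / Real.pi)..l, integrand L y ≤ 2 * (e * J) := by
      have : Real.pi / 2 * ∫ y in (2 * l * η / Real.pi)..l, integrand L y ≤
        Real.pi / 2 * (e * J) := by gcongr
      nlinarith [mul_pos he0 hJ0]
    linarith
  have hratio : varianceFormula L r / (cHigh L / (1 - r)) = l * (1 - r) * (I / J) := by
    rw [varianceFormula_eq, cHigh, ← hl, ← hI, ← hJ]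
    field_simp
  rw [hratio]
  have hR1 : 1 - e ≤ I / J := (le_div_iff₀ hJ0).2 hlow'
  have hR2 : I / J ≤ 1 + 3 * e := (div_le_iff₀ hJ0).2 hup'
  have hR0 : 0 ≤ I / J := by linarith
  have hlo : (1 - e) * (1 - e) ≤ l * (1 - r) * (I / J) :=
    mul_le_mul hκ2 hR1 (by linarith) (by linarith)
  have hhi : l * (1 - r) * (I / J) ≤ 1 * (I / J) := mul_le_mul_of_nonneg_right hκ1 hR0
  have hsq : 1 - 2 * e ≤ (1 - e) * (1 - e) := by linarith [mul_self_nonneg e]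
  rw [abs_lt]
  constructor <;> linarith

lemma uniformTails_singleton {L : ℝ} (hL : 1 / 2 < L) : UniformTails {L} := by
  intro ε hε
  have hJ := mul_pos hε (integral_integrand_pos hL)
  have hgi := integrableOn_integrand hL
  have ht := intervalIntegral_tendsto_integral_Ioi 0 hgi.integrableOn tendsto_id
  have hev := (ht.eventually (lt_mem_nhds (sub_lt_self _ hJ))).and (eventually_gt_atTop 0)
  obtain ⟨B₀, hB₀, hpos⟩ := hev.exists
  refine ⟨B₀, hpos, fun L' hL' B hB => ?_⟩
  rw [Set.mem_singleton_iff] at hL'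
  subst hL'
  have h1 : ∫ x in Set.Ioi B, integrand L' x ≤ ∫ x in Set.Ioi B₀, integrand L' x :=
    setIntegral_mono_set hgi.integrableOn
      (ae_of_all _ fun x => integrand_nonneg (by linarith) x)
      (Set.Ioi_subset_Ioi hB).eventuallyLE
  have h2 : ∫ x in Set.Ioi (0 : ℝ), integrand L' x =
      (∫ x in (0 : ℝ)..B₀, integrand L' x) + ∫ x in Set.Ioi B₀, integrand L' x := by
    rw [intervalIntegral.integral_of_le hpos.le, ← Set.Ioc_union_Ioi_eq_Ioi hpos.le,
      setIntegral_union Set.Ioc_disjoint_Ioi_same measurableSet_Ioi hgi.integrableOn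
        hgi.integrableOn]
  simp only [id] at hB₀
  linarith

/-- The tail beyond B is at most 4/(L²B). The full integral is at least the mass on (0, L^{-1/2}],
which by monotonicity is at least L^{-1/2} times the value at the right end. -/
lemma uniformTails_Ioi_one : UniformTails (Set.Ioi 1) := by
  intro ε hε
  refine ⟨24 / ε, by positivity, fun L (hL : 1 < L) B hB => ?_⟩
  have hL0 : 0 < L := by linarith
  have hB0 : 0 < B := lt_of_lt_of_le (by positivity) hB
  have hgi := integrableOn_integrand (L := L) (by linarith)
  have htail : ∫ x in Set.Ioi B, integrand L x ≤ 4 / L ^ 2 * B⁻¹ := by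
    have h1 : ∫ x in Set.Ioi B, integrand L x ≤
        ∫ x in Set.Ioi B, 4 / L ^ 2 * x ^ (-2 : ℝ) := by
      refine setIntegral_mono_on hgi.integrableOn
        ((integrableOn_Ioi_rpow_of_lt (by norm_num) hB0).const_mul _) measurableSet_Ioi
        fun x hx => integrand_le_inv_sq hL.le (hB0.trans hx)
    refine h1.trans (le_of_eq ?_)
    rw [integral_const_mul, integral_Ioi_rpow_of_lt (by norm_num) hB0]
    norm_num
    exact Or.inl (Real.rpow_neg_one B)
  have hs : 0 < (Real.sqrt L)⁻¹ := by positivity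
  have hs2 : ((Real.sqrt L)⁻¹) ^ 2 = 1 / L := by
    rw [inv_pow, Real.sq_sqrt hL0.le, one_div]
  -- At x² = 1/L the power (1+1/L)^L is at most e < 3, so the denominator (1+x²)^L - 1 is below 2.
  have hval : 1 / ((L + 1) * 2) ≤ integrand L (Real.sqrt L)⁻¹ := by
    unfold integrand
    rw [hs2]
    have hexp : (1 + 1 / L) ^ L ≤ Real.exp 1 := by
      have h := Real.add_one_le_exp (1 / L)
      calc (1 + 1 / L) ^ L ≤ (Real.exp (1 / L)) ^ L :=
            Real.rpow_le_rpow (by positivity) (by linarith) hL0.le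
        _ = Real.exp 1 := by rw [← Real.exp_mul]; congr 1; field_simp
    have hone : 1 < (1 + 1 / L) ^ L :=
      Real.one_lt_rpow (by have : 0 < 1 / L := by positivity
                           linarith) hL0
    have he := Real.exp_one_lt_d9
    have e1 : 1 / L / (1 + 1 / L) = 1 / (L + 1) := by field_simp
    rw [e1, one_div_mul_one_div]
    refine one_div_le_one_div_of_le (mul_pos (by linarith) (by linarith)) ?_
    nlinarith
  have hJ : (Real.sqrt L)⁻¹ * (1 / ((L + 1) * 2)) ≤ ∫ x in Set.Ioi (0 : ℝ), integrand L x := by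
    have h1 : ∫ x in Set.Ioc 0 (Real.sqrt L)⁻¹, integrand L (Real.sqrt L)⁻¹ ≤
        ∫ x in Set.Ioc 0 (Real.sqrt L)⁻¹, integrand L x :=
      setIntegral_mono_on (integrableOn_const (by simp)) hgi.integrableOn measurableSet_Ioc
        fun x hx => integrand_antitoneOn hL0 hx.1 hs hx.2
    have h2 : ∫ x in Set.Ioc 0 (Real.sqrt L)⁻¹, integrand L x ≤
        ∫ x in Set.Ioi (0 : ℝ), integrand L x :=
      setIntegral_mono_set hgi.integrableOn (ae_of_all _ fun x => integrand_nonneg hL0 x)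
        Set.Ioc_subset_Ioi_self.eventuallyLE
    rw [setIntegral_const, Measure.real, Real.volume_Ioc, ENNReal.toReal_ofReal (by linarith),
      sub_zero, smul_eq_mul] at h1
    refine le_trans ?_ (h1.trans h2)
    gcongr
  refine htail.trans (le_trans ?_ (mul_le_mul_of_nonneg_left hJ hε.le))
  have hsq : Real.sqrt L ≤ L := by
    rw [Real.sqrt_le_left hL0.le]; nlinarith
  have hinv : L⁻¹ ≤ (Real.sqrt L)⁻¹ := inv_anti₀ (by positivity) hsq
  have hBε : B⁻¹ ≤ ε / 24 := by
    rw [← inv_div]; exact inv_anti₀ (by positivity) hB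
  calc 4 / L ^ 2 * B⁻¹ ≤ 4 / L ^ 2 * (ε / 24) := by gcongr
    _ = ε * (1 / (6 * L ^ 2)) := by field_simp; norm_num
    _ ≤ ε * (L⁻¹ * (1 / ((L + 1) * 2))) := by
        gcongr
        rw [← one_div, one_div_mul_one_div]
        refine one_div_le_one_div_of_le (by positivity) ?_
        nlinarith
    _ ≤ _ := by gcongr

/-! ### The scale l = 2r/(1-r²), and the critical case L = 1/2. -/

lemma tendsto_scale : Tendsto (fun r : ℝ => 2 * (r / (1 - r ^ 2))) (𝓝[<] 1) atTop := by
  have h1 : Tendsto (fun r : ℝ => (1 - r ^ 2)) (𝓝[<] 1) (𝓝[>] 0) := by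
    refine tendsto_nhdsWithin_iff.2 ⟨?_, ?_⟩
    · have : Tendsto (fun r : ℝ => 1 - r ^ 2) (𝓝 1) (𝓝 (1 - 1 ^ 2)) :=
        (by fun_prop : Continuous fun r : ℝ => 1 - r ^ 2).tendsto 1
      simpa using this.mono_left nhdsWithin_le_nhds
    · filter_upwards [Ioo_mem_nhdsLT (show (0 : ℝ) < 1 by norm_num)] with r hr
      have := hr.1
      have := hr.2
      simp only [Set.mem_Ioi]
      nlinarith
  have h2 : Tendsto (fun r : ℝ => 2 * r) (𝓝[<] 1) (𝓝 2) := by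
    have : Tendsto (fun r : ℝ => 2 * r) (𝓝 1) (𝓝 (2 * 1)) :=
        (by fun_prop : Continuous fun r : ℝ => 2 * r).tendsto 1
    simpa using this.mono_left nhdsWithin_le_nhds
  have h3 := h2.pos_mul_atTop two_pos (tendsto_inv_nhdsGT_zero.comp h1)
  refine h3.congr fun r => ?_
  simp only [Function.comp_apply]
  ring

lemma tendsto_scale_mul :
    Tendsto (fun r : ℝ => 2 * (r / (1 - r ^ 2)) * (1 - r)) (𝓝[<] 1) (𝓝 1) := by
  have h : Tendsto (fun r : ℝ => 2 * r / (1 + r)) (𝓝[<] 1) (𝓝 1) := by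
    have h1 : ContinuousAt (fun r : ℝ => 2 * r / (1 + r)) 1 :=
      ContinuousAt.div (by fun_prop) (by fun_prop) (by norm_num)
    have h2 := h1.tendsto
    norm_num at h2
    exact h2.mono_left nhdsWithin_le_nhds
  refine h.congr' ?_
  filter_upwards [Ioo_mem_nhdsLT (show (0 : ℝ) < 1 by norm_num)] with r hr
  have h1 : 1 - r ≠ 0 := by linarith [hr.2]
  have h2 : 1 + r ≠ 0 := by linarith [hr.1]
  rw [show 1 - r ^ 2 = (1 - r) * (1 + r) by ring]
  field_simp

/-- With s = √(1+y²) the integrand is (s²-1)/((s-1)s²) = (s+1)/s². -/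
lemma integrand_half {y : ℝ} (hy : y ≠ 0) :
    integrand (1 / 2) y = 1 / Real.sqrt (1 + y ^ 2) + 1 / (1 + y ^ 2) := by
  have hw : (0 : ℝ) < 1 + y ^ 2 := by positivity
  have h1 : 1 < Real.sqrt (1 + y ^ 2) := by
    rw [Real.lt_sqrt (by norm_num)]
    have : 0 < y ^ 2 := by positivity
    linarith
  unfold integrand
  rw [← Real.sqrt_eq_rpow]
  set s := Real.sqrt (1 + y ^ 2) with hs
  have e : y ^ 2 = s ^ 2 - 1 := by rw [hs, Real.sq_sqrt hw.le]; ring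
  rw [e]
  have : s - 1 ≠ 0 := by linarith
  have : s ≠ 0 := by linarith
  field_simp
  ring

lemma log_le_integral_integrand_half {l : ℝ} (hl : 0 < l) :
    Real.log l ≤ ∫ y in (0 : ℝ)..l, integrand (1 / 2) y := by
  have h1 : ∫ y in (0 : ℝ)..l, (y + 1)⁻¹ = Real.log (l + 1) := by
    rw [intervalIntegral.integral_comp_add_right (fun y => y⁻¹), integral_inv_of_pos (by norm_num)
      (by linarith)]
    simp
  have hi : IntervalIntegrable (fun y : ℝ => (y + 1)⁻¹) volume 0 l := by
    refine ContinuousOn.intervalIntegrable fun x hx => ContinuousAt.continuousWithinAt ?_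
    rw [Set.uIcc_of_le hl.le] at hx
    exact ContinuousAt.inv₀ (by fun_prop) (by linarith [hx.1])
  calc Real.log l ≤ Real.log (l + 1) := Real.log_le_log hl (by linarith)
    _ = ∫ y in (0 : ℝ)..l, (y + 1)⁻¹ := h1.symm
    _ ≤ _ := by
      refine intervalIntegral.integral_mono_on_of_le_Ioo hl.le hi
        (intervalIntegrable_integrand (by norm_num) _ _) fun y hy => ?_
      have hy0 := hy.1
      rw [integrand_half hy0.ne', ← one_div]
      have h2 : Real.sqrt (1 + y ^ 2) ≤ y + 1 := by
        rw [Real.sqrt_le_left (by linarith)]; nlinarith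
      have h3 : 1 / (y + 1) ≤ 1 / Real.sqrt (1 + y ^ 2) := by gcongr
      have h4 : 0 < 1 / (1 + y ^ 2) := by positivity
      linarith

lemma integral_integrand_half_le {b : ℝ} (hb : 1 ≤ b) :
    ∫ y in (0 : ℝ)..b, integrand (1 / 2) y ≤ 3 + Real.log b := by
  have hh : (0 : ℝ) < 1 / 2 := by norm_num
  rw [← intervalIntegral.integral_add_adjacent_intervals
    (intervalIntegrable_integrand hh 0 1) (intervalIntegrable_integrand hh 1 b)]
  have h1 : ∫ y in (0 : ℝ)..1, integrand (1 / 2) y ≤ 2 := by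
    have := intervalIntegral.integral_mono_on zero_le_one (intervalIntegrable_integrand hh 0 1)
      (intervalIntegrable_const (c := 2)) fun y _ => by
        have := integrand_le_inv hh y
        norm_num at this ⊢
        exact this
    simpa using this
  have hi : IntervalIntegrable (fun y : ℝ => y⁻¹ + y ^ (-2 : ℤ)) volume 1 b := by
    refine ContinuousOn.intervalIntegrable fun x hx => ContinuousAt.continuousWithinAt ?_
    rw [Set.uIcc_of_le hb] at hx
    have hx0 : x ≠ 0 := by linarith [hx.1]
    exact (continuousAt_inv₀ hx0).add (continuousAt_zpow₀ _ _ (Or.inl hx0))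
  have h2 : ∫ y in (1 : ℝ)..b, integrand (1 / 2) y ≤ ∫ y in (1 : ℝ)..b, (y⁻¹ + y ^ (-2 : ℤ)) := by
    refine intervalIntegral.integral_mono_on hb (intervalIntegrable_integrand hh 1 b) hi
      fun y hy => ?_
    have hy0 : 0 < y := by linarith [hy.1]
    rw [integrand_half hy0.ne']
    have h3 : y ≤ Real.sqrt (1 + y ^ 2) := Real.le_sqrt_of_sq_le (by linarith)
    rw [← one_div, zpow_neg, ← one_div]
    refine add_le_add (by gcongr) ?_
    refine one_div_le_one_div_of_le (by positivity) ?_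
    norm_cast
    linarith
  have h3 : ∫ y in (1 : ℝ)..b, (y⁻¹ + y ^ (-2 : ℤ)) ≤ Real.log b + 1 := by
    rw [intervalIntegral.integral_add, integral_inv_of_pos one_pos (by linarith), integral_zpow]
    · have : 0 < b⁻¹ := by positivity
      norm_num
      linarith
    · right
      refine ⟨by norm_num, ?_⟩
      rw [Set.uIcc_of_le hb]
      intro h
      linarith [h.1]
    · refine intervalIntegral.intervalIntegrable_inv (fun x hx => ?_) continuousOn_id
      rw [Set.uIcc_of_le hb] at hx
      linarith [hx.1]
    · refine intervalIntegral.intervalIntegrable_zpow (Or.inr ?_)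
      rw [Set.uIcc_of_le hb]
      intro h
      linarith [h.1]
  linarith

/-- Used on [cl, l] with c fixed: there the bound depends only on the ratio of the endpoints, so
angles away from 0 contribute O(1) against log l. -/
lemma integral_integrand_half_le_log {c b : ℝ} (hc : 0 < c) (hcb : c ≤ b) :
    ∫ y in c..b, integrand (1 / 2) y ≤ (1 + 1 / c) * Real.log (b / c) := by
  have hi : IntervalIntegrable (fun y : ℝ => (1 + 1 / c) * y⁻¹) volume c b := by
    refine ContinuousOn.intervalIntegrable fun x hx => ContinuousAt.continuousWithinAt ?_
    rw [Set.uIcc_of_le hcb] at hx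
    have hx0 : x ≠ 0 := by linarith [hx.1]
    exact continuousAt_const.mul (continuousAt_inv₀ hx0)
  have h2 : ∫ y in c..b, integrand (1 / 2) y ≤ ∫ y in c..b, (1 + 1 / c) * y⁻¹ := by
    refine intervalIntegral.integral_mono_on hcb
      (intervalIntegrable_integrand (by norm_num) c b) hi fun y hy => ?_
    have hy0 : 0 < y := by linarith [hy.1]
    rw [integrand_half hy0.ne']
    have h3 : y ≤ Real.sqrt (1 + y ^ 2) := Real.le_sqrt_of_sq_le (by linarith)
    have h4 : 1 / Real.sqrt (1 + y ^ 2) ≤ y⁻¹ := by rw [← one_div]; gcongr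
    have h5 : 1 / (1 + y ^ 2) ≤ 1 / c * y⁻¹ := by
      rw [← one_div, one_div_mul_one_div]
      refine one_div_le_one_div_of_le (by positivity) ?_
      nlinarith [hy.1]
    rw [add_mul, one_mul]
    exact add_le_add h4 h5
  rw [intervalIntegral.integral_const_mul, integral_inv_of_pos hc (by linarith)] at h2
  exact h2

lemma tendsto_arcIntegral_half :
    Tendsto (fun l : ℝ => l / 2 * arcIntegral (1 / 2) l / Real.log l) atTop (𝓝 1) := by
  have hh : (0 : ℝ) < 1 / 2 := by norm_num
  refine tendsto_order.2 ⟨fun a ha => ?_, fun a ha => ?_⟩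
  · filter_upwards [eventually_gt_atTop 1] with l hl
    have h1 := (log_le_integral_integrand_half (by linarith)).trans
      (le_arcIntegral (l := l) hh (by linarith))
    have h2 := Real.log_pos hl
    exact ha.trans_le ((one_le_div h2).2 h1)
  -- Chosen so that 1/k = (1+a)/2 lies strictly between 1 and a.
  · set k : ℝ := 2 / (1 + a) with hk
    have hk0 : 0 < k := by positivity
    have hk1 : k < 1 := by rw [hk, div_lt_one (by linarith)]; linarith
    have hka : 1 / k < a := by rw [hk, one_div_div]; linarith
    obtain ⟨η, hη, hη1, hsin⟩ := exists_mul_le_sin hk1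
    set C : ℝ := 1 / k * 3 + Real.pi / 2 * ((1 + 1 / 1) * Real.log (Real.pi / (2 * η))) with hC
    have hlim : Tendsto (fun l : ℝ => 1 / k + C / Real.log l) atTop (𝓝 (1 / k + 0)) :=
      tendsto_const_nhds.add (tendsto_const_nhds.div_atTop Real.tendsto_log_atTop)
    rw [add_zero] at hlim
    filter_upwards [hlim.eventually (gt_mem_nhds hka), eventually_gt_atTop 1,
      eventually_gt_atTop (1 / (k * η)), eventually_gt_atTop (Real.pi / (2 * η))]
      with l hl hl1 hl2 hl3
    have hl0 : 0 < l := by linarith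
    refine lt_of_le_of_lt ?_ hl
    have hlog := Real.log_pos hl1
    rw [div_le_iff₀ hlog, add_mul, div_mul_cancel₀ _ hlog.ne']
    refine (arcIntegral_le hh hl0 hk0 hη hη1 hsin).trans ?_
    rw [div_lt_iff₀ (by positivity)] at hl2 hl3
    have h1 : ∫ y in (0 : ℝ)..(k * l * η), integrand (1 / 2) y ≤ 3 + Real.log l := by
      refine (integral_integrand_half_le (by nlinarith)).trans ?_
      have : k * l * η ≤ l := by
        have : k * η ≤ 1 := by nlinarith
        nlinarith
      have := Real.log_le_log (by positivity) this
      linarith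
    have hc1 : 1 ≤ 2 * l * η / Real.pi := by
      rw [one_le_div Real.pi_pos]; linarith
    have h2 : ∫ y in (2 * l * η / Real.pi)..l, integrand (1 / 2) y ≤
        (1 + 1 / 1) * Real.log (Real.pi / (2 * η)) := by
      have hle : 2 * l * η / Real.pi ≤ l := by
        rw [div_le_iff₀ Real.pi_pos]; nlinarith [Real.pi_gt_three]
      refine (integral_integrand_half_le_log (by linarith) hle).trans ?_
      have e : l / (2 * l * η / Real.pi) = Real.pi / (2 * η) := by field_simp
      rw [e]
      have : 0 ≤ Real.log (Real.pi / (2 * η)) :=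
        Real.log_nonneg ((one_le_div (by positivity)).2 (by nlinarith [Real.pi_gt_three]))
      gcongr
    have h3 := mul_le_mul_of_nonneg_left h1 (by positivity : 0 ≤ 1 / k)
    have h4 := mul_le_mul_of_nonneg_left h2 (by positivity : 0 ≤ Real.pi / 2)
    rw [hC]
    linarith

lemma tendsto_varianceFormula_half :
    Tendsto (fun r : ℝ => varianceFormula (1 / 2) r /
      (1 / (8 * Real.pi) * (1 / (1 - r)) * Real.log (1 / (1 - r)))) (𝓝[<] 1) (𝓝 1) := by
  have h1 := tendsto_arcIntegral_half.comp tendsto_scale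
  have hinv : Tendsto (fun r : ℝ => 1 / (1 - r)) (𝓝[<] 1) atTop := by
    have h : Tendsto (fun r : ℝ => 1 - r) (𝓝[<] 1) (𝓝[>] 0) := by
      refine tendsto_nhdsWithin_iff.2 ⟨?_, ?_⟩
      · have : Tendsto (fun r : ℝ => 1 - r) (𝓝 1) (𝓝 (1 - 1)) :=
          (by fun_prop : Continuous fun r : ℝ => 1 - r).tendsto 1
        simpa using this.mono_left nhdsWithin_le_nhds
      · filter_upwards [self_mem_nhdsWithin] with r hr
        simpa using hr
    exact (tendsto_inv_nhdsGT_zero.comp h).congr fun r => by simp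
  have hlog := Real.tendsto_log_atTop.comp hinv
  -- This is log l / log(1/(1-r)), written so that the limit is visible: the two logarithms differ
  -- by log(l(1-r)), which tends to 0.
  have h2 : Tendsto (fun r : ℝ => 1 + Real.log (2 * (r / (1 - r ^ 2)) * (1 - r)) /
      Real.log (1 / (1 - r))) (𝓝[<] 1) (𝓝 1) := by
    have := (tendsto_scale_mul.log one_ne_zero).div_atTop hlog
    simpa using this.const_add 1
  have h3 := (tendsto_scale_mul.mul h1).mul h2
  rw [one_mul, one_mul] at h3
  refine h3.congr' ?_
  filter_upwards [Ioo_mem_nhdsLT (show (0 : ℝ) < 1 by norm_num),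
    tendsto_scale.eventually (eventually_gt_atTop 1), hlog.eventually (eventually_gt_atTop 0)]
    with r hr hl hlog0
  simp only [Function.comp_apply] at hlog0 ⊢
  have h1r : 0 < 1 - r := by linarith [hr.2]
  rw [varianceFormula_eq]
  set l := 2 * (r / (1 - r ^ 2)) with hl'
  have hl0 : 0 < l := by linarith
  have e : Real.log (l * (1 - r)) = Real.log l - Real.log (1 / (1 - r)) := by
    rw [Real.log_mul hl0.ne' h1r.ne', one_div, Real.log_inv]; ring
  rw [e]
  have := Real.log_pos hl
  field_simp
  ring

/-! ### The case L < 1/2. -/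

lemma tendsto_rpow_mul_integrand {L : ℝ} (hL : 0 < L) :
    Tendsto (fun y : ℝ => y ^ (2 * L) * integrand L y) atTop (𝓝 1) := by
  have hinv : Tendsto (fun y : ℝ => (y ^ 2)⁻¹) atTop (𝓝 0) :=
    tendsto_inv_atTop_zero.comp (tendsto_pow_atTop two_ne_zero)
  have hinvL : Tendsto (fun y : ℝ => y ^ (-(2 * L))) atTop (𝓝 0) :=
    tendsto_rpow_neg_atTop (by linarith)
  have h1 : Tendsto (fun y : ℝ => (1 + (y ^ 2)⁻¹) ^ L - y ^ (-(2 * L))) atTop (𝓝 1) := by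
    have := ((hinv.const_add 1).rpow_const (p := L) (Or.inr hL.le)).sub hinvL
    simpa using this
  have h2 : Tendsto (fun y : ℝ => 1 + (y ^ 2)⁻¹) atTop (𝓝 1) := by
    simpa using hinv.const_add 1
  have h3 := (h1.mul h2).inv₀ (by norm_num)
  rw [mul_one, inv_one] at h3
  refine h3.congr' ?_
  filter_upwards [eventually_gt_atTop 0] with y hy
  have e1 : y ^ (-(2 * L)) = (y ^ (2 * L))⁻¹ := Real.rpow_neg hy.le _
  have e2 : (1 + (y ^ 2)⁻¹) ^ L = (1 + y ^ 2) ^ L * (y ^ (2 * L))⁻¹ := by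
    rw [Real.rpow_mul hy.le, Real.rpow_two, ← Real.inv_rpow (by positivity),
      ← Real.mul_rpow (by positivity) (by positivity)]
    congr 1
    field_simp
    ring
  rw [e1, e2]
  have := one_lt_one_add_sq_rpow hL hy.ne'
  have h5 : (1 + y ^ 2) ^ L - 1 ≠ 0 := by linarith
  have h6 : y ^ (2 * L) ≠ 0 := by positivity
  unfold integrand
  rw [show (1 + y ^ 2) ^ L * (y ^ (2 * L))⁻¹ - (y ^ (2 * L))⁻¹ =
    ((1 + y ^ 2) ^ L - 1) * (y ^ (2 * L))⁻¹ by ring]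
  field_simp
  ring

lemma integral_rpow_mul_one_sub_rpow {a b : ℝ} (ha : 0 < a) (hb : 0 < b) :
    IntegrableOn (fun x : ℝ => x ^ (a - 1) * (1 - x) ^ (b - 1)) (Set.Ioo 0 1) ∧
    ∫ x in Set.Ioo (0 : ℝ) 1, x ^ (a - 1) * (1 - x) ^ (b - 1) =
      Real.Gamma a * Real.Gamma b / Real.Gamma (a + b) := by
  have hc := Complex.betaIntegral_convergent (u := a) (v := b) (by simpa) (by simpa)
  rw [intervalIntegrable_iff_integrableOn_Ioo_of_le zero_le_one] at hc
  have hco : Set.EqOn (fun x : ℝ => (x : ℂ) ^ ((a : ℂ) - 1) * (1 - (x : ℂ)) ^ ((b : ℂ) - 1))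
      (fun x : ℝ => ((x ^ (a - 1) * (1 - x) ^ (b - 1) : ℝ) : ℂ)) (Set.Ioo 0 1) := by
    intro x hx
    simp only
    rw [Complex.ofReal_mul, Complex.ofReal_cpow hx.1.le, Complex.ofReal_cpow (by linarith [hx.2])]
    push_cast
    rfl
  have hc2 := hc.congr_fun hco measurableSet_Ioo
  have hre : IntegrableOn (fun x : ℝ => x ^ (a - 1) * (1 - x) ^ (b - 1)) (Set.Ioo 0 1) := by
    have h : Integrable _ (volume.restrict (Set.Ioo (0 : ℝ) 1)) := hc2.re
    exact h.congr (ae_of_all _ fun x => by simp)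
  refine ⟨hre, ?_⟩
  have h1 := beta_eq_betaIntegralReal a b ha hb
  rw [beta] at h1
  rw [h1, Complex.betaIntegral, intervalIntegral.integral_of_le zero_le_one,
    integral_Ioc_eq_integral_Ioo, setIntegral_congr_fun measurableSet_Ioo hco,
    integral_complex_ofReal,
    Complex.ofReal_re]

lemma image_sin_half_sq :
    (fun θ : ℝ => Real.sin (θ / 2) ^ 2) '' Set.Ioo 0 Real.pi = Set.Ioo 0 1 := by
  ext t
  constructor
  · rintro ⟨θ, hθ, rfl⟩
    have hs : 0 < Real.sin (θ / 2) :=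
      Real.sin_pos_of_pos_of_lt_pi (by linarith [hθ.1]) (by linarith [hθ.1, hθ.2])
    have hc : 0 < Real.cos (θ / 2) :=
      Real.cos_pos_of_mem_Ioo ⟨by linarith [hθ.1, Real.pi_pos], by linarith [hθ.2]⟩
    refine ⟨by positivity, ?_⟩
    have := Real.sin_sq_add_cos_sq (θ / 2)
    simp only
    nlinarith [pow_pos hc 2]
  · intro ht
    have h0 : 0 < Real.sqrt t := Real.sqrt_pos.2 ht.1
    have h1 : Real.sqrt t < 1 := by rw [Real.sqrt_lt' one_pos]; linarith [ht.2]
    refine ⟨2 * Real.arcsin (Real.sqrt t), ⟨?_, ?_⟩, ?_⟩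
    · have := Real.arcsin_pos.2 h0; linarith
    · have := Real.arcsin_lt_pi_div_two.2 h1; linarith
    · simp only
      rw [mul_div_cancel_left₀ _ two_ne_zero, Real.sin_arcsin (by linarith) h1.le,
        Real.sq_sqrt ht.1.le]

/-- The substitution t = sin²(θ/2) turns this into the Beta integral with parameters 1/2 - L and
1/2. The condition L < 1/2 is exactly integrability at θ = 0. -/
lemma sin_half_rpow {L : ℝ} (hL : L < 1 / 2) :
    IntervalIntegrable (fun θ : ℝ => Real.sin (θ / 2) ^ (-(2 * L))) volume 0 Real.pi ∧
    ∫ θ in (0 : ℝ)..Real.pi, Real.sin (θ / 2) ^ (-(2 * L)) =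
      Real.sqrt Real.pi * Real.Gamma (1 / 2 - L) / Real.Gamma (1 - L) := by
  obtain ⟨hi, hv⟩ := integral_rpow_mul_one_sub_rpow (a := 1 / 2 - L) (b := 1 / 2)
    (by linarith) (by norm_num)
  have hder : ∀ θ ∈ Set.Ioo (0 : ℝ) Real.pi, HasDerivWithinAt
      (fun θ : ℝ => Real.sin (θ / 2) ^ 2) (Real.sin (θ / 2) * Real.cos (θ / 2))
      (Set.Ioo 0 Real.pi) θ := by
    intro θ _
    have h1 : HasDerivAt (fun θ : ℝ => θ / 2) (1 / 2) θ := (hasDerivAt_id θ).div_const 2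
    have h2 := (h1.sin).pow 2
    refine (h2.congr_deriv ?_).hasDerivWithinAt
    push_cast
    ring
  have hinj : Set.InjOn (fun θ : ℝ => Real.sin (θ / 2) ^ 2) (Set.Ioo 0 Real.pi) := by
    refine StrictMonoOn.injOn fun x hx y hy hxy => ?_
    have hs : 0 < Real.sin (x / 2) :=
      Real.sin_pos_of_pos_of_lt_pi (by linarith [hx.1]) (by linarith [hx.1, hx.2])
    have : Real.sin (x / 2) < Real.sin (y / 2) :=
      Real.strictMonoOn_sin ⟨by linarith [hx.1, Real.pi_pos], by linarith [hx.2]⟩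
        ⟨by linarith [hy.1, Real.pi_pos], by linarith [hy.2]⟩ (by linarith)
    gcongr
  have hcongr : Set.EqOn (fun θ : ℝ => |Real.sin (θ / 2) * Real.cos (θ / 2)| •
      ((Real.sin (θ / 2) ^ 2) ^ (1 / 2 - L - 1) *
        (1 - Real.sin (θ / 2) ^ 2) ^ ((1 : ℝ) / 2 - 1)))
      (fun θ => Real.sin (θ / 2) ^ (-(2 * L))) (Set.Ioo 0 Real.pi) := by
    intro θ hθ
    have hs : 0 < Real.sin (θ / 2) :=
      Real.sin_pos_of_pos_of_lt_pi (by linarith [hθ.1]) (by linarith [hθ.1, hθ.2])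
    have hc : 0 < Real.cos (θ / 2) :=
      Real.cos_pos_of_mem_Ioo ⟨by linarith [hθ.1, Real.pi_pos], by linarith [hθ.2]⟩
    have e : 1 - Real.sin (θ / 2) ^ 2 = Real.cos (θ / 2) ^ 2 := by
      linarith [Real.sin_sq_add_cos_sq (θ / 2)]
    simp only [smul_eq_mul]
    rw [e, abs_of_pos (mul_pos hs hc), ← Real.rpow_two, ← Real.rpow_two, ← Real.rpow_mul hs.le,
      ← Real.rpow_mul hc.le, show (2 : ℝ) * (1 / 2 - 1) = -1 by norm_num, Real.rpow_neg_one,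
      show 2 * (1 / 2 - L - 1) = -(2 * L) + -1 by ring, Real.rpow_add hs, Real.rpow_neg_one]
    field_simp
  constructor
  · rw [intervalIntegrable_iff_integrableOn_Ioo_of_le Real.pi_pos.le]
    rw [← image_sin_half_sq, integrableOn_image_iff_integrableOn_abs_deriv_smul measurableSet_Ioo
      hder hinj] at hi
    exact hi.congr_fun hcongr measurableSet_Ioo
  · rw [← image_sin_half_sq, integral_image_eq_integral_abs_deriv_smul measurableSet_Ioo
      hder hinj, setIntegral_congr_fun measurableSet_Ioo hcongr] at hv
    rw [intervalIntegral.integral_of_le Real.pi_pos.le, integral_Ioc_eq_integral_Ioo, hv,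
      Real.Gamma_one_half_eq]
    ring_nf

/-- Dominated convergence: l^{2L} g(l s) tends to s^{-2L} and is at most s^{-2L}/L for every l > 0,
with s = sin(θ/2). -/
lemma tendsto_arcIntegral_low {L : ℝ} (h0 : 0 < L) (hL : L < 1 / 2) :
    Tendsto (fun l : ℝ => l ^ (2 * L) * arcIntegral L l) atTop
      (𝓝 (Real.sqrt Real.pi * Real.Gamma (1 / 2 - L) / Real.Gamma (1 - L))) := by
  obtain ⟨hi, hv⟩ := sin_half_rpow hL
  rw [← hv]
  have key : Tendsto (fun l : ℝ => ∫ θ in (0 : ℝ)..Real.pi,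
      l ^ (2 * L) * integrand L (l * Real.sin (θ / 2))) atTop
      (𝓝 (∫ θ in (0 : ℝ)..Real.pi, Real.sin (θ / 2) ^ (-(2 * L)))) := by
    have hpos : ∀ᵐ θ : ℝ, θ ∈ Set.uIoc 0 Real.pi → 0 < Real.sin (θ / 2) := by
      refine ae_of_all _ fun θ hθ => ?_
      rw [Set.uIoc_of_le Real.pi_pos.le] at hθ
      exact Real.sin_pos_of_pos_of_lt_pi (by linarith [hθ.1]) (by linarith [hθ.1, hθ.2])
    refine intervalIntegral.tendsto_integral_filter_of_dominated_convergence
      (fun θ => 1 / L * Real.sin (θ / 2) ^ (-(2 * L))) ?_ ?_ (hi.const_mul _) ?_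
    · refine Eventually.of_forall fun l => Measurable.aestronglyMeasurable ?_
      exact ((measurable_integrand L).comp (by fun_prop)).const_mul _
    · filter_upwards [eventually_gt_atTop 0] with l hl
      filter_upwards [hpos] with θ hθ hm
      have hs := hθ hm
      have hls : 0 < l * Real.sin (θ / 2) := mul_pos hl hs
      rw [Real.norm_of_nonneg (mul_nonneg (by positivity) (integrand_nonneg h0 _))]
      have h1 := integrand_le_rpow h0 (l * Real.sin (θ / 2))
      rw [min_eq_left (by linarith)] at h1
      have h2 : (1 + (l * Real.sin (θ / 2)) ^ 2) ^ (-L) ≤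
          l ^ (-(2 * L)) * Real.sin (θ / 2) ^ (-(2 * L)) := by
        rw [← Real.mul_rpow hl.le hs.le, show -(2 * L) = 2 * -L by ring, Real.rpow_mul hls.le,
          Real.rpow_two]
        exact Real.rpow_le_rpow_of_nonpos (by positivity) (by linarith) (by linarith)
      calc l ^ (2 * L) * integrand L (l * Real.sin (θ / 2))
          ≤ l ^ (2 * L) * (1 / L * (l ^ (-(2 * L)) * Real.sin (θ / 2) ^ (-(2 * L)))) := by
            gcongr
            refine h1.trans ?_
            gcongr
        _ = _ := by
            rw [Real.rpow_neg hl.le]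
            field_simp
    · filter_upwards [hpos] with θ hθ hm
      have hs := hθ hm
      have h1 := (tendsto_rpow_mul_integrand h0).comp (tendsto_id.atTop_mul_const hs)
      have h2 := h1.const_mul (Real.sin (θ / 2) ^ (-(2 * L)))
      rw [mul_one] at h2
      refine h2.congr' ?_
      filter_upwards [eventually_gt_atTop 0] with l hl
      simp only [Function.comp_apply, id]
      rw [Real.mul_rpow hl.le hs.le, Real.rpow_neg hs.le]
      field_simp
  refine key.congr fun l => ?_
  rw [intervalIntegral.integral_const_mul]
  rfl

lemma tendsto_varianceFormula_low {L : ℝ} (h0 : 0 < L) (hL : L < 1 / 2) :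
    Tendsto (fun r : ℝ => varianceFormula L r / (cLow L / (1 - r) ^ (2 - 2 * L)))
      (𝓝[<] 1) (𝓝 1) := by
  have hG1 : 0 < Real.Gamma (1 / 2 - L) := Real.Gamma_pos_of_pos (by linarith)
  have hG2 : 0 < Real.Gamma (1 - L) := Real.Gamma_pos_of_pos (by linarith)
  have h1 := (tendsto_arcIntegral_low h0 hL).comp tendsto_scale
  have h2 := (tendsto_scale_mul.rpow_const (p := 2 - 2 * L) (Or.inl one_ne_zero)).mul h1
  have h3 := h2.const_mul (L ^ 2 / (4 * Real.pi) / cLow L)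
  have hc : L ^ 2 / (4 * Real.pi) / cLow L * (1 ^ (2 - 2 * L) *
      (Real.sqrt Real.pi * Real.Gamma (1 / 2 - L) / Real.Gamma (1 - L))) = 1 := by
    have hpi : Real.pi = Real.sqrt Real.pi ^ 2 := (Real.sq_sqrt Real.pi_pos.le).symm
    have hsq : 0 < Real.sqrt Real.pi := by positivity
    rw [cLow, Real.one_rpow, one_mul]
    nth_rewrite 1 [hpi]
    generalize Real.Gamma (1 / 2 - L) = G at hG1 ⊢
    field_simp
  rw [hc] at h3
  refine h3.congr' ?_
  filter_upwards [Ioo_mem_nhdsLT (show (0 : ℝ) < 1 by norm_num),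
    tendsto_scale.eventually (eventually_gt_atTop 1)] with r hr hl
  have h1r : 0 < 1 - r := by linarith [hr.2]
  have hcl : 0 < cLow L := by unfold cLow; positivity
  simp only [Function.comp_apply]
  rw [varianceFormula_eq]
  set l := 2 * (r / (1 - r ^ 2))
  have hl0 : 0 < l := by linarith
  rw [Real.mul_rpow hl0.le h1r.le, show (2 - 2 * L) = 2 + -(2 * L) by ring, Real.rpow_add hl0,
    Real.rpow_neg hl0.le, Real.rpow_two]
  field_simp
  norm_num

/-! ### Complex Gaussian pairs through characteristic functions. -/

/-- The character `w ↦ exp(i Re w)`. -/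
noncomputable def expRe (w : ℂ) : ℂ := Complex.exp ((w.re : ℂ) * Complex.I)

lemma continuous_expRe : Continuous expRe := by unfold expRe; fun_prop

lemma norm_expRe (w : ℂ) : ‖expRe w‖ = 1 := Complex.norm_exp_ofReal_mul_I _

lemma expRe_add (v w : ℂ) : expRe (v + w) = expRe v * expRe w := by
  simp only [expRe, ← Complex.exp_add, Complex.add_re, Complex.ofReal_add, add_mul]

lemma expRe_zero : expRe 0 = 1 := by simp [expRe]

lemma expRe_sum {ι : Type*} (s : Finset ι) (w : ι → ℂ) :
    expRe (∑ i ∈ s, w i) = ∏ i ∈ s, expRe (w i) := by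
  classical
  induction s using Finset.induction_on with
  | empty => simp [expRe_zero]
  | insert i s hi ih => rw [Finset.sum_insert hi, Finset.prod_insert hi, expRe_add, ih]

instance : IsProbabilityMeasure stdComplexNormal :=
  Measure.isProbabilityMeasure_map (by fun_prop)

lemma integral_expRe_stdComplexNormal (c : ℂ) :
    ∫ z, expRe (c * z) ∂stdComplexNormal = (Real.exp (-(‖c‖ ^ 2) / 4) : ℂ) := by
  have hc : Continuous fun z : ℂ => expRe (c * z) := continuous_expRe.comp (by fun_prop)
  rw [stdComplexNormal, integral_map (by fun_prop) hc.aestronglyMeasurable]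
  have h : ∀ x : ℝ × ℝ, expRe (c * Complex.measurableEquivRealProd.symm x) =
      Complex.exp ((c.re : ℂ) * x.1 * Complex.I) *
        Complex.exp ((-c.im : ℝ) * x.2 * Complex.I) := by
    intro x
    simp only [expRe, ← Complex.exp_add]
    congr 1
    have : (c * Complex.measurableEquivRealProd.symm x).re = c.re * x.1 - c.im * x.2 := by
      simp [Complex.measurableEquivRealProd]
    rw [this]
    push_cast
    ring
  simp_rw [h]
  rw [integral_prod_mul (fun x : ℝ => Complex.exp ((c.re : ℂ) * x * Complex.I))
    (fun y : ℝ => Complex.exp ((-c.im : ℝ) * y * Complex.I)), ← charFun_apply_real,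
    ← charFun_apply_real, charFun_gaussianReal, charFun_gaussianReal, ← Complex.exp_add,
    Complex.ofReal_exp]
  congr 1
  rw [← Complex.normSq_eq_norm_sq, Complex.normSq_apply]
  push_cast
  simp
  ring

lemma integral_expRe_prod (p q : ℂ) :
    ∫ z, expRe (p * z.1 + q * z.2) ∂(stdComplexNormal.prod stdComplexNormal) =
      (Real.exp (-(‖p‖ ^ 2 + ‖q‖ ^ 2) / 4) : ℂ) := by
  simp_rw [expRe_add]
  rw [integral_prod_mul (fun x : ℂ => expRe (p * x)) (fun y : ℂ => expRe (q * y)),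
    integral_expRe_stdComplexNormal, integral_expRe_stdComplexNormal, ← Complex.ofReal_mul,
    ← Real.exp_add]
  congr 2
  ring

/-- Every real-linear functional T on ℂ² has the form Re(p z₁ + q z₂), with p = T(1,0) - iT(i,0) and
q likewise, so these integrals are the whole characteristic function. -/
lemma ext_of_integral_expRe {μ ν : Measure (ℂ × ℂ)} [IsFiniteMeasure μ] [IsFiniteMeasure ν]
    (h : ∀ p q : ℂ, ∫ z, expRe (p * z.1 + q * z.2) ∂μ = ∫ z, expRe (p * z.1 + q * z.2) ∂ν) :
    μ = ν := by
  refine Measure.ext_of_charFunDual (funext fun T => ?_)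
  rw [charFunDual_apply, charFunDual_apply]
  have key : ∀ z : ℂ × ℂ, Complex.exp ((T z : ℂ) * Complex.I) =
      expRe (((T (1, 0) : ℂ) - T (Complex.I, 0) * Complex.I) * z.1 +
        ((T (0, 1) : ℂ) - T (0, Complex.I) * Complex.I) * z.2) := by
    intro z
    have hz : z = z.1.re • ((1 : ℂ), (0 : ℂ)) + z.1.im • (Complex.I, (0 : ℂ)) +
        z.2.re • ((0 : ℂ), (1 : ℂ)) + z.2.im • ((0 : ℂ), Complex.I) := by
      ext <;> simp
    have hT : T z = z.1.re * T (1, 0) + z.1.im * T (Complex.I, 0) + z.2.re * T (0, 1) +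
        z.2.im * T (0, Complex.I) := by
      conv_lhs => rw [hz]
      simp only [map_add, map_smul, smul_eq_mul]
    rw [expRe, hT]
    congr 3
    simp
    ring
  simp_rw [key]
  exact h _ _

/-- A pair of random variables with the characteristic function of `(ζ₁, ρ ζ₁ + σ ζ₂)`. -/
def IsGaussianPair {Ω : Type*} [MeasurableSpace Ω] (P : Measure Ω) (X Y : Ω → ℂ) (ρ σ : ℂ) : Prop :=
  ∀ p q : ℂ, ∫ ω, expRe (p * X ω + q * Y ω) ∂P =
    (Real.exp (-(‖p + q * ρ‖ ^ 2 + ‖q * σ‖ ^ 2) / 4) : ℂ)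

lemma IsGaussianPair.map_eq {Ω : Type*} [MeasurableSpace Ω] {P : Measure Ω}
    [IsProbabilityMeasure P] {X Y : Ω → ℂ} (hX : Measurable X) (hY : Measurable Y) {ρ σ : ℂ}
    (h : IsGaussianPair P X Y ρ σ) :
    P.map (fun ω => (X ω, Y ω)) = (stdComplexNormal.prod stdComplexNormal).map
      fun z : ℂ × ℂ => (z.1, ρ * z.1 + σ * z.2) := by
  have : IsProbabilityMeasure (P.map (fun ω => (X ω, Y ω))) :=
    Measure.isProbabilityMeasure_map (by fun_prop)
  have : IsProbabilityMeasure ((stdComplexNormal.prod stdComplexNormal).map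
      fun z : ℂ × ℂ => (z.1, ρ * z.1 + σ * z.2)) :=
    Measure.isProbabilityMeasure_map (by fun_prop)
  refine ext_of_integral_expRe fun p q => ?_
  have hc : Continuous fun z : ℂ × ℂ => expRe (p * z.1 + q * z.2) :=
    continuous_expRe.comp (by fun_prop)
  rw [integral_map (by fun_prop) hc.aestronglyMeasurable,
    integral_map (by fun_prop) hc.aestronglyMeasurable, h p q, ← integral_expRe_prod]
  refine integral_congr_ae (ae_of_all _ fun z => ?_)
  simp only
  congr 1
  ring

/-- The characteristic function sees the second coefficient only through its modulus. Besides
supplying the model pair, this freedom of phase gives rotation invariance. -/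
lemma isGaussianPair_linear (ρ σ τ : ℂ) (h : ‖σ‖ = ‖τ‖) :
    IsGaussianPair (stdComplexNormal.prod stdComplexNormal) (fun z => z.1)
      (fun z => ρ * z.1 + τ * z.2) ρ σ := by
  intro p q
  have : ∀ z : ℂ × ℂ, p * z.1 + q * (ρ * z.1 + τ * z.2) = (p + q * ρ) * z.1 + (q * τ) * z.2 :=
    fun z => by ring
  simp_rw [this]
  rw [integral_expRe_prod, norm_mul, norm_mul, h]

lemma IsGaussianPair.map_snd {Ω : Type*} [MeasurableSpace Ω] {P : Measure Ω}
    [IsProbabilityMeasure P] {X Y : Ω → ℂ} (hY : Measurable Y) {ρ σ : ℂ}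
    (h : IsGaussianPair P X Y ρ σ) (h1 : ‖ρ‖ ^ 2 + ‖σ‖ ^ 2 = 1) :
    P.map Y = stdComplexNormal := by
  -- Padding with a constant second coordinate lets the uniqueness statement for pairs serve for one
  -- variable.
  have e : P.map (fun ω => (Y ω, (0 : ℂ))) = stdComplexNormal.map fun z : ℂ => (z, (0 : ℂ)) := by
    have : IsProbabilityMeasure (P.map (fun ω => (Y ω, (0 : ℂ)))) :=
      Measure.isProbabilityMeasure_map (by fun_prop)
    have : IsProbabilityMeasure (stdComplexNormal.map fun z : ℂ => (z, (0 : ℂ))) :=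
      Measure.isProbabilityMeasure_map (by fun_prop)
    refine ext_of_integral_expRe fun p q => ?_
    have hc : Continuous fun z : ℂ × ℂ => expRe (p * z.1 + q * z.2) :=
      continuous_expRe.comp (by fun_prop)
    rw [integral_map (by fun_prop) hc.aestronglyMeasurable,
      integral_map (by fun_prop) hc.aestronglyMeasurable]
    simp only [mul_zero, add_zero]
    have := h 0 p
    simp only [zero_mul, zero_add] at this
    rw [this, integral_expRe_stdComplexNormal, norm_mul, norm_mul, mul_pow, mul_pow, ← mul_add, h1,
      mul_one]
  have e2 := congrArg (fun μ => Measure.map Prod.fst μ) e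
  rw [Measure.map_map (by fun_prop) (by fun_prop),
    Measure.map_map (by fun_prop) (by fun_prop)] at e2
  simpa [Function.comp_def] using e2

lemma IsGaussianPair.map_fst {Ω : Type*} [MeasurableSpace Ω] {P : Measure Ω}
    [IsProbabilityMeasure P] {X Y : Ω → ℂ} (hX : Measurable X) (hY : Measurable Y) {ρ σ : ℂ}
    (h : IsGaussianPair P X Y ρ σ) : P.map X = stdComplexNormal := by
  have e := congrArg (fun μ => Measure.map Prod.fst μ) (h.map_eq hX hY)
  rw [Measure.map_map (by fun_prop) (by fun_prop), Measure.map_map (by fun_prop) (by fun_prop)] at e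
  simp only [Function.comp_def] at e
  rw [e, Measure.map_fst_prod]
  simp

section Series

variable {Ω : Type*} [MeasurableSpace Ω] {P : Measure Ω} [IsProbabilityMeasure P]

omit [IsProbabilityMeasure P] in
lemma integral_expRe_sum {a : ℕ → Ω → ℂ} (ha : ∀ n, Measurable (a n))
    (hlaw : ∀ n, P.map (a n) = stdComplexNormal) (hind : iIndepFun a P) (c : ℕ → ℂ) (N : ℕ) :
    ∫ ω, expRe (∑ n ∈ Finset.range N, c n * a n ω) ∂P =
      (Real.exp (-(∑ n ∈ Finset.range N, ‖c n‖ ^ 2) / 4) : ℂ) := by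
  have hc (w : ℂ) : Continuous fun z : ℂ => expRe (w * z) := continuous_expRe.comp (by fun_prop)
  have h1 : iIndepFun (fun (i : Fin N) ω => a i ω) P := hind.precomp Fin.val_injective
  have h2 := iIndepFun.integral_fun_prod_comp (X := fun (i : Fin N) ω => a i ω)
    (f := fun (i : Fin N) z => expRe (c i * z)) h1 (fun i => (ha i).aemeasurable)
    (fun i => (hc (c i)).aestronglyMeasurable)
  have h3 : ∀ ω, expRe (∑ n ∈ Finset.range N, c n * a n ω) =
      ∏ i : Fin N, expRe (c i * a i ω) := by
    intro ω
    rw [expRe_sum, Finset.prod_range]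
  simp_rw [h3]
  rw [h2]
  have h4 : ∀ i : Fin N, ∫ ω, expRe (c i * a i ω) ∂P = (Real.exp (-(‖c i‖ ^ 2) / 4) : ℂ) := by
    intro i
    rw [← integral_expRe_stdComplexNormal, ← hlaw i, integral_map (ha i).aemeasurable
      (hc _).aestronglyMeasurable]
  simp_rw [h4]
  rw [← Complex.ofReal_prod, ← Real.exp_sum, Finset.sum_range, ← Finset.sum_div,
    Finset.sum_neg_distrib]

/-- Partial sums are handled by independence; the limit passes under the integral because the
character has modulus one. -/
lemma integral_expRe_series {a : ℕ → Ω → ℂ} (ha : ∀ n, Measurable (a n))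
    (hlaw : ∀ n, P.map (a n) = stdComplexNormal) (hind : iIndepFun a P) {c : ℕ → ℂ} {S : ℝ}
    (hS : HasSum (fun n => ‖c n‖ ^ 2) S) {X : Ω → ℂ}
    (hX : ∀ ω, HasSum (fun n => c n * a n ω) (X ω)) :
    ∫ ω, expRe (X ω) ∂P = (Real.exp (-S / 4) : ℂ) := by
  have h1 : Tendsto (fun N => ∫ ω, expRe (∑ n ∈ Finset.range N, c n * a n ω) ∂P) atTop
      (𝓝 (∫ ω, expRe (X ω) ∂P)) := by
    refine tendsto_integral_of_dominated_convergence (fun _ => 1) (fun N => ?_)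
      (integrable_const _) (fun N => ae_of_all _ fun ω => (norm_expRe _).le)
      (ae_of_all _ fun ω => ?_)
    · have : Measurable fun ω => ∑ n ∈ Finset.range N, c n * a n ω := by fun_prop
      exact (continuous_expRe.measurable.comp this).aestronglyMeasurable
    · exact (continuous_expRe.tendsto _).comp (hX ω).tendsto_sum_nat
  simp_rw [integral_expRe_sum ha hlaw hind] at h1
  refine tendsto_nhds_unique h1 ?_
  have h2 : Continuous fun x : ℝ => (Real.exp (-x / 4) : ℂ) := by fun_prop
  exact (h2.tendsto S).comp hS.tendsto_sum_nat

end Series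

/-! ### The squared modulus of a standard complex normal, and its logarithm. -/

/-- The exponential distribution of rate one. -/
noncomputable def expLaw : Measure ℝ :=
  (volume.restrict (Set.Ioi 0)).withDensity fun t => ENNReal.ofReal (Real.exp (-t))

lemma lintegral_stdComplexNormal {F : ℂ → ENNReal} (hF : Measurable F) :
    ∫⁻ z, F z ∂stdComplexNormal =
      ∫⁻ z, ENNReal.ofReal (Real.pi⁻¹ * Real.exp (-‖z‖ ^ 2)) * F z := by
  have hv : ((1 : NNReal) / 2) ≠ 0 := by norm_num
  have hm : Measurable fun x : ℝ × ℝ => gaussianPDF 0 (1 / 2) x.1 * gaussianPDF 0 (1 / 2) x.2 := by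
    fun_prop
  have hg : Measurable fun x : ℝ × ℝ => F (Complex.measurableEquivRealProd.symm x) := by fun_prop
  rw [stdComplexNormal, lintegral_map hF (by fun_prop), gaussianReal_of_var_ne_zero _ hv,
    prod_withDensity (by fun_prop) (by fun_prop),
    lintegral_withDensity_eq_lintegral_mul _ hm hg,
    ← (Complex.volume_preserving_equiv_real_prod.symm).lintegral_comp_emb
      Complex.measurableEquivRealProd.symm.measurableEmbedding]
  refine lintegral_congr fun x => ?_
  simp only [Pi.mul_apply]
  congr 1
  rw [gaussianPDF, gaussianPDF, ← ENNReal.ofReal_mul (gaussianPDFReal_nonneg _ _ _)]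
  congr 1
  rw [gaussianPDFReal, gaussianPDFReal, ← Complex.normSq_eq_norm_sq, Complex.normSq_apply]
  have e : (Real.sqrt (2 * Real.pi * ((1 / 2 : NNReal) : ℝ)))⁻¹ = (Real.sqrt Real.pi)⁻¹ := by
    push_cast
    congr 2
    ring
  rw [e]
  have h2 : Real.pi⁻¹ = (Real.sqrt Real.pi)⁻¹ * (Real.sqrt Real.pi)⁻¹ := by
    rw [← mul_inv, Real.mul_self_sqrt Real.pi_pos.le]
  rw [h2, mul_mul_mul_comm, ← Real.exp_add]
  congr 2
  simp [Complex.measurableEquivRealProd]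
  ring

lemma lintegral_norm_sq_stdComplexNormal {F : ℝ → ENNReal} (hF : Measurable F) :
    ∫⁻ z, F (‖z‖ ^ 2) ∂stdComplexNormal =
      ∫⁻ t in Set.Ioi 0, ENNReal.ofReal (Real.exp (-t)) * F t := by
  have hg : Measurable fun z : ℂ => F (‖z‖ ^ 2) := by fun_prop
  rw [lintegral_stdComplexNormal hg, ← Complex.lintegral_comp_polarCoord_symm]
  simp_rw [Complex.norm_polarCoord_symm, sq_abs, smul_eq_mul]
  have himg : (fun r : ℝ => r ^ 2) '' Set.Ioi 0 = Set.Ioi 0 := by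
    ext t
    constructor
    · rintro ⟨r, hr, rfl⟩
      exact pow_pos (show 0 < r from hr) 2
    · intro ht
      exact ⟨Real.sqrt t, Real.sqrt_pos.2 ht, Real.sq_sqrt (le_of_lt ht)⟩
  rw [← himg, lintegral_image_eq_lintegral_abs_deriv_mul measurableSet_Ioi
    (f' := fun r => 2 * r) (fun r _ => by simpa using (hasDerivAt_pow 2 r).hasDerivWithinAt)
    (fun x hx y hy h => by
      rwa [pow_left_inj₀ (le_of_lt hx) (le_of_lt hy) two_ne_zero] at h)]
  rw [polarCoord_target, Measure.volume_eq_prod, ← Measure.prod_restrict,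
    lintegral_prod _ (by fun_prop)]
  simp only [lintegral_const, Measure.restrict_apply MeasurableSet.univ, Set.univ_inter,
    Real.volume_Ioo]
  refine setLIntegral_congr_fun measurableSet_Ioi fun r (hr : 0 < r) => ?_
  rw [← mul_assoc, mul_right_comm, ← mul_assoc]
  congr 1
  rw [← ENNReal.ofReal_mul hr.le, ← ENNReal.ofReal_mul (by positivity),
    ← ENNReal.ofReal_mul (by positivity), abs_of_pos (by positivity)]
  congr 1
  field_simp
  ring

lemma map_norm_sq_stdComplexNormal :
    stdComplexNormal.map (fun z => ‖z‖ ^ 2) = expLaw := by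
  refine Measure.ext fun s hs => ?_
  rw [← lintegral_indicator_one hs, ← lintegral_indicator_one hs,
    lintegral_map (measurable_one.indicator hs) (by fun_prop),
    lintegral_norm_sq_stdComplexNormal (measurable_one.indicator hs), expLaw,
    lintegral_withDensity_eq_lintegral_mul _ (by fun_prop) (measurable_one.indicator hs)]
  rfl

instance : IsProbabilityMeasure expLaw := by
  rw [← map_norm_sq_stdComplexNormal]
  exact Measure.isProbabilityMeasure_map (by fun_prop)

lemma integral_expLaw (f : ℝ → ℝ) :
    ∫ t, f t ∂expLaw = ∫ t in Set.Ioi 0, Real.exp (-t) * f t := by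
  rw [expLaw, integral_withDensity_eq_integral_toReal_smul (by fun_prop)
    (ae_of_all _ fun _ => ENNReal.ofReal_lt_top)]
  refine integral_congr_ae (ae_of_all _ fun t => ?_)
  simp only [smul_eq_mul]
  rw [ENNReal.toReal_ofReal (Real.exp_pos _).le]

lemma integrable_expLaw_iff {f : ℝ → ℝ} :
    Integrable f expLaw ↔ IntegrableOn (fun t => Real.exp (-t) * f t) (Set.Ioi 0) := by
  rw [expLaw, integrable_withDensity_iff_integrable_smul' (by fun_prop)
    (ae_of_all _ fun _ => ENNReal.ofReal_lt_top), IntegrableOn]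
  refine integrable_congr (ae_of_all _ fun t => ?_)
  simp only [smul_eq_mul]
  rw [ENNReal.toReal_ofReal (Real.exp_pos _).le]

lemma ae_pos_expLaw : ∀ᵐ t ∂expLaw, 0 < t := by
  rw [expLaw]
  exact (withDensity_absolutelyContinuous _ _).ae_le (ae_restrict_mem measurableSet_Ioi)

lemma integral_norm_sq {f : ℝ → ℝ} (hf : Measurable f) :
    ∫ z, f (‖z‖ ^ 2) ∂stdComplexNormal = ∫ t, f t ∂expLaw := by
  rw [← map_norm_sq_stdComplexNormal, integral_map (by fun_prop) hf.aestronglyMeasurable]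

/-- Both |log t| for t ≥ 1 and for t ≤ 1 are bounded by 4 times a quarter power; against e^{-t} the
squares become convergent Gamma integrals. -/
lemma log_sq_le {t : ℝ} (ht : 0 < t) :
    Real.log t ^ 2 ≤ 16 * (t ^ ((1 : ℝ) / 2) + t ^ (-(1 : ℝ) / 2)) := by
  have h1 := Real.log_le_rpow_div ht.le (ε := 1 / 4) (by norm_num)
  have h2 := Real.log_le_rpow_div (inv_pos.2 ht).le (ε := 1 / 4) (by norm_num)
  rw [Real.log_inv, Real.inv_rpow ht.le, ← Real.rpow_neg ht.le] at h2
  have e1 : (t ^ ((1 : ℝ) / 4)) ^ 2 = t ^ ((1 : ℝ) / 2) := by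
    rw [← Real.rpow_mul_natCast ht.le]; norm_num
  have e2 : (t ^ (-((1 : ℝ) / 4))) ^ 2 = t ^ (-(1 : ℝ) / 2) := by
    rw [← Real.rpow_mul_natCast ht.le]; norm_num
  have p1 : 0 < t ^ ((1 : ℝ) / 4) := by positivity
  have p2 : 0 < t ^ (-((1 : ℝ) / 4)) := by positivity
  rw [← e1, ← e2]
  rcases le_total 0 (Real.log t) with h | h
  · nlinarith
  · nlinarith

lemma memLp_log_expLaw : MemLp Real.log 2 expLaw := by
  rw [memLp_two_iff_integrable_sq (by fun_prop), integrable_expLaw_iff]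
  have h1 := (Real.GammaIntegral_convergent (s := 3 / 2) (by norm_num)).add
    (Real.GammaIntegral_convergent (s := 1 / 2) (by norm_num))
  refine Integrable.mono' (h1.const_mul 16) (by fun_prop) ?_
  filter_upwards [ae_restrict_mem measurableSet_Ioi] with t ht
  have ht : 0 < t := ht
  rw [Real.norm_of_nonneg (by positivity)]
  have := mul_le_mul_of_nonneg_left (log_sq_le ht) (Real.exp_pos (-t)).le
  refine this.trans (le_of_eq ?_)
  simp only [Pi.add_apply]
  norm_num
  ring

lemma integrable_log_expLaw : Integrable Real.log expLaw :=
  memLp_log_expLaw.integrable one_le_two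

lemma integrable_id_mul_log_expLaw : Integrable (fun t => |Real.log t| * t) expLaw := by
  have hid : MemLp (fun t : ℝ => t) 2 expLaw := by
    rw [memLp_two_iff_integrable_sq (by fun_prop), integrable_expLaw_iff]
    have h1 := Real.GammaIntegral_convergent (s := 3) (by norm_num)
    refine IntegrableOn.congr_fun h1 (fun t _ => ?_) measurableSet_Ioi
    norm_num
  exact memLp_log_expLaw.abs.integrable_mul hid

/-- The mean of `log T` for an exponential variable (minus the Euler constant). -/
noncomputable def logMean : ℝ := ∫ t, Real.log t ∂expLaw

lemma memLp_log_norm : MemLp (fun z : ℂ => Real.log ‖z‖) 2 stdComplexNormal := by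
  have h := memLp_log_expLaw
  rw [← map_norm_sq_stdComplexNormal, memLp_map_measure_iff (by fun_prop) (by fun_prop)] at h
  refine (h.const_mul (1 / 2)).congr_norm
    (Real.measurable_log.comp measurable_norm).aestronglyMeasurable (ae_of_all _ fun z => ?_)
  simp only [Function.comp_apply, Real.log_pow]
  congr 1
  push_cast
  ring

lemma integral_log_norm : ∫ z, Real.log ‖z‖ ∂stdComplexNormal = 1 / 2 * logMean := by
  rw [logMean, ← integral_norm_sq Real.measurable_log, ← integral_const_mul]
  refine integral_congr_ae (ae_of_all _ fun z => ?_)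
  simp only [Real.log_pow]
  push_cast
  ring

/-- The substitution s = (1+v)t absorbs the extra exponential and shifts the logarithm by log(1+v).
-/
lemma integral_exp_neg_mul_expLaw {v : ℝ} (hv : 0 ≤ v) :
    ∫ t, Real.log t * Real.exp (-(v * t)) ∂expLaw = (logMean - Real.log (1 + v)) / (1 + v) := by
  have hv1 : 0 < 1 + v := by linarith
  have h1 := integral_comp_mul_left_Ioi (fun s => Real.exp (-s) * Real.log s) 0 hv1
  rw [mul_zero, ← integral_expLaw, smul_eq_mul] at h1
  have hexp : ∫ t in Set.Ioi (0 : ℝ), Real.exp (-(1 + v) * t) = (1 + v)⁻¹ := by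
    rw [integral_exp_mul_Ioi (by linarith), mul_zero, Real.exp_zero, neg_div_neg_eq, one_div]
  have hi1 : IntegrableOn (fun t => Real.exp (-(1 + v) * t)) (Set.Ioi 0) :=
    integrableOn_exp_mul_Ioi (by linarith) 0
  have hi2 : IntegrableOn (fun t => Real.exp (-t) * (Real.log t * Real.exp (-(v * t))))
      (Set.Ioi 0) := by
    refine Integrable.mono' (integrable_expLaw_iff.1 integrable_log_expLaw.abs) (by fun_prop) ?_
    filter_upwards [ae_restrict_mem measurableSet_Ioi] with t ht
    have ht : 0 < t := ht
    rw [norm_mul, norm_mul, Real.norm_of_nonneg (Real.exp_pos _).le,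
      Real.norm_of_nonneg (Real.exp_pos _).le, Real.norm_eq_abs]
    have h3 : Real.exp (-(v * t)) ≤ 1 := Real.exp_le_one_iff.2 (by nlinarith)
    exact mul_le_mul_of_nonneg_left (mul_le_of_le_one_right (abs_nonneg _) h3) (Real.exp_pos _).le
  have h2 : ∫ t in Set.Ioi (0 : ℝ), Real.exp (-((1 + v) * t)) * Real.log ((1 + v) * t) =
      Real.log (1 + v) * (1 + v)⁻¹ + ∫ t, Real.log t * Real.exp (-(v * t)) ∂expLaw := by
    rw [integral_expLaw, ← hexp, ← integral_const_mul, ← integral_add (hi1.const_mul _) hi2]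
    refine setIntegral_congr_fun measurableSet_Ioi fun t (ht : 0 < t) => ?_
    rw [Real.log_mul hv1.ne' ht.ne', show -((1 + v) * t) = -t + -(v * t) by ring,
      show -(1 + v) * t = -t + -(v * t) by ring, Real.exp_add]
    ring
  rw [h2] at h1
  change _ = (1 + v)⁻¹ * logMean at h1
  rw [eq_div_iff hv1.ne']
  field_simp at h1
  linarith

lemma expLaw_real_Iio {c : ℝ} (hc : 0 ≤ c) : expLaw.real (Set.Iio c) = 1 - Real.exp (-c) := by
  have h : ∫ t, (Set.Iio c).indicator (fun _ => (1 : ℝ)) t ∂expLaw = expLaw.real (Set.Iio c) := by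
    rw [integral_indicator_const _ measurableSet_Iio]; simp
  rw [← h, integral_expLaw]
  have h2 : ∀ t : ℝ, Real.exp (-t) * (Set.Iio c).indicator (fun _ => (1 : ℝ)) t =
      (Set.Iio c).indicator (fun t => Real.exp (-t)) t := by
    intro t
    by_cases ht : t ∈ Set.Iio c <;> simp [ht]
  simp_rw [h2]
  rw [setIntegral_indicator measurableSet_Iio, Set.Ioi_inter_Iio, ← integral_Ioc_eq_integral_Ioo,
    ← intervalIntegral.integral_of_le hc]
  have h3 := intervalIntegral.integral_comp_neg (a := 0) (b := c) (fun t => Real.exp t)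
  rw [h3, integral_exp]
  simp

/-! ### The dilogarithm from two independent exponential variables. -/

section RealComputation

variable {x : ℝ}

lemma integral_Ioo_inv_mul_one_sub {c : ℝ} (hc : 0 < c) (hx1 : x < 1) (hcx : c ≤ x) :
    ∫ y in Set.Ioo c x, (y * (1 - y))⁻¹ = Real.log (x / (1 - x)) - Real.log (c / (1 - c)) := by
  rw [← integral_Ioc_eq_integral_Ioo, ← intervalIntegral.integral_of_le hcx]
  refine intervalIntegral.integral_eq_sub_of_hasDerivAt
    (f := fun y => Real.log (y / (1 - y))) (fun y hy => ?_) ?_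
  · rw [Set.uIcc_of_le hcx] at hy
    have h0 : 0 < y := by linarith [hy.1]
    have h1 : 0 < 1 - y := by linarith [hy.2]
    have hd : HasDerivAt (fun y : ℝ => y / (1 - y)) ((1 * (1 - y) - y * (-1)) / (1 - y) ^ 2) y :=
      (hasDerivAt_id y).div ((hasDerivAt_id y).const_sub 1) h1.ne'
    refine (hd.log (by positivity)).congr_deriv ?_
    field_simp
    ring
  · refine ContinuousOn.intervalIntegrable fun y hy => ContinuousAt.continuousWithinAt ?_
    rw [Set.uIcc_of_le hcx] at hy
    have h0 : 0 < y := by linarith [hy.1]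
    have h1 : 0 < 1 - y := by linarith [hy.2]
    exact ContinuousAt.inv₀ (by fun_prop) (by positivity)

/-- A layer-cake formula: log(y/(1-y)) is an antiderivative of 1/(y(1-y)), and the indicator
switches on at y = t/(t+a). In this form the dependence on t is through events {t < const}, whose
exponential probabilities are explicit. -/
lemma log_max_sub_log (hx0 : 0 < x) (hx1 : x < 1) {a t : ℝ} (ha : 0 < a) (ht : 0 < t) :
    ∫ y in Set.Ioo 0 x, (Set.Iio (y / (1 - y) * a)).indicator (fun _ => (y * (1 - y))⁻¹) t =
      Real.log (max (x * a) ((1 - x) * t)) - Real.log ((1 - x) * t) := by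
  have h1x : 0 < 1 - x := by linarith
  set c : ℝ := t / (t + a) with hc
  have hc0 : 0 < c := by positivity
  have hc1 : c < 1 := by rw [hc, div_lt_one (by linarith)]; linarith
  have hcc : c / (1 - c) = t / a := by
    have hta : t + a ≠ 0 := by positivity
    rw [hc, one_sub_div hta, add_sub_cancel_left, div_div_div_cancel_right₀ hta]
  have h1 : ∫ y in Set.Ioo 0 x, (Set.Iio (y / (1 - y) * a)).indicator
      (fun _ => (y * (1 - y))⁻¹) t =
      ∫ y in Set.Ioo 0 x, (Set.Ioi c).indicator (fun y => (y * (1 - y))⁻¹) y := by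
    refine setIntegral_congr_fun measurableSet_Ioo fun y hy => ?_
    have h1y : 0 < 1 - y := by linarith [hy.2]
    have hiff : t ∈ Set.Iio (y / (1 - y) * a) ↔ y ∈ Set.Ioi c := by
      simp only [Set.mem_Iio, Set.mem_Ioi, hc]
      rw [div_mul_eq_mul_div, lt_div_iff₀ h1y, div_lt_iff₀ (by linarith)]
      constructor <;> intro h <;> nlinarith
    simp only [Set.indicator_apply, hiff]
  rw [h1, setIntegral_indicator measurableSet_Ioi]
  have h2 : Set.Ioo 0 x ∩ Set.Ioi c = Set.Ioo c x := by
    ext y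
    simp only [Set.mem_inter_iff, Set.mem_Ioo, Set.mem_Ioi]
    constructor
    · rintro ⟨⟨_, h⟩, h'⟩; exact ⟨h', h⟩
    · rintro ⟨h, h'⟩; exact ⟨⟨hc0.trans h, h'⟩, h⟩
  rw [h2]
  rcases le_or_gt c x with hcx | hcx
  · rw [integral_Ioo_inv_mul_one_sub hc0 hx1 hcx, hcc]
    have : (1 - x) * t ≤ x * a := by
      rw [hc, div_le_iff₀ (by linarith)] at hcx
      linarith
    rw [max_eq_left this, Real.log_div hx0.ne' h1x.ne', Real.log_div ht.ne' ha.ne',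
      Real.log_mul hx0.ne' ha.ne', Real.log_mul h1x.ne' ht.ne']
    ring
  · rw [Set.Ioo_eq_empty (by linarith)]
    have : x * a ≤ (1 - x) * t := by
      rw [hc, lt_div_iff₀ (by linarith)] at hcx
      linarith
    rw [max_eq_right this]
    simp

/-- The bound 1 - e^{-u} ≤ u removes the singularity at y = 0 and supplies the domination for both
uses of Fubini. -/
lemma one_sub_exp_div_le {a y : ℝ} (hx1 : x < 1) (ha : 0 ≤ a) (hy : y ∈ Set.Ioo 0 x) :
    0 ≤ (1 - Real.exp (-(y / (1 - y) * a))) * (y * (1 - y))⁻¹ ∧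
    (1 - Real.exp (-(y / (1 - y) * a))) * (y * (1 - y))⁻¹ ≤ a * ((1 - x) ^ 2)⁻¹ := by
  have h0 : 0 < y := hy.1
  have h1 : 0 < 1 - x := by linarith
  have h1y : 1 - x ≤ 1 - y := by linarith [hy.2]
  have h1y' : 0 < 1 - y := by linarith
  have hv : 0 ≤ y / (1 - y) * a := by positivity
  have he := Real.add_one_le_exp (-(y / (1 - y) * a))
  have he1 : Real.exp (-(y / (1 - y) * a)) ≤ 1 := Real.exp_le_one_iff.2 (by linarith)
  constructor
  · exact mul_nonneg (by linarith) (by positivity)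
  · calc (1 - Real.exp (-(y / (1 - y) * a))) * (y * (1 - y))⁻¹
        ≤ (y / (1 - y) * a) * (y * (1 - y))⁻¹ := by gcongr; linarith
      _ = a * ((1 - y) ^ 2)⁻¹ := by field_simp
      _ ≤ a * ((1 - x) ^ 2)⁻¹ := by gcongr

lemma integral_log_max (hx0 : 0 < x) (hx1 : x < 1) {a : ℝ} (ha : 0 < a) :
    ∫ t, Real.log (max (x * a) ((1 - x) * t)) ∂expLaw = Real.log (1 - x) + logMean +
      ∫ y in Set.Ioo 0 x, (1 - Real.exp (-(y / (1 - y) * a))) * (y * (1 - y))⁻¹ := by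
  have h1x : 0 < 1 - x := by linarith
  set F : ℝ → ℝ → ℝ := fun t y =>
    (Set.Iio (y / (1 - y) * a)).indicator (fun _ => (y * (1 - y))⁻¹) t with hF
  have hFm : Measurable (Function.uncurry F) := by
    have : Function.uncurry F = {p : ℝ × ℝ | p.1 < p.2 / (1 - p.2) * a}.indicator
        (fun p => (p.2 * (1 - p.2))⁻¹) := by
      ext p
      simp [F, Function.uncurry_def, Set.indicator_apply]
    rw [this]
    exact Measurable.indicator (by fun_prop) (measurableSet_lt (by fun_prop) (by fun_prop))
  have hFy (y : ℝ) (hy : y ∈ Set.Ioo 0 x) : ∫ t, F t y ∂expLaw =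
      (1 - Real.exp (-(y / (1 - y) * a))) * (y * (1 - y))⁻¹ := by
    have h1y : 0 < 1 - y := by linarith [hy.2]
    have hy0 := hy.1
    simp only [F]
    rw [integral_indicator_const _ measurableSet_Iio, expLaw_real_Iio (by positivity), smul_eq_mul]
  have hint : Integrable (Function.uncurry F) (expLaw.prod (volume.restrict (Set.Ioo 0 x))) := by
    rw [integrable_prod_iff' hFm.aestronglyMeasurable]
    constructor
    · refine ae_of_all _ fun y => ?_
      change Integrable (fun t => F t y) expLaw
      exact (integrable_const _).indicator measurableSet_Iio
    · refine Integrable.mono' (g := fun _ => a * ((1 - x) ^ 2)⁻¹) (integrable_const _)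
        hFm.norm.stronglyMeasurable.integral_prod_left'.aestronglyMeasurable ?_
      filter_upwards [ae_restrict_mem measurableSet_Ioo] with y hy
      have h1y : 0 < 1 - y := by linarith [hy.2]
      have hy0 := hy.1
      have hn : ∀ t, ‖Function.uncurry F (t, y)‖ = F t y := fun t => by
        have h0 : 0 ≤ F t y := by
          simp only [F]
          exact Set.indicator_nonneg (fun _ _ => by positivity) _
        exact Real.norm_of_nonneg h0
      simp_rw [hn]
      rw [hFy y hy]
      have := one_sub_exp_div_le hx1 ha.le hy
      rw [Real.norm_of_nonneg this.1]
      exact this.2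
  have hsw := integral_integral_swap hint
  rw [setIntegral_congr_fun measurableSet_Ioo fun y hy => hFy y hy] at hsw
  have hae : (fun t => Real.log (max (x * a) ((1 - x) * t))) =ᵐ[expLaw]
      fun t => (∫ y in Set.Ioo 0 x, F t y) + (Real.log (1 - x) + Real.log t) := by
    filter_upwards [ae_pos_expLaw] with t ht
    rw [log_max_sub_log hx0 hx1 ha ht, Real.log_mul h1x.ne' ht.ne']
    ring
  have hI : Integrable (fun t => ∫ y in Set.Ioo 0 x, F t y) expLaw := hint.integral_prod_left
  have hJ : Integrable (fun t => Real.log (1 - x) + Real.log t) expLaw :=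
    (integrable_const _).add integrable_log_expLaw
  rw [integral_congr_ae hae, integral_add hI hJ, hsw, integral_add (integrable_const _)
    integrable_log_expLaw]
  simp only [integral_const, probReal_univ, one_smul]
  rw [logMean]
  ring

lemma hasSum_integral_neg_log_div (hx0 : 0 < x) (hx1 : x < 1) :
    HasSum (fun m : ℕ => x ^ (m + 1) / (m + 1) ^ 2)
      (∫ y in Set.Ioo 0 x, -Real.log (1 - y) / y) := by
  have hFi (m : ℕ) : IntegrableOn (fun y : ℝ => y ^ m / (m + 1)) (Set.Ioo 0 x) :=
    ((by fun_prop : Continuous fun y : ℝ => y ^ m / (m + 1)).integrableOn_Icc).mono_set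
      Set.Ioo_subset_Icc_self
  have hval (m : ℕ) : ∫ y in Set.Ioo 0 x, y ^ m / ((m : ℝ) + 1) = x ^ (m + 1) / (m + 1) ^ 2 := by
    rw [← integral_Ioc_eq_integral_Ioo, ← intervalIntegral.integral_of_le hx0.le,
      intervalIntegral.integral_div, integral_pow]
    simp only [ne_eq, Nat.add_eq_zero_iff, one_ne_zero, and_false, not_false_eq_true, zero_pow,
      sub_zero]
    rw [div_div, sq]
  have hnorm (m : ℕ) : ∫ y in Set.Ioo 0 x, ‖y ^ m / ((m : ℝ) + 1)‖ =
      x ^ (m + 1) / (m + 1) ^ 2 := by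
    rw [← hval]
    refine setIntegral_congr_fun measurableSet_Ioo fun y hy => ?_
    have := hy.1
    exact Real.norm_of_nonneg (by positivity)
  have hs : Summable fun m : ℕ => x ^ (m + 1) / ((m : ℝ) + 1) ^ 2 := by
    refine Summable.of_nonneg_of_le (fun m => by positivity) (fun m => ?_)
      ((summable_geometric_of_lt_one hx0.le hx1).mul_left x)
    rw [pow_succ']
    refine div_le_self (by positivity) ?_
    nlinarith [(m.cast_nonneg : (0 : ℝ) ≤ m)]
  have h := hasSum_integral_of_summable_integral_norm hFi (by simpa only [hnorm] using hs)
  simp only [hval] at h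
  rwa [setIntegral_congr_fun measurableSet_Ioo fun y hy => ?_] at h
  have hy0 : 0 < y := hy.1
  have h1 := (Real.hasSum_pow_div_log_of_abs_lt_one (x := y)
    (by rw [abs_of_pos hy0]; linarith [hy.2])).div_const y
  rw [← h1.tsum_eq]
  refine tsum_congr fun m => ?_
  rw [pow_succ]
  field_simp

/-- After Fubini, the s-integral at v = y/(1-y) produces logMean/(1-y) - log(1-y)/y. Integrating the
first term gives -logMean · log(1-x), which cancels the log(1-x) coming from `integral_log_max`; the
second term integrates to the dilogarithm series. -/
lemma integral_log_mul_integral_log_max (hx0 : 0 < x) (hx1 : x < 1) :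
    ∫ s, Real.log s * ∫ t, Real.log (max (x * s) ((1 - x) * t)) ∂expLaw ∂expLaw =
      logMean ^ 2 + ∑' m : ℕ, x ^ (m + 1) / ((m : ℝ) + 1) ^ 2 := by
  have h1x : 0 < 1 - x := by linarith
  set G : ℝ → ℝ → ℝ := fun s y =>
    Real.log s * ((1 - Real.exp (-(y / (1 - y) * s))) * (y * (1 - y))⁻¹) with hG
  have hGm : Measurable (Function.uncurry G) := by
    simp only [hG, Function.uncurry_def]; fun_prop
  have hint : Integrable (Function.uncurry G) (expLaw.prod (volume.restrict (Set.Ioo 0 x))) := by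
    have hb := integrable_id_mul_log_expLaw.mul_prod
      (integrable_const ((1 - x) ^ 2)⁻¹ : Integrable _ (volume.restrict (Set.Ioo 0 x)))
    refine hb.mono' hGm.aestronglyMeasurable ?_
    have hae1 : ∀ᵐ p ∂(expLaw.prod (volume.restrict (Set.Ioo 0 x))), 0 < p.1 :=
      Measure.quasiMeasurePreserving_fst.ae ae_pos_expLaw
    have hae2 : ∀ᵐ p ∂(expLaw.prod (volume.restrict (Set.Ioo 0 x))), p.2 ∈ Set.Ioo 0 x :=
      Measure.quasiMeasurePreserving_snd.ae (ae_restrict_mem measurableSet_Ioo)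
    filter_upwards [hae1, hae2] with p h1 h2
    have h3 := one_sub_exp_div_le hx1 h1.le h2
    simp only [Function.uncurry_def, hG]
    rw [norm_mul, Real.norm_of_nonneg h3.1, Real.norm_eq_abs, mul_assoc]
    exact mul_le_mul_of_nonneg_left h3.2 (abs_nonneg _)
  have hsw := integral_integral_swap hint
  have hinner (y : ℝ) (hy : y ∈ Set.Ioo 0 x) : ∫ s, G s y ∂expLaw =
      logMean * (1 - y)⁻¹ + -Real.log (1 - y) / y := by
    have hy0 := hy.1
    have h1y : 0 < 1 - y := by linarith [hy.2]
    have hv : 0 ≤ y / (1 - y) := by positivity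
    have e1 : 1 + y / (1 - y) = (1 - y)⁻¹ := by field_simp; ring
    have hi : Integrable (fun s => Real.log s * Real.exp (-(y / (1 - y) * s))) expLaw := by
      refine integrable_log_expLaw.abs.mono' (by fun_prop) ?_
      filter_upwards [ae_pos_expLaw] with s hs
      rw [norm_mul, Real.norm_of_nonneg (Real.exp_pos _).le, Real.norm_eq_abs]
      refine mul_le_of_le_one_right (abs_nonneg _) (Real.exp_le_one_iff.2 ?_)
      have : 0 ≤ y / (1 - y) * s := by positivity
      linarith
    have e2 : ∀ s, G s y = (y * (1 - y))⁻¹ *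
        (Real.log s - Real.log s * Real.exp (-(y / (1 - y) * s))) := fun s => by
      simp only [hG]; ring
    simp_rw [e2]
    rw [integral_const_mul, integral_sub integrable_log_expLaw hi, integral_exp_neg_mul_expLaw hv,
      e1, Real.log_inv, ← logMean]
    field_simp
    ring
  rw [setIntegral_congr_fun measurableSet_Ioo hinner] at hsw
  have hae : (fun s => Real.log s * ∫ t, Real.log (max (x * s) ((1 - x) * t)) ∂expLaw) =ᵐ[expLaw]
      fun s => (∫ y in Set.Ioo 0 x, G s y) + (Real.log (1 - x) + logMean) * Real.log s := by
    filter_upwards [ae_pos_expLaw] with s hs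
    rw [integral_log_max hx0 hx1 hs]
    simp only [hG]
    rw [integral_const_mul]
    ring
  have hi1 : IntegrableOn (fun y : ℝ => (1 - y)⁻¹) (Set.Ioo 0 x) := by
    refine (ContinuousOn.integrableOn_Icc fun y hy => ContinuousAt.continuousWithinAt ?_).mono_set
      Set.Ioo_subset_Icc_self
    have : 0 < 1 - y := by linarith [hy.2]
    exact ContinuousAt.inv₀ (by fun_prop) this.ne'
  have hsum := hasSum_integral_neg_log_div hx0 hx1
  -- If this failed, the Bochner integral would be 0 by convention, while `hsum` exhibits it as a
  -- sum of nonnegative terms whose first term is x > 0.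
  have hi2 : IntegrableOn (fun y : ℝ => -Real.log (1 - y) / y) (Set.Ioo 0 x) := by
    by_contra hcon
    have h0 : HasSum (fun m : ℕ => x ^ (m + 1) / ((m : ℝ) + 1) ^ 2) 0 := by
      rw [integral_undef hcon] at hsum; exact hsum
    have := (hasSum_zero_iff_of_nonneg fun m => by positivity).1 h0
    have := congrFun this 0
    simp at this
    linarith
  have hval1 : ∫ y in Set.Ioo 0 x, (1 - y)⁻¹ = -Real.log (1 - x) := by
    rw [← integral_Ioc_eq_integral_Ioo, ← intervalIntegral.integral_of_le hx0.le,
      intervalIntegral.integral_comp_sub_left (fun y => y⁻¹), integral_inv_of_pos h1x (by norm_num)]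
    simp [Real.log_inv]
  have hI : Integrable (fun s => ∫ y in Set.Ioo 0 x, G s y) expLaw := hint.integral_prod_left
  rw [integral_congr_ae hae, integral_add hI
    (integrable_log_expLaw.const_mul _), hsw, integral_const_mul, ← logMean,
    integral_add (hi1.const_mul _) hi2, integral_const_mul, hval1, hsum.tsum_eq]
  ring

end RealComputation

/-! ### Covariance of log moduli for a Gaussian pair. -/

lemma map_mul_stdComplexNormal {τ : ℂ} (hτ : ‖τ‖ = 1) :
    stdComplexNormal.map (fun z => τ * z) = stdComplexNormal := by
  have h := isGaussianPair_linear 0 1 τ (by simp [hτ])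
  have h2 := h.map_snd (by fun_prop) (by simp)
  have h3 : (stdComplexNormal.prod stdComplexNormal).map Prod.snd = stdComplexNormal := by
    rw [Measure.map_snd_prod]; simp
  nth_rewrite 1 [← h3]
  rw [Measure.map_map (by fun_prop) (by fun_prop)]
  simpa [Function.comp_def] using h2

lemma circleAverage_log_norm_center (a : ℂ) {R : ℝ} (hR : 0 < R) :
    Real.circleAverage (fun z => Real.log ‖z‖) a R = Real.log (max ‖a‖ R) := by
  have h := circleAverage_log_norm_sub_const_eq_log_radius_add_posLog (c := a) (a := 0) hR.ne'
  simp only [sub_zero] at h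
  rw [h]
  rcases eq_or_ne a 0 with rfl | ha
  · simp [hR.le]
  have ha0 : 0 < ‖a‖ := norm_pos_iff.2 ha
  rcases le_total ‖a‖ R with h1 | h1
  · rw [max_eq_right h1, Real.posLog_eq_zero_iff _ |>.2, add_zero]
    rw [abs_of_nonneg (by positivity), inv_mul_le_iff₀ hR]
    linarith
  · rw [max_eq_left h1, Real.posLog_eq_log, Real.log_mul (by positivity) (by positivity),
      Real.log_inv]
    · ring
    · rw [abs_of_nonneg (by positivity), le_inv_mul_iff₀ hR]
      linarith

lemma ae_ne_zero_stdComplexNormal : ∀ᵐ z ∂stdComplexNormal, z ≠ 0 := by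
  have h := ae_pos_expLaw
  rw [← map_norm_sq_stdComplexNormal, ae_map_iff (by fun_prop) measurableSet_Ioi] at h
  filter_upwards [h] with z hz
  rintro rfl
  simp at hz

lemma measurable_log_norm : Measurable fun z : ℂ => Real.log ‖z‖ :=
  Real.measurable_log.comp measurable_norm

/-- By rotation invariance z may be replaced by e^{iθ}z and averaged over θ. The inner average is
that of log|·| over the circle of radius σ|z| about a. -/
lemma integral_log_norm_add {a : ℂ} {σ : ℝ} (hσ : 0 < σ)
    (hi : Integrable (fun z : ℂ => Real.log ‖a + σ * z‖) stdComplexNormal) :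
    ∫ z : ℂ, Real.log ‖a + σ * z‖ ∂stdComplexNormal =
      ∫ z : ℂ, Real.log (max ‖a‖ (σ * ‖z‖)) ∂stdComplexNormal := by
  set h : ℂ → ℝ := fun z => Real.log ‖a + σ * z‖ with hh
  have hm : Measurable h := measurable_log_norm.comp (by fun_prop)
  set F : ℝ → ℂ → ℝ := fun θ z => h (circleMap 0 1 θ * z) with hF
  have hτ (θ : ℝ) : ‖circleMap 0 1 θ‖ = 1 := by simp
  have hFm : Measurable (Function.uncurry F) := by
    refine hm.comp ?_
    exact ((continuous_circleMap 0 1).measurable.comp measurable_fst).mul measurable_snd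
  have hrot (g : ℂ → ℝ) (hg : Measurable g) (θ : ℝ) :
      ∫ z, g (circleMap 0 1 θ * z) ∂stdComplexNormal = ∫ z, g z ∂stdComplexNormal := by
    conv_rhs => rw [← map_mul_stdComplexNormal (hτ θ),
      integral_map (by fun_prop) hg.aestronglyMeasurable]
  have hint : Integrable (Function.uncurry F)
      ((volume.restrict (Set.Ioc 0 (2 * Real.pi))).prod stdComplexNormal) := by
    rw [integrable_prod_iff hFm.aestronglyMeasurable]
    constructor
    · refine ae_of_all _ fun θ => ?_
      have := hi
      rw [← map_mul_stdComplexNormal (hτ θ), integrable_map_measure hm.aestronglyMeasurable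
        (by fun_prop)] at this
      exact this
    · have : ∀ θ, ∫ z, ‖Function.uncurry F (θ, z)‖ ∂stdComplexNormal =
          ∫ z, ‖h z‖ ∂stdComplexNormal := fun θ => hrot (fun z => ‖h z‖) hm.norm θ
      simp_rw [this]
      exact integrable_const _
  have hsw := integral_integral_swap hint
  have h1 : ∀ θ, ∫ z, F θ z ∂stdComplexNormal = ∫ z, h z ∂stdComplexNormal := hrot h hm
  simp_rw [h1] at hsw
  rw [setIntegral_const, Measure.real, Real.volume_Ioc, sub_zero,
    ENNReal.toReal_ofReal (by positivity), smul_eq_mul] at hsw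
  have h2 : ∀ᵐ z ∂stdComplexNormal, ∫ θ in Set.Ioc 0 (2 * Real.pi), F θ z =
      2 * Real.pi * Real.log (max ‖a‖ (σ * ‖z‖)) := by
    filter_upwards [ae_ne_zero_stdComplexNormal] with z hz
    have hz0 : 0 < ‖z‖ := norm_pos_iff.2 hz
    -- As θ runs, a + σe^{iθ}z starts at angle arg z on its circle, hence the shift in the
    -- parametrization.
    rw [← circleAverage_log_norm_center a (mul_pos hσ hz0),
      Real.circleAverage_eq_integral_add z.arg, smul_eq_mul, ← mul_assoc,
      mul_inv_cancel₀ (by positivity), one_mul,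
      intervalIntegral.integral_of_le (by positivity)]
    refine setIntegral_congr_fun measurableSet_Ioc fun θ _ => ?_
    simp only [hF, hh, circleMap]
    congr 2
    conv_lhs => rw [← Complex.norm_mul_exp_arg_mul_I z]
    push_cast
    rw [add_mul (θ : ℂ), Complex.exp_add]
    ring
  rw [integral_congr_ae h2, integral_const_mul] at hsw
  exact mul_left_cancel₀ (by positivity : 2 * Real.pi ≠ 0) hsw

variable {Ω : Type*} [MeasurableSpace Ω] {P : Measure Ω} [IsProbabilityMeasure P]

omit [IsProbabilityMeasure P] in
lemma memLp_log_norm_of_map_eq {X : Ω → ℂ} (hX : Measurable X)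
    (h : P.map X = stdComplexNormal) : MemLp (fun ω => Real.log ‖X ω‖) 2 P := by
  have h1 := memLp_log_norm
  rw [← h, memLp_map_measure_iff measurable_log_norm.aestronglyMeasurable hX.aemeasurable] at h1
  exact h1

omit [IsProbabilityMeasure P] in
lemma integral_log_norm_of_map_eq {X : Ω → ℂ} (hX : Measurable X)
    (h : P.map X = stdComplexNormal) : ∫ ω, Real.log ‖X ω‖ ∂P = 1 / 2 * logMean := by
  rw [← integral_log_norm, ← h, integral_map hX.aemeasurable
    measurable_log_norm.aestronglyMeasurable]

/-- In the model pair, fix the first variable and average out the phase of the second. Only squared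
moduli remain, which are exponential, and the real computation applies with x = |ρ|². The factor 1/4
comes from writing each log|·| as half the logarithm of a square. -/
lemma IsGaussianPair.integral_log_mul_log {X Y : Ω → ℂ} (hX : Measurable X) (hY : Measurable Y)
    {ρ : ℂ} {σ : ℝ} (hσ : 0 < σ) (hρ : ρ ≠ 0) (h1 : ‖ρ‖ ^ 2 + σ ^ 2 = 1)
    (h : IsGaussianPair P X Y ρ σ) :
    ∫ ω, Real.log ‖X ω‖ * Real.log ‖Y ω‖ ∂P =
      1 / 4 * (logMean ^ 2 + ∑' m : ℕ, (‖ρ‖ ^ 2) ^ (m + 1) / ((m : ℝ) + 1) ^ 2) := by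
  have hm : Measurable fun z : ℂ × ℂ => Real.log ‖z.1‖ * Real.log ‖z.2‖ :=
    (measurable_log_norm.comp measurable_fst).mul (measurable_log_norm.comp measurable_snd)
  have e1 : ∫ ω, Real.log ‖X ω‖ * Real.log ‖Y ω‖ ∂P =
      ∫ z, Real.log ‖z.1‖ * Real.log ‖ρ * z.1 + σ * z.2‖
        ∂(stdComplexNormal.prod stdComplexNormal) := by
    have := integral_map (μ := P) (φ := fun ω => (X ω, Y ω)) (by fun_prop)
      hm.aestronglyMeasurable
    rw [← this, h.map_eq hX hY, integral_map (by fun_prop) hm.aestronglyMeasurable]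
  have hpair := isGaussianPair_linear ρ (σ : ℂ) σ rfl
  have hsn : ‖ρ‖ ^ 2 + ‖(σ : ℂ)‖ ^ 2 = 1 := by
    rw [Complex.norm_real, Real.norm_eq_abs, sq_abs]; exact h1
  have hL1 : MemLp (fun z : ℂ × ℂ => Real.log ‖z.1‖) 2
      (stdComplexNormal.prod stdComplexNormal) :=
    memLp_log_norm_of_map_eq measurable_fst (by rw [Measure.map_fst_prod]; simp)
  have hL2 : MemLp (fun z : ℂ × ℂ => Real.log ‖ρ * z.1 + σ * z.2‖) 2
      (stdComplexNormal.prod stdComplexNormal) :=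
    memLp_log_norm_of_map_eq (by fun_prop) (hpair.map_snd (by fun_prop) hsn)
  have hint : Integrable (fun z : ℂ × ℂ => Real.log ‖z.1‖ * Real.log ‖ρ * z.1 + σ * z.2‖)
      (stdComplexNormal.prod stdComplexNormal) := hL1.integrable_mul hL2
  have hx0 : 0 < ‖ρ‖ ^ 2 := by positivity
  have hx1 : ‖ρ‖ ^ 2 < 1 := by nlinarith
  have hσ2 : σ ^ 2 = 1 - ‖ρ‖ ^ 2 := by linarith
  rw [e1, integral_prod _ hint]
  have hinner : ∀ᵐ z ∂stdComplexNormal,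
      ∫ w, Real.log ‖z‖ * Real.log ‖ρ * z + σ * w‖ ∂stdComplexNormal =
      1 / 4 * (Real.log (‖z‖ ^ 2) *
        ∫ t, Real.log (max (‖ρ‖ ^ 2 * ‖z‖ ^ 2) ((1 - ‖ρ‖ ^ 2) * t)) ∂expLaw) := by
    filter_upwards [(hL2.integrable one_le_two).prod_right_ae] with z hz
    rw [integral_const_mul, integral_log_norm_add hσ hz, ← integral_norm_sq
      (f := fun t => Real.log (max (‖ρ‖ ^ 2 * ‖z‖ ^ 2) ((1 - ‖ρ‖ ^ 2) * t)))
      (Real.measurable_log.comp (by fun_prop))]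
    have : ∀ w : ℂ, Real.log (max (‖ρ‖ ^ 2 * ‖z‖ ^ 2) ((1 - ‖ρ‖ ^ 2) * ‖w‖ ^ 2)) =
        2 * Real.log (max ‖ρ * z‖ (σ * ‖w‖)) := by
      intro w
      rw [← hσ2, ← mul_pow, ← mul_pow, norm_mul]
      have hmono : MonotoneOn (fun x : ℝ => x ^ 2) (Set.Ici 0) := fun x hx y _ hxy =>
        pow_le_pow_left₀ hx hxy 2
      rw [← hmono.map_max (a := ‖ρ‖ * ‖z‖) (b := σ * ‖w‖) (by simp; positivity)
        (by simp; positivity), Real.log_pow]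
      push_cast
      ring
    simp_rw [this]
    rw [integral_const_mul, Real.log_pow]
    push_cast
    ring
  rw [integral_congr_ae hinner, integral_const_mul, integral_norm_sq
    (f := fun s => Real.log s *
      ∫ t, Real.log (max (‖ρ‖ ^ 2 * s) ((1 - ‖ρ‖ ^ 2) * t)) ∂expLaw),
    integral_log_mul_integral_log_max hx0 hx1]
  refine Real.measurable_log.mul ?_
  have : Measurable fun p : ℝ × ℝ => Real.log (max (‖ρ‖ ^ 2 * p.1) ((1 - ‖ρ‖ ^ 2) * p.2)) :=
    Real.measurable_log.comp (by fun_prop)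
  exact this.stronglyMeasurable.integral_prod_right'.measurable

/-! ### Binomial series and Parseval on circles. -/

lemma binom_pos {L : ℝ} (hL : 0 < L) (n : ℕ) : 0 < binom L n := by
  unfold binom
  have := Real.Gamma_pos_of_pos hL
  have := Real.Gamma_pos_of_pos (show 0 < L + n by positivity)
  have := Real.Gamma_pos_of_pos (show (0 : ℝ) < n + 1 by positivity)
  positivity

lemma binom_zero {L : ℝ} (hL : 0 < L) : binom L 0 = 1 := by
  have := Real.Gamma_pos_of_pos hL
  simp [binom, this.ne']

lemma binom_eq_choose {L : ℝ} (hL : 0 < L) (n : ℕ) : binom L n = Ring.choose (L + n - 1) n := by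
  have h1 : Ring.choose (L + n - 1) n = Ring.multichoose L n := by
    rw [Ring.choose]; congr 1; ring
  have h2 := Ring.factorial_nsmul_multichoose_eq_ascPochhammer L n
  have h3 : (ascPochhammer ℕ n).smeval L = Real.Gamma (L + n) / Real.Gamma L := by
    have hG := Real.Gamma_pos_of_pos hL
    rw [Polynomial.ascPochhammer_smeval_eq_eval]
    induction n with
    | zero => simp [hG.ne']
    | succ n ih =>
      have hn : L + n ≠ 0 := by positivity
      rw [ascPochhammer_succ_eval, ih (by rw [Ring.choose]; congr 1; ring)
        (Ring.factorial_nsmul_multichoose_eq_ascPochhammer L n), Nat.cast_succ, ← add_assoc,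
        Real.Gamma_add_one hn]
      ring
  rw [h1, binom, Real.Gamma_nat_eq_factorial]
  rw [h3, nsmul_eq_mul] at h2
  have hf : (n.factorial : ℝ) ≠ 0 := by positivity
  rw [mul_comm (n.factorial : ℝ) (Real.Gamma L), ← div_div, ← h2]
  field_simp

lemma hasSum_binom {L : ℝ} (hL : 0 < L) {u : ℂ} (hu : ‖u‖ < 1) :
    HasSum (fun n : ℕ => (binom L n : ℂ) * u ^ n) (1 / (1 - u) ^ (L : ℂ)) := by
  have h := (Complex.one_div_one_sub_cpow_hasFPowerSeriesOnBall_zero (L : ℂ)).hasSum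
    (y := u) (by rw [← ENNReal.ofReal_one, Metric.eball_ofReal]; simpa using hu)
  simp only [FormalMultilinearSeries.ofScalars_apply_eq, zero_add, smul_eq_mul] at h
  refine h.congr_fun fun n => ?_
  rw [binom_eq_choose hL, Complex.ofReal_choose]
  push_cast
  rfl

lemma summable_binom {L : ℝ} (hL : 0 < L) {x : ℝ} (hx0 : 0 ≤ x) (hx : x < 1) :
    Summable fun n : ℕ => binom L n * x ^ n := by
  have h := (hasSum_binom hL (u := x) (by simpa [abs_of_nonneg hx0] using hx)).summable.norm
  refine h.congr fun n => ?_
  rw [norm_mul, norm_pow, Complex.norm_real, Complex.norm_real,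
    Real.norm_of_nonneg (binom_pos hL n).le, Real.norm_of_nonneg hx0]

lemma continuous_fourierSeries {c : ℕ → ℂ} (hc : Summable fun k => ‖c k‖) :
    Continuous fun α : ℝ => ∑' k, c k * Complex.exp (α * Complex.I) ^ k := by
  refine continuous_tsum (fun k => by fun_prop) hc fun k α => ?_
  rw [norm_mul, norm_pow, Complex.norm_exp_ofReal_mul_I, one_pow, mul_one]

lemma integral_exp_pow_mul_exp_neg_pow (j k : ℕ) :
    ∫ α in (0 : ℝ)..(2 * Real.pi),
      Complex.exp (α * Complex.I) ^ k * Complex.exp (-(α * Complex.I)) ^ j =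
      if k = j then 2 * Real.pi else 0 := by
  have h : ∀ α : ℝ, Complex.exp (α * Complex.I) ^ k * Complex.exp (-(α * Complex.I)) ^ j =
      Complex.exp ((((k : ℂ) - j) * Complex.I) * α) := by
    intro α
    rw [← Complex.exp_nat_mul, ← Complex.exp_nat_mul, ← Complex.exp_add]
    congr 1
    ring
  simp_rw [h]
  split_ifs with hkj
  · subst hkj
    simp
  · have hne : ((k : ℂ) - j) * Complex.I ≠ 0 :=
      mul_ne_zero (sub_ne_zero.2 (by exact_mod_cast hkj)) Complex.I_ne_zero
    rw [integral_exp_mul_complex hne]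
    have : Complex.exp (((k : ℂ) - j) * Complex.I * ((2 * Real.pi : ℝ) : ℂ)) = 1 := by
      have := Complex.exp_int_mul_two_pi_mul_I ((k : ℤ) - j)
      rw [← this]
      congr 1
      push_cast
      ring
    rw [this]
    simp

/-- Absolute summability permits termwise integration twice: first to recover the coefficients of F,
then to pair F with its own conjugate series. -/
lemma parseval {c : ℕ → ℂ} (hc : Summable fun k => ‖c k‖) :
    HasSum (fun k => ‖c k‖ ^ 2) ((2 * Real.pi)⁻¹ *
      ∫ α in (0 : ℝ)..(2 * Real.pi), ‖∑' k, c k * Complex.exp (α * Complex.I) ^ k‖ ^ 2) := by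
  have hpi : (2 * Real.pi : ℂ) ≠ 0 := by
    have := Real.pi_ne_zero
    exact_mod_cast mul_ne_zero two_ne_zero this
  set F : ℝ → ℂ := fun α => ∑' k, c k * Complex.exp (α * Complex.I) ^ k with hF
  have hFc : Continuous F := continuous_fourierSeries hc
  have hterm (α : ℝ) (k : ℕ) : ‖c k * Complex.exp (α * Complex.I) ^ k‖ = ‖c k‖ := by
    rw [norm_mul, norm_pow, Complex.norm_exp_ofReal_mul_I, one_pow, mul_one]
  have hexpneg (α : ℝ) : ‖Complex.exp (-(α * Complex.I))‖ = 1 := by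
    rw [← neg_mul, ← Complex.ofReal_neg, Complex.norm_exp_ofReal_mul_I]
  have hFs (α : ℝ) : HasSum (fun k => c k * Complex.exp (α * Complex.I) ^ k) (F α) :=
    (Summable.of_norm (by simpa only [hterm] using hc)).hasSum
  have hcoef (j : ℕ) : ∫ α in (0 : ℝ)..(2 * Real.pi), F α * Complex.exp (-(α * Complex.I)) ^ j =
      2 * Real.pi * c j := by
    have h := intervalIntegral.hasSum_integral_of_dominated_convergence (ι := ℕ) (μ := volume)
      (a := 0) (b := 2 * Real.pi)
      (F := fun k α => c k * Complex.exp (α * Complex.I) ^ k * Complex.exp (-(α * Complex.I)) ^ j)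
      (f := fun α => F α * Complex.exp (-(α * Complex.I)) ^ j)
      (fun k _ => ‖c k‖)
      (fun k => (by fun_prop : Continuous fun α : ℝ =>
        c k * Complex.exp (α * Complex.I) ^ k *
          Complex.exp (-(α * Complex.I)) ^ j).aestronglyMeasurable)
      (fun k => ae_of_all _ fun α _ => by
        rw [norm_mul, hterm, norm_pow, hexpneg, one_pow, mul_one])
      (ae_of_all _ fun α _ => hc) (by simp)
      (ae_of_all _ fun α _ => (hFs α).mul_right _)
    have h2 : ∀ k, ∫ α in (0 : ℝ)..(2 * Real.pi),
        c k * Complex.exp (α * Complex.I) ^ k * Complex.exp (-(α * Complex.I)) ^ j =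
        if k = j then 2 * Real.pi * c j else 0 := by
      intro k
      simp_rw [mul_assoc (c k)]
      rw [intervalIntegral.integral_const_mul, integral_exp_pow_mul_exp_neg_pow]
      split_ifs with hkj
      · rw [hkj]; push_cast; ring
      · simp
    simp_rw [h2] at h
    exact h.unique (hasSum_ite_eq j _)
  have h := intervalIntegral.hasSum_integral_of_dominated_convergence (ι := ℕ) (μ := volume)
      (a := 0) (b := 2 * Real.pi)
      (F := fun k α => starRingEnd ℂ (c k) * (F α * Complex.exp (-(α * Complex.I)) ^ k))
      (f := fun α => ((‖F α‖ ^ 2 : ℝ) : ℂ))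
      (fun k _ => ‖c k‖ * ∑' k, ‖c k‖)
      (fun k => (by fun_prop : Continuous fun α : ℝ =>
        starRingEnd ℂ (c k) * (F α *
          Complex.exp (-(α * Complex.I)) ^ k)).aestronglyMeasurable)
      (fun k => ae_of_all _ fun α _ => by
        rw [norm_mul, norm_mul, norm_pow, hexpneg, one_pow, mul_one, RCLike.norm_conj]
        gcongr
        refine (norm_tsum_le_tsum_norm (by simpa only [hterm] using hc)).trans (le_of_eq ?_)
        simp only [hterm])
      (ae_of_all _ fun α _ => hc.mul_right _) (by simp)
      (ae_of_all _ fun α _ => by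
        have h1 := ((hFs α).star).mul_left (F α)
        have h2 : F α * star (F α) = ((‖F α‖ ^ 2 : ℝ) : ℂ) := by
          rw [Complex.star_def, Complex.mul_conj, Complex.normSq_eq_norm_sq]
        rw [h2] at h1
        refine h1.congr_fun fun k => ?_
        rw [star_mul', star_pow, Complex.star_def, ← Complex.exp_conj]
        simp only [map_mul, Complex.conj_ofReal, Complex.conj_I, mul_neg]
        ring)
  simp only [intervalIntegral.integral_const_mul, hcoef] at h
  rw [intervalIntegral.integral_ofReal] at h
  have h3 := (Complex.hasSum_iff _ _).1 (h.mul_left ((2 * Real.pi : ℂ)⁻¹)) |>.1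
  have e1 : ∀ k, (((2 * Real.pi : ℂ)⁻¹ * (starRingEnd ℂ (c k) * (2 * Real.pi * c k))) : ℂ).re =
      ‖c k‖ ^ 2 := by
    intro k
    have : ((2 * Real.pi : ℂ)⁻¹ * (starRingEnd ℂ (c k) * (2 * Real.pi * c k))) =
        ((‖c k‖ ^ 2 : ℝ) : ℂ) := by
      rw [← Complex.normSq_eq_norm_sq, ← Complex.mul_conj]
      field_simp
    rw [this, Complex.ofReal_re]
  have e2 (I : ℝ) : ((2 * Real.pi : ℂ)⁻¹ * (I : ℂ)).re = (2 * Real.pi)⁻¹ * I := by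
    rw [← Complex.ofReal_re ((2 * Real.pi)⁻¹ * I)]
    push_cast
    rfl
  simpa only [e1, e2] using h3

/-- The squared modulus of the normalised covariance kernel. -/
noncomputable def corrSq (L : ℝ) (z w : ℂ) : ℝ :=
  ((1 - ‖z‖ ^ 2) * (1 - ‖w‖ ^ 2) / ‖1 - z * starRingEnd ℂ w‖ ^ 2) ^ L

/-- The coefficients `(1-s²)^M (M+k-1 choose k) s^{2k}`. -/
noncomputable def radialCoeff (M : ℝ) (k : ℕ) (s : ℝ) : ℝ :=
  (1 - s ^ 2) ^ M * (binom M k * (s ^ 2) ^ k)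

/-- The double circle average of the squared correlation. -/
noncomputable def corrAverage (M s t : ℝ) : ℝ :=
  (2 * Real.pi)⁻¹ * ∫ θ in (0 : ℝ)..(2 * Real.pi), (2 * Real.pi)⁻¹ *
    ∫ φ in (0 : ℝ)..(2 * Real.pi), corrSq M (circleMap 0 s θ) (circleMap 0 t φ)

lemma one_sub_ne_zero_of_norm_lt {u : ℂ} (hu : ‖u‖ < 1) : 1 - u ≠ 0 := by
  intro h
  rw [sub_eq_zero] at h
  rw [← h] at hu
  simp at hu

/-- Up to the constant ((1-s²)(1-t²))^M, `corrSq` is the squared modulus of (1 - z̄w)^{-M}. On |w| =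
t this is a Fourier series with coefficients `binom M k` (z̄t)^k, so Parseval applies, and the
result depends on z only through |z|. -/
lemma hasSum_radialCoeff_mul {M s t : ℝ} (hM : 0 < M) (hs0 : 0 ≤ s) (hs : s < 1) (ht0 : 0 ≤ t)
    (ht : t < 1) {z : ℂ} (hz : ‖z‖ = s) :
    HasSum (fun k => radialCoeff M k s * radialCoeff M k t)
      ((2 * Real.pi)⁻¹ * ∫ φ in (0 : ℝ)..(2 * Real.pi), corrSq M z (circleMap 0 t φ)) := by
  have hst : s * t < 1 := by nlinarith
  have hs2 : 0 < 1 - s ^ 2 := by nlinarith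
  have ht2 : 0 < 1 - t ^ 2 := by nlinarith
  have hst0 : 0 ≤ s * t := mul_nonneg hs0 ht0
  set c : ℕ → ℂ := fun k => (binom M k : ℂ) * (starRingEnd ℂ z * t) ^ k with hc
  have hcn (k : ℕ) : ‖c k‖ = binom M k * (s * t) ^ k := by
    rw [hc, norm_mul, norm_pow, norm_mul, RCLike.norm_conj, hz, Complex.norm_real,
      Complex.norm_real, Real.norm_of_nonneg (binom_pos hM k).le, Real.norm_of_nonneg ht0]
  have hcs : Summable fun k => ‖c k‖ := by
    simp only [hcn]; exact summable_binom hM hst0 hst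
  have h := (parseval hcs).mul_left (((1 - s ^ 2) * (1 - t ^ 2)) ^ M)
  refine (congrArg₂ (fun f a => HasSum (L := .unconditional ℕ) f a) ?_ ?_).mpr h
  · ext k
    rw [hcn, radialCoeff, radialCoeff, Real.mul_rpow hs2.le ht2.le]
    ring
  · rw [mul_left_comm (((1 - s ^ 2) * (1 - t ^ 2)) ^ M)]
    congr 1
    rw [← intervalIntegral.integral_const_mul]
    refine intervalIntegral.integral_congr fun φ _ => ?_
    have hu : ‖starRingEnd ℂ z * circleMap 0 t φ‖ < 1 := by
      rw [norm_mul, RCLike.norm_conj, hz, norm_circleMap_zero, abs_of_nonneg ht0]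
      exact hst
    have hsum : ∑' k, c k * Complex.exp (φ * Complex.I) ^ k =
        1 / (1 - starRingEnd ℂ z * circleMap 0 t φ) ^ (M : ℂ) := by
      rw [← (hasSum_binom hM hu).tsum_eq]
      refine tsum_congr fun k => ?_
      simp only [hc, circleMap, zero_add, mul_pow]
      ring
    rw [hsum, corrSq, hz, norm_circleMap_zero, sq_abs, norm_div, norm_one,
      Complex.norm_cpow_real, Real.div_rpow (by positivity) (by positivity)]
    have e : ‖1 - z * starRingEnd ℂ (circleMap 0 t φ)‖ =
        ‖1 - starRingEnd ℂ z * circleMap 0 t φ‖ := by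
      rw [← RCLike.norm_conj]
      simp
    rw [e, div_pow, one_pow, mul_one_div]
    congr 1
    rw [← Real.rpow_mul_natCast (norm_nonneg _), ← Real.rpow_natCast_mul (norm_nonneg _),
      mul_comm M]

lemma hasSum_corrAverage {M s t : ℝ} (hM : 0 < M) (hs0 : 0 ≤ s) (hs : s < 1) (ht0 : 0 ≤ t)
    (ht : t < 1) :
    HasSum (fun k => radialCoeff M k s * radialCoeff M k t) (corrAverage M s t) := by
  have h := hasSum_radialCoeff_mul hM hs0 hs ht0 ht (z := circleMap 0 s 0)
    (by rw [norm_circleMap_zero, abs_of_nonneg hs0])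
  have h2 : corrAverage M s t =
      (2 * Real.pi)⁻¹ * ∫ φ in (0 : ℝ)..(2 * Real.pi), corrSq M (circleMap 0 s 0)
        (circleMap 0 t φ) := by
    have h3 (θ : ℝ) := (hasSum_radialCoeff_mul hM hs0 hs ht0 ht (z := circleMap 0 s θ)
      (by rw [norm_circleMap_zero, abs_of_nonneg hs0])).unique h
    rw [corrAverage]
    simp_rw [h3]
    rw [intervalIntegral.integral_const, sub_zero, smul_eq_mul, inv_mul_cancel_left₀]
    positivity
  rw [h2]
  exact h

/-! ### Second differences of the covariance and their limit. -/

/-- The function `(1 + τ ω)^{-L}`, `τ = s²/(1-s²)`, `ω = 1 - e^{iα}`. -/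
noncomputable def profile (L τ α : ℝ) : ℂ :=
  (1 + τ * (1 - Complex.exp (α * Complex.I))) ^ (-(L : ℂ))

/-- For τ = s²/(1-s²) one has 1 + τ(1-e^{iα}) = (1 - s²e^{iα})/(1-s²). The denominator is a positive
real, so it separates from the complex power without a branch problem. The m-th power is thus the
generating function of `radialCoeff (L * m)`. -/
lemma profile_pow {L s : ℝ} (hs0 : 0 ≤ s) (hs : s < 1) (α : ℝ) (m : ℕ) :
    profile L (s ^ 2 / (1 - s ^ 2)) α ^ m =
      ((1 - s ^ 2) ^ (L * m) : ℝ) *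
        (1 / (1 - (s : ℂ) ^ 2 * Complex.exp (α * Complex.I)) ^ ((L * m : ℝ) : ℂ)) := by
  have hs2 : 0 < 1 - s ^ 2 := by nlinarith
  have hs2' : (1 - (s : ℂ) ^ 2) ≠ 0 := by exact_mod_cast hs2.ne'
  have hu : ‖(s : ℂ) ^ 2 * Complex.exp (α * Complex.I)‖ < 1 := by
    rw [norm_mul, Complex.norm_exp_ofReal_mul_I, mul_one, norm_pow, Complex.norm_real,
      Real.norm_of_nonneg hs0]
    nlinarith
  have hne := one_sub_ne_zero_of_norm_lt hu
  set v := 1 - (s : ℂ) ^ 2 * Complex.exp (α * Complex.I) with hv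
  have e1 : 1 + ((s ^ 2 / (1 - s ^ 2) : ℝ) : ℂ) * (1 - Complex.exp (α * Complex.I)) =
      ((1 - s ^ 2)⁻¹ : ℝ) * v := by
    rw [hv]
    push_cast
    field_simp
    ring
  have hne2 : (((1 - s ^ 2)⁻¹ : ℝ) : ℂ) * v ≠ 0 :=
    mul_ne_zero (by exact_mod_cast (inv_pos.2 hs2).ne') hne
  rw [profile, e1, Complex.ofReal_cpow hs2.le, one_div, ← Complex.cpow_neg,
    ← Complex.cpow_nat_mul, Complex.cpow_def_of_ne_zero hne2, Complex.cpow_def_of_ne_zero hne,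
    Complex.cpow_def_of_ne_zero (by exact_mod_cast hs2.ne'), ← Complex.exp_add,
    Complex.log_ofReal_mul (inv_pos.2 hs2) hne, Real.log_inv, ← Complex.ofReal_log hs2.le]
  congr 1
  push_cast
  ring

/-- The left side is Σ_k (A_k(s) - A_k(t))² with A_k the radial coefficients. Parseval is read
backwards, with A_k(s) - A_k(t) as Fourier coefficients in the auxiliary angle α. -/
lemma corrAverage_second_difference {L s t : ℝ} {m : ℕ} (hL : 0 < L) (hm : 0 < m) (hs0 : 0 ≤ s)
    (hs : s < 1) (ht0 : 0 ≤ t) (ht : t < 1) :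
    corrAverage (L * m) s s - 2 * corrAverage (L * m) s t + corrAverage (L * m) t t =
      (2 * Real.pi)⁻¹ * ∫ α in (0 : ℝ)..(2 * Real.pi),
        ‖profile L (s ^ 2 / (1 - s ^ 2)) α ^ m - profile L (t ^ 2 / (1 - t ^ 2)) α ^ m‖ ^ 2 := by
  set M := L * m with hM'
  have hM : 0 < M := by positivity
  have h1 := ((hasSum_corrAverage hM hs0 hs hs0 hs).sub
    ((hasSum_corrAverage hM hs0 hs ht0 ht).mul_left 2)).add (hasSum_corrAverage hM ht0 ht ht0 ht)
  have hsummable {r : ℝ} (hr0 : 0 ≤ r) (hr : r < 1) : Summable fun k => radialCoeff M k r :=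
    (summable_binom hM (sq_nonneg r) (by nlinarith)).mul_left _
  have hnn {r : ℝ} (hr0 : 0 ≤ r) (hr : r < 1) (k : ℕ) : 0 ≤ radialCoeff M k r := by
    have := binom_pos hM k
    have : 0 < 1 - r ^ 2 := by nlinarith
    unfold radialCoeff
    positivity
  have hsum {r : ℝ} (hr0 : 0 ≤ r) (hr : r < 1) (α : ℝ) :
      HasSum (fun k => (radialCoeff M k r : ℂ) * Complex.exp (α * Complex.I) ^ k)
        (profile L (r ^ 2 / (1 - r ^ 2)) α ^ m) := by
    have hu : ‖(r : ℂ) ^ 2 * Complex.exp (α * Complex.I)‖ < 1 := by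
      rw [norm_mul, Complex.norm_exp_ofReal_mul_I, mul_one, norm_pow, Complex.norm_real,
        Real.norm_of_nonneg hr0]
      nlinarith
    rw [profile_pow hr0 hr]
    refine ((hasSum_binom hM hu).mul_left _).congr_fun fun k => ?_
    rw [radialCoeff, mul_pow]
    push_cast
    ring
  set c : ℕ → ℂ := fun k => (radialCoeff M k s : ℂ) - radialCoeff M k t with hc
  have hcs : Summable fun k => ‖c k‖ := by
    refine Summable.of_nonneg_of_le (fun k => norm_nonneg _) (fun k => ?_)
      ((hsummable hs0 hs).add (hsummable ht0 ht))
    refine (norm_sub_le _ _).trans (le_of_eq ?_)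
    rw [Complex.norm_real, Complex.norm_real, Real.norm_of_nonneg (hnn hs0 hs k),
      Real.norm_of_nonneg (hnn ht0 ht k)]
  have h2 := parseval hcs
  have e1 : ∀ α : ℝ, ∑' k, c k * Complex.exp (α * Complex.I) ^ k =
      profile L (s ^ 2 / (1 - s ^ 2)) α ^ m - profile L (t ^ 2 / (1 - t ^ 2)) α ^ m := by
    intro α
    refine HasSum.tsum_eq (((hsum hs0 hs α).sub (hsum ht0 ht α)).congr_fun fun k => ?_)
    simp only [hc]
    ring
  simp_rw [e1] at h2
  refine h1.unique (h2.congr_fun fun k => ?_)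
  simp only [hc]
  rw [← Complex.ofReal_sub, Complex.norm_real, Real.norm_eq_abs, sq_abs]
  ring

lemma norm_one_sub_exp_sq (α : ℝ) :
    ‖1 - Complex.exp (α * Complex.I)‖ ^ 2 = (2 * Real.sin (α / 2)) ^ 2 := by
  rw [← Complex.normSq_eq_norm_sq, Complex.normSq_apply]
  simp only [Complex.sub_re, Complex.one_re, Complex.sub_im, Complex.one_im,
    Complex.exp_ofReal_mul_I_re, Complex.exp_ofReal_mul_I_im]
  have h1 := Real.cos_sq' (α / 2)
  have h2 : Real.cos α = 2 * Real.cos (α / 2) ^ 2 - 1 := by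
    rw [← Real.cos_two_mul]; congr 1; ring
  have h3 := Real.sin_sq_add_cos_sq α
  nlinarith

lemma norm_one_add_mul_sq (τ α : ℝ) :
    ‖1 + τ * (1 - Complex.exp (α * Complex.I))‖ ^ 2 =
      1 + τ * (τ + 1) * (2 * Real.sin (α / 2)) ^ 2 := by
  rw [← norm_one_sub_exp_sq, ← Complex.normSq_eq_norm_sq, ← Complex.normSq_eq_norm_sq,
    Complex.normSq_apply, Complex.normSq_apply]
  simp only [Complex.add_re, Complex.sub_re, Complex.one_re, Complex.sub_im, Complex.one_im,
    Complex.add_im, Complex.mul_re, Complex.mul_im, Complex.ofReal_re, Complex.ofReal_im,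
    Complex.exp_ofReal_mul_I_re, Complex.exp_ofReal_mul_I_im]
  have h3 := Real.sin_sq_add_cos_sq α
  linear_combination (-τ) * h3

lemma one_le_norm_one_add_mul {τ : ℝ} (hτ : 0 ≤ τ) (α : ℝ) :
    1 ≤ ‖1 + τ * (1 - Complex.exp (α * Complex.I))‖ := by
  have h := norm_one_add_mul_sq τ α
  have h2 : 0 ≤ τ * (τ + 1) * (2 * Real.sin (α / 2)) ^ 2 := by positivity
  nlinarith [norm_nonneg (1 + (τ : ℂ) * (1 - Complex.exp (α * Complex.I)))]

lemma one_add_mul_mem_slitPlane {τ : ℝ} (hτ : 0 ≤ τ) (α : ℝ) :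
    1 + (τ : ℂ) * (1 - Complex.exp (α * Complex.I)) ∈ Complex.slitPlane := by
  left
  simp only [Complex.add_re, Complex.sub_re, Complex.one_re, Complex.mul_re, Complex.ofReal_re,
    Complex.ofReal_im, Complex.exp_ofReal_mul_I_re]
  have := mul_nonneg hτ (sub_nonneg.2 (Real.cos_le_one α))
  linarith

lemma norm_profile (L τ α : ℝ) :
    ‖profile L τ α‖ = ‖1 + τ * (1 - Complex.exp (α * Complex.I))‖ ^ (-L) := by
  rw [profile, ← Complex.ofReal_neg, Complex.norm_cpow_real]

lemma norm_profile_sq (L τ α : ℝ) :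
    ‖profile L τ α‖ ^ 2 = (1 + τ * (τ + 1) * (2 * Real.sin (α / 2)) ^ 2) ^ (-L) := by
  rw [norm_profile, ← norm_one_add_mul_sq, ← Real.rpow_mul_natCast (norm_nonneg _),
    ← Real.rpow_natCast_mul (norm_nonneg _), mul_comm (-L)]

lemma norm_profile_le_one {L τ : ℝ} (hL : 0 < L) (hτ : 0 ≤ τ) (α : ℝ) : ‖profile L τ α‖ ≤ 1 := by
  rw [norm_profile]
  exact Real.rpow_le_one_of_one_le_of_nonpos (one_le_norm_one_add_mul hτ α) (by linarith)

lemma norm_profile_antitone {L τ τ' : ℝ} (hL : 0 < L) (hτ : 0 ≤ τ) (h : τ ≤ τ') (α : ℝ) :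
    ‖profile L τ' α‖ ≤ ‖profile L τ α‖ := by
  rw [← sq_le_sq₀ (norm_nonneg _) (norm_nonneg _), norm_profile_sq, norm_profile_sq]
  refine Real.rpow_le_rpow_of_nonpos (by positivity) ?_ (by linarith)
  have := hτ.trans h
  gcongr

lemma continuous_profile {L τ : ℝ} (hτ : 0 ≤ τ) : Continuous (profile L τ) := by
  unfold profile
  refine continuous_iff_continuousAt.2 fun α => ?_
  exact ContinuousAt.cpow (by fun_prop) (by fun_prop) (one_add_mul_mem_slitPlane hτ α)

/-- The derivative of `profile` in its second argument. -/
noncomputable def profileDeriv (L τ α : ℝ) : ℂ :=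
  -(L : ℂ) * (1 + τ * (1 - Complex.exp (α * Complex.I))) ^ (-(L : ℂ) - 1) *
    (1 - Complex.exp (α * Complex.I))

lemma hasDerivAt_profile (L : ℝ) {τ : ℝ} (hτ : 0 ≤ τ) (α : ℝ) :
    HasDerivAt (fun τ => profile L τ α) (profileDeriv L τ α) τ := by
  have h1 : HasDerivAt (fun τ : ℝ => 1 + (τ : ℂ) * (1 - Complex.exp (α * Complex.I)))
      (1 - Complex.exp (α * Complex.I)) τ := by
    simpa using ((Complex.ofRealCLM.hasDerivAt (x := τ)).mul_const
      (1 - Complex.exp (α * Complex.I))).const_add 1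
  have h2 := (hasDerivAt_id (1 + (τ : ℂ) * (1 - Complex.exp (α * Complex.I)))).cpow_const
    (c := -(L : ℂ)) (one_add_mul_mem_slitPlane hτ α)
  have h3 := h2.comp τ h1
  simp only [mul_one, id] at h3
  exact h3

lemma norm_profileDeriv_sq {L : ℝ} (τ α : ℝ) :
    ‖profileDeriv L τ α‖ ^ 2 = L ^ 2 *
      (1 + τ * (τ + 1) * (2 * Real.sin (α / 2)) ^ 2) ^ (-(L + 1)) * (2 * Real.sin (α / 2)) ^ 2 := by
  have e : -(L : ℂ) - 1 = ((-(L + 1) : ℝ) : ℂ) := by push_cast; ring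
  rw [profileDeriv, e, norm_mul, norm_mul, mul_pow, mul_pow, norm_one_sub_exp_sq, norm_neg,
    Complex.norm_real, Real.norm_eq_abs, sq_abs, Complex.norm_cpow_real, ← norm_one_add_mul_sq,
    ← Real.rpow_mul_natCast (norm_nonneg _), ← Real.rpow_natCast_mul (norm_nonneg _),
    mul_comm (-(L + 1))]

lemma norm_profileDeriv_le {L τ : ℝ} (hL : 0 < L) (hτ : 0 ≤ τ) (α : ℝ) :
    ‖profileDeriv L τ α‖ ≤ L * |2 * Real.sin (α / 2)| := by
  rw [← sq_le_sq₀ (norm_nonneg _) (by positivity), norm_profileDeriv_sq, mul_pow L, sq_abs]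
  have h : (1 + τ * (τ + 1) * (2 * Real.sin (α / 2)) ^ 2) ^ (-(L + 1)) ≤ 1 := by
    refine Real.rpow_le_one_of_one_le_of_nonpos ?_ (by linarith)
    have : 0 ≤ τ * (τ + 1) * (2 * Real.sin (α / 2)) ^ 2 := by positivity
    linarith
  exact mul_le_mul_of_nonneg_right (mul_le_of_le_one_right (by positivity) h) (by positivity)

lemma norm_profile_pow_sub_le {L τ₀ τ σ : ℝ} (hL : 0 < L) (hτ₀ : 0 ≤ τ₀) (h1 : τ₀ ≤ τ)
    (h2 : τ ≤ σ) (α : ℝ) (m : ℕ) :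
    ‖profile L σ α ^ (m + 1) - profile L τ α ^ (m + 1)‖ ≤
      (m + 1) * ‖profile L τ₀ α‖ ^ m * (L * |2 * Real.sin (α / 2)|) * (σ - τ) := by
  have h := (convex_Icc τ₀ σ).norm_image_sub_le_of_norm_hasDerivWithin_le
    (f := fun t => profile L t α ^ (m + 1))
    (f' := fun t => ((m + 1 : ℕ) : ℂ) * profile L t α ^ m * profileDeriv L t α)
    (C := (m + 1) * ‖profile L τ₀ α‖ ^ m * (L * |2 * Real.sin (α / 2)|)) (x := τ) (y := σ)
    (fun t ht => ((hasDerivAt_profile L (hτ₀.trans ht.1) α).pow (m + 1)).hasDerivWithinAt)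
    (fun t ht => by
      have ht0 := hτ₀.trans ht.1
      rw [norm_mul, norm_mul, norm_pow, Complex.norm_natCast]
      push_cast
      gcongr
      · exact norm_profile_antitone hL hτ₀ ht.1 α
      · exact norm_profileDeriv_le hL ht0 α)
    ⟨h1, h2⟩ ⟨h1.trans h2, le_rfl⟩
  rwa [Real.norm_of_nonneg (sub_nonneg.2 h2)] at h

/-- The integrand of the second difference of the covariance. -/
noncomputable def diffSeries (L τ σ α : ℝ) : ℝ :=
  ∑' m : ℕ, ‖profile L σ α ^ (m + 1) - profile L τ α ^ (m + 1)‖ ^ 2 / ((m : ℝ) + 1) ^ 2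

lemma diffSeries_nonneg (L τ σ α : ℝ) : 0 ≤ diffSeries L τ σ α :=
  tsum_nonneg fun m => by positivity

lemma sin_half_ne_zero {α : ℝ} (hα : α ∈ Set.Ioo 0 (2 * Real.pi)) : Real.sin (α / 2) ≠ 0 :=
  (Real.sin_pos_of_pos_of_lt_pi (by linarith [hα.1]) (by linarith [hα.2])).ne'

lemma norm_profile_sq_lt_one {L τ α : ℝ} (hL : 0 < L) (hτ : 0 < τ) (hα : Real.sin (α / 2) ≠ 0) :
    ‖profile L τ α‖ ^ 2 < 1 := by
  rw [norm_profile_sq]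
  refine Real.rpow_lt_one_of_one_lt_of_neg ?_ (by linarith)
  have : 0 < τ * (τ + 1) * (2 * Real.sin (α / 2)) ^ 2 := by positivity
  linarith

/-- The factor (m+1)² from differentiating the power cancels the weight, leaving a geometric bound
independent of τ in [τ₀, σ). -/
lemma diffSeries_term_le {L τ₀ τ σ : ℝ} (hL : 0 < L) (hτ₀ : 0 ≤ τ₀) (h1 : τ₀ ≤ τ)
    (h2 : τ < σ) (α : ℝ) (m : ℕ) :
    ‖profile L σ α ^ (m + 1) - profile L τ α ^ (m + 1)‖ ^ 2 / ((m : ℝ) + 1) ^ 2 / (σ - τ) ^ 2 ≤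
      (‖profile L τ₀ α‖ ^ 2) ^ m * (L * |2 * Real.sin (α / 2)|) ^ 2 := by
  have h := norm_profile_pow_sub_le hL hτ₀ h1 h2.le α m
  have hd : 0 < σ - τ := by linarith
  have := pow_le_pow_left₀ (norm_nonneg _) h 2
  rw [div_div, div_le_iff₀ (by positivity)]
  refine this.trans (le_of_eq ?_)
  rw [← pow_mul, mul_comm 2 m, pow_mul]
  ring

lemma diffSeries_div_eq (L τ σ α : ℝ) :
    diffSeries L τ σ α / (σ - τ) ^ 2 =
      ∑' m : ℕ, ‖profile L σ α ^ (m + 1) - profile L τ α ^ (m + 1)‖ ^ 2 / ((m : ℝ) + 1) ^ 2 /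
        (σ - τ) ^ 2 := by
  rw [diffSeries, tsum_div_const]

/-- Each term tends to the squared derivative |p^m p'|². The geometric sum |p'|²/(1-|p|²) is g up to
a factor, because |p|² = (1+y²)^{-L} with y² = σ(σ+1)(2 sin(α/2))². -/
lemma tendsto_diffSeries {L σ α : ℝ} (hL : 0 < L) (hσ : 0 < σ) (hα : Real.sin (α / 2) ≠ 0) :
    Tendsto (fun τ => diffSeries L τ σ α / (σ - τ) ^ 2) (𝓝[<] σ)
      (𝓝 (L ^ 2 / (σ * (σ + 1)) *
        integrand L (Real.sqrt (σ * (σ + 1)) * (2 * Real.sin (α / 2))))) := by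
  set S := (2 * Real.sin (α / 2)) ^ 2 with hS
  have hS0 : 0 < S := by positivity
  have hlim : L ^ 2 / (σ * (σ + 1)) *
      integrand L (Real.sqrt (σ * (σ + 1)) * (2 * Real.sin (α / 2))) =
      ∑' m : ℕ, (‖profile L σ α‖ ^ 2) ^ m * ‖profileDeriv L σ α‖ ^ 2 := by
    rw [tsum_mul_right, tsum_geometric_of_lt_one (by positivity)
      (norm_profile_sq_lt_one hL hσ hα), norm_profile_sq, norm_profileDeriv_sq, integrand, mul_pow,
      Real.sq_sqrt (by positivity), ← hS]
    have hw : 0 < 1 + σ * (σ + 1) * S := by positivity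
    have hwL : 1 < (1 + σ * (σ + 1) * S) ^ L :=
      Real.one_lt_rpow (by have : 0 < σ * (σ + 1) * S := by positivity
                           linarith) hL
    rw [neg_add, Real.rpow_add hw, Real.rpow_neg_one, Real.rpow_neg hw.le]
    have h1 : (1 + σ * (σ + 1) * S) ^ L - 1 ≠ 0 := by linarith
    field_simp
  rw [hlim]
  simp_rw [diffSeries_div_eq]
  have hτ₀ : 0 < σ / 2 := by linarith
  refine tendsto_tsum_of_dominated_convergence
    (bound := fun m => (‖profile L (σ / 2) α‖ ^ 2) ^ m * (L * |2 * Real.sin (α / 2)|) ^ 2)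
    ((summable_geometric_of_lt_one (by positivity)
      (norm_profile_sq_lt_one hL hτ₀ hα)).mul_right _) (fun m => ?_) ?_
  · have hd := (hasDerivAt_profile L hσ.le α).pow (m + 1)
    have h1 := (hasDerivAt_iff_tendsto_slope.1 hd).mono_left
      (nhdsWithin_mono σ (fun x (hx : x < σ) => hx.ne) : 𝓝[<] σ ≤ 𝓝[≠] σ)
    have h2 := (h1.norm.pow 2).div_const (((m : ℝ) + 1) ^ 2)
    have e : ‖((m + 1 : ℕ) : ℂ) * profile L σ α ^ (m + 1 - 1) * profileDeriv L σ α‖ ^ 2 /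
        ((m : ℝ) + 1) ^ 2 = (‖profile L σ α‖ ^ 2) ^ m * ‖profileDeriv L σ α‖ ^ 2 := by
      rw [norm_mul, norm_mul, norm_pow, Complex.norm_natCast, Nat.add_sub_cancel, ← pow_mul,
        mul_comm 2 m, pow_mul]
      push_cast
      field_simp
    rw [e] at h2
    refine h2.congr' ?_
    filter_upwards [self_mem_nhdsWithin] with τ hτ
    have hτ : τ < σ := hτ
    have hd : 0 < σ - τ := by linarith
    rw [slope_def_module, norm_smul, norm_inv, Real.norm_eq_abs, abs_sub_comm, abs_of_pos hd,
      norm_sub_rev]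
    simp only [Pi.pow_apply]
    field_simp
  · filter_upwards [Ioo_mem_nhdsLT (show σ / 2 < σ by linarith)] with τ hτ m
    rw [Real.norm_of_nonneg (by positivity)]
    exact diffSeries_term_le hL hτ₀.le hτ.1.le hτ.2 α m

/-- As α → 0 the geometric ratio tends to 1, but the factor sin²(α/2) compensates. Rewriting the
bound through the integrand makes this explicit, since the integrand is at most 1/L; the result does
not depend on α. -/
lemma diffSeries_div_le {L τ₀ τ σ α : ℝ} (hL : 0 < L) (hτ₀ : 0 < τ₀) (h1 : τ₀ ≤ τ)
    (h2 : τ < σ) (hα : Real.sin (α / 2) ≠ 0) :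
    diffSeries L τ σ α / (σ - τ) ^ 2 ≤
      L / (τ₀ * (τ₀ + 1)) * (1 + τ₀ * (τ₀ + 1) * 4) ^ (L + 1) := by
  set S := (2 * Real.sin (α / 2)) ^ 2 with hS
  have hS0 : 0 < S := by positivity
  have hS4 : S ≤ 4 := by
    have := Real.sin_sq_le_one (α / 2)
    rw [hS, mul_pow]; linarith
  have hq := norm_profile_sq_lt_one hL hτ₀ hα
  have hsb := (hasSum_geometric_of_lt_one (by positivity) hq).mul_right
    ((L * |2 * Real.sin (α / 2)|) ^ 2)
  rw [diffSeries_div_eq]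
  have hle : ∑' m : ℕ, ‖profile L σ α ^ (m + 1) - profile L τ α ^ (m + 1)‖ ^ 2 /
      ((m : ℝ) + 1) ^ 2 / (σ - τ) ^ 2 ≤
      (1 - ‖profile L τ₀ α‖ ^ 2)⁻¹ * (L * |2 * Real.sin (α / 2)|) ^ 2 := by
    rw [← hsb.tsum_eq]
    exact Summable.tsum_le_tsum (fun m => diffSeries_term_le hL hτ₀.le h1 h2 α m)
      (Summable.of_nonneg_of_le (fun m => by positivity)
        (fun m => diffSeries_term_le hL hτ₀.le h1 h2 α m) hsb.summable) hsb.summable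
  refine hle.trans ?_
  rw [mul_pow, sq_abs, norm_profile_sq, ← hS]
  set y := Real.sqrt (τ₀ * (τ₀ + 1) * S) with hy
  have hy2 : τ₀ * (τ₀ + 1) * S = y ^ 2 := (Real.sq_sqrt (by positivity)).symm
  have hy0 : 0 < y := Real.sqrt_pos.2 (by positivity)
  have hw : 0 < 1 + y ^ 2 := by positivity
  have hwL := one_lt_one_add_sq_rpow hL hy0.ne'
  have hg := integrand_le_inv hL y
  have hne : (1 + y ^ 2) ^ L - 1 ≠ 0 := by linarith
  have e : (1 - (1 + τ₀ * (τ₀ + 1) * S) ^ (-L))⁻¹ * (L ^ 2 * S) =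
      L ^ 2 / (τ₀ * (τ₀ + 1)) * (1 + y ^ 2) ^ (L + 1) * integrand L y := by
    rw [hy2, Real.rpow_neg hw.le, Real.rpow_add hw, Real.rpow_one, integrand]
    have : S = y ^ 2 / (τ₀ * (τ₀ + 1)) := by rw [← hy2]; field_simp
    rw [this]
    have h4 : (1 + y ^ 2) ^ L ≠ 0 := by positivity
    have h5 : 1 - ((1 + y ^ 2) ^ L)⁻¹ = ((1 + y ^ 2) ^ L - 1) / (1 + y ^ 2) ^ L := by
      field_simp
    rw [h5]
    field_simp
  rw [e]
  calc L ^ 2 / (τ₀ * (τ₀ + 1)) * (1 + y ^ 2) ^ (L + 1) * integrand L y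
      ≤ L ^ 2 / (τ₀ * (τ₀ + 1)) * (1 + τ₀ * (τ₀ + 1) * 4) ^ (L + 1) * (1 / L) := by
        rw [← hy2]
        have := integrand_nonneg hL y
        gcongr
    _ = _ := by field_simp

lemma diffSeries_term_le_four {L τ σ : ℝ} (hL : 0 < L) (hτ : 0 ≤ τ) (hσ : 0 ≤ σ) (α : ℝ) (m : ℕ) :
    ‖profile L σ α ^ (m + 1) - profile L τ α ^ (m + 1)‖ ^ 2 / ((m : ℝ) + 1) ^ 2 ≤
      4 / ((m : ℝ) + 1) ^ 2 := by
  have h1 {x : ℝ} (hx : 0 ≤ x) : ‖profile L x α ^ (m + 1)‖ ≤ 1 := by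
    rw [norm_pow]
    exact pow_le_one₀ (norm_nonneg _) (norm_profile_le_one hL hx α)
  have h2 := (norm_sub_le (profile L σ α ^ (m + 1)) (profile L τ α ^ (m + 1))).trans
    (add_le_add (h1 hσ) (h1 hτ))
  have h3 := pow_le_pow_left₀ (norm_nonneg _) h2 2
  gcongr
  linarith

lemma summable_four_div : Summable fun m : ℕ => 4 / ((m : ℝ) + 1) ^ 2 := by
  have h := (summable_nat_add_iff 1).2 (Real.summable_one_div_nat_pow.2 one_lt_two)
  refine (h.mul_left 4).congr fun m => ?_
  push_cast
  ring

lemma continuous_diffSeries {L τ σ : ℝ} (hL : 0 < L) (hτ : 0 ≤ τ) (hσ : 0 ≤ σ) :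
    Continuous (diffSeries L τ σ) := by
  refine continuous_tsum (fun m => ?_) summable_four_div fun m α => ?_
  · exact ((((continuous_profile hσ).pow _).sub
      ((continuous_profile hτ).pow _)).norm.pow 2).div_const _
  · rw [Real.norm_of_nonneg (by positivity)]
    exact diffSeries_term_le_four hL hτ hσ α m

lemma hasSum_second_difference {L s t : ℝ} (hL : 0 < L) (hs0 : 0 ≤ s) (hs : s < 1) (ht0 : 0 ≤ t)
    (ht : t < 1) :
    HasSum (fun m : ℕ => (corrAverage (L * (m + 1 : ℕ)) s s -
        2 * corrAverage (L * (m + 1 : ℕ)) s t +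
        corrAverage (L * (m + 1 : ℕ)) t t) / ((m : ℝ) + 1) ^ 2)
      ((2 * Real.pi)⁻¹ * ∫ α in (0 : ℝ)..(2 * Real.pi),
        diffSeries L (t ^ 2 / (1 - t ^ 2)) (s ^ 2 / (1 - s ^ 2)) α) := by
  have hs2 : 0 < 1 - s ^ 2 := by nlinarith
  have ht2 : 0 < 1 - t ^ 2 := by nlinarith
  have hσ : 0 ≤ s ^ 2 / (1 - s ^ 2) := by positivity
  have hτ : 0 ≤ t ^ 2 / (1 - t ^ 2) := by positivity
  set σ := s ^ 2 / (1 - s ^ 2) with hσ'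
  set τ := t ^ 2 / (1 - t ^ 2) with hτ'
  have hcont (m : ℕ) : Continuous fun α =>
      ‖profile L σ α ^ (m + 1) - profile L τ α ^ (m + 1)‖ ^ 2 / ((m : ℝ) + 1) ^ 2 :=
    ((((continuous_profile hσ).pow _).sub ((continuous_profile hτ).pow _)).norm.pow 2).div_const _
  have h := intervalIntegral.hasSum_integral_of_dominated_convergence
    (μ := volume) (a := 0) (b := 2 * Real.pi)
    (F := fun (m : ℕ) α => ‖profile L σ α ^ (m + 1) - profile L τ α ^ (m + 1)‖ ^ 2 /
      ((m : ℝ) + 1) ^ 2) (f := diffSeries L τ σ)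
    (fun (m : ℕ) _ => 4 / ((m : ℝ) + 1) ^ 2)
    (fun m => (hcont m).aestronglyMeasurable)
    (fun m => ae_of_all _ fun α _ => by
      rw [Real.norm_of_nonneg (by positivity)]
      exact diffSeries_term_le_four hL hτ hσ α m)
    (ae_of_all _ fun α _ => summable_four_div)
    intervalIntegrable_const
    (ae_of_all _ fun α _ => (Summable.of_nonneg_of_le (fun m => by positivity)
      (diffSeries_term_le_four hL hτ hσ α) summable_four_div).hasSum)
  refine (h.mul_left _).congr_fun fun m => ?_
  rw [corrAverage_second_difference hL m.succ_pos hs0 hs ht0 ht, intervalIntegral.integral_div,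
    mul_div_assoc]

lemma integral_integrand_sin {L : ℝ} (hL : 0 < L) (k : ℝ) :
    ∫ α in (0 : ℝ)..(2 * Real.pi), integrand L (k * (2 * Real.sin (α / 2))) =
      2 * arcIntegral L (2 * k) := by
  have hi (a b : ℝ) : IntervalIntegrable
      (fun α => integrand L (k * (2 * Real.sin (α / 2)))) volume a b :=
    intervalIntegrable_integrand_comp hL (by fun_prop) a b
  have h1 : ∫ α in Real.pi..(2 * Real.pi), integrand L (k * (2 * Real.sin (α / 2))) =
      ∫ α in (0 : ℝ)..Real.pi, integrand L (k * (2 * Real.sin (α / 2))) := by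
    have h := intervalIntegral.integral_comp_sub_left (a := 0) (b := Real.pi)
      (fun α => integrand L (k * (2 * Real.sin (α / 2)))) (2 * Real.pi)
    rw [sub_zero, show 2 * Real.pi - Real.pi = Real.pi by ring] at h
    rw [← h]
    refine intervalIntegral.integral_congr fun α _ => ?_
    rw [show (2 * Real.pi - α) / 2 = Real.pi - α / 2 by ring, Real.sin_pi_sub]
  rw [← intervalIntegral.integral_add_adjacent_intervals (hi 0 Real.pi) (hi Real.pi _), h1,
    ← two_mul, arcIntegral]
  congr 1
  refine intervalIntegral.integral_congr fun α _ => ?_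
  congr 1
  ring

lemma tendsto_integral_diffSeries {L σ : ℝ} (hL : 0 < L) (hσ : 0 < σ) :
    Tendsto (fun τ => (∫ α in (0 : ℝ)..(2 * Real.pi), diffSeries L τ σ α) / (σ - τ) ^ 2) (𝓝[<] σ)
      (𝓝 (L ^ 2 / (σ * (σ + 1)) * (2 * arcIntegral L (2 * Real.sqrt (σ * (σ + 1)))))) := by
  rw [← integral_integrand_sin hL, ← intervalIntegral.integral_const_mul]
  simp_rw [← intervalIntegral.integral_div]
  have hτ₀ : 0 < σ / 2 := by linarith
  have hmem : Set.Ioo (σ / 2) σ ∈ 𝓝[<] σ := Ioo_mem_nhdsLT (by linarith)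
  have hsin : ∀ᵐ α : ℝ, α ∈ Set.uIoc 0 (2 * Real.pi) → Real.sin (α / 2) ≠ 0 := by
    filter_upwards [compl_mem_ae_iff.2 (measure_singleton (2 * Real.pi) : volume {2 * Real.pi} = 0)]
      with α h1 h2
    rw [Set.uIoc_of_le (by positivity)] at h2
    exact sin_half_ne_zero ⟨h2.1, lt_of_le_of_ne h2.2 h1⟩
  refine intervalIntegral.tendsto_integral_filter_of_dominated_convergence
    (fun _ => L / (σ / 2 * (σ / 2 + 1)) * (1 + σ / 2 * (σ / 2 + 1) * 4) ^ (L + 1)) ?_ ?_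
    intervalIntegrable_const ?_
  · filter_upwards [hmem] with τ hτ
    exact ((continuous_diffSeries hL (hτ₀.trans hτ.1).le hσ.le).div_const _).aestronglyMeasurable
  · filter_upwards [hmem] with τ hτ
    filter_upwards [hsin] with α h1 h2
    rw [Real.norm_of_nonneg (div_nonneg (diffSeries_nonneg L τ σ α) (sq_nonneg _))]
    exact diffSeries_div_le hL hτ₀ hτ.1.le hτ.2 (h1 h2)
  · filter_upwards [hsin] with α h1 h2
    exact tendsto_diffSeries hL hσ (h1 h2)

/-- The normalized second differences converge to the variance. -/
lemma tendsto_second_difference {L r : ℝ} (hL : 0 < L) (hr0 : 0 < r) (hr : r < 1) :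
    Tendsto (fun s => 1 / 4 * (∑' m : ℕ, (corrAverage (L * (m + 1 : ℕ)) r r -
        2 * corrAverage (L * (m + 1 : ℕ)) r s + corrAverage (L * (m + 1 : ℕ)) s s) /
        ((m : ℝ) + 1) ^ 2) / Real.log (r / s) ^ 2) (𝓝[<] r) (𝓝 (varianceFormula L r)) := by
  have hr2 : 0 < 1 - r ^ 2 := by nlinarith
  set σ := r ^ 2 / (1 - r ^ 2) with hσ'
  have hσ : 0 < σ := by positivity
  -- This identity is what makes the argument of g equal to (2r/(1-r²)) sin(α/2).
  have hk : σ * (σ + 1) = (r / (1 - r ^ 2)) ^ 2 := by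
    rw [hσ']; field_simp; ring
  have hd1 : HasDerivAt (fun s : ℝ => s ^ 2 / (1 - s ^ 2)) (2 * r / (1 - r ^ 2) ^ 2) r := by
    have h := ((hasDerivAt_id r).pow 2).div (((hasDerivAt_id r).pow 2).const_sub 1) hr2.ne'
    refine h.congr_deriv ?_
    simp only [id, Pi.pow_apply]
    field_simp
    ring
  have hd2 := Real.hasDerivAt_log hr0.ne'
  have hle : 𝓝[<] r ≤ 𝓝[≠] r := nhdsWithin_mono r fun x (hx : x < r) => hx.ne
  have hmem : Set.Ioo 0 r ∈ 𝓝[<] r := Ioo_mem_nhdsLT hr0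
  have hlt {s : ℝ} (hs : s ∈ Set.Ioo 0 r) : s ^ 2 / (1 - s ^ 2) < σ := by
    obtain ⟨h1, h2⟩ := hs
    rw [hσ', div_lt_div_iff₀ (by nlinarith) hr2]
    nlinarith
  have hτ : Tendsto (fun s : ℝ => s ^ 2 / (1 - s ^ 2)) (𝓝[<] r) (𝓝[<] σ) :=
    tendsto_nhdsWithin_iff.2 ⟨hd1.continuousAt.tendsto.mono_left nhdsWithin_le_nhds, by
      filter_upwards [hmem] with s hs using hlt hs⟩
  have hA := (tendsto_integral_diffSeries hL hσ).comp hτ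
  -- Change of variable from σ to log r: the squared ratio of the derivatives of s²/(1-s²) and of
  -- log s at r.
  have hB := (((hasDerivAt_iff_tendsto_slope.1 hd1).mono_left hle).div
    ((hasDerivAt_iff_tendsto_slope.1 hd2).mono_left hle) (inv_ne_zero hr0.ne')).pow 2
  have hC := ((hA.mul hB).const_mul ((2 * Real.pi)⁻¹)).const_mul (1 / 4)
  have e : 1 / 4 * ((2 * Real.pi)⁻¹ * (L ^ 2 / (σ * (σ + 1)) *
      (2 * arcIntegral L (2 * Real.sqrt (σ * (σ + 1)))) * (2 * r / (1 - r ^ 2) ^ 2 / r⁻¹) ^ 2)) =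
      varianceFormula L r := by
    rw [hk, Real.sqrt_sq (by positivity), varianceFormula]
    field_simp
    norm_num
  rw [e] at hC
  refine hC.congr' ?_
  filter_upwards [hmem] with s hs
  have hs1 : s < 1 := hs.2.trans hr
  have hd : 0 < r - s := by linarith [hs.2]
  have hlog : 0 < Real.log (r / s) := Real.log_pos ((one_lt_div hs.1).2 hs.2)
  have hlog' : Real.log s - Real.log r = - Real.log (r / s) := by
    rw [Real.log_div hr0.ne' hs.1.ne']; ring
  have hst : σ - s ^ 2 / (1 - s ^ 2) ≠ 0 := (sub_pos.2 (hlt hs)).ne'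
  rw [(hasSum_second_difference hL hr0.le hr hs.1.le hs1).tsum_eq]
  simp only [Function.comp_apply, Pi.div_apply, slope_def_field, hlog']
  rw [← hσ', show s ^ 2 / (1 - s ^ 2) - σ = -(σ - s ^ 2 / (1 - s ^ 2)) by ring,
    show s - r = -(r - s) by ring]
  set D := σ - s ^ 2 / (1 - s ^ 2)
  field_simp

/-! ### Almost sure convergence and regularization of the random series. -/

lemma integrable_norm_stdComplexNormal : Integrable (fun z : ℂ => ‖z‖) stdComplexNormal := by
  have h1 : Integrable (fun x : ℝ => x) (gaussianReal 0 (1 / 2)) :=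
    memLp_one_iff_integrable.1 (memLp_id_gaussianReal 1)
  rw [stdComplexNormal, integrable_map_equiv]
  refine ((h1.abs.comp_fst (gaussianReal 0 (1 / 2))).add
    (h1.abs.comp_snd (gaussianReal 0 (1 / 2)))).mono' (by fun_prop) (ae_of_all _ fun x => ?_)
  simp only [Function.comp_apply, norm_norm, Pi.add_apply]
  exact Complex.norm_le_abs_re_add_abs_im _

/-- The power series with coefficients `c n * √(binom L n)` converges absolutely on the disc. -/
def AbsConvergent (L : ℝ) (c : ℕ → ℂ) : Prop :=
  ∀ R : ℝ, 0 ≤ R → R < 1 → Summable fun n => ‖c n‖ * Real.sqrt (binom L n) * R ^ n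

lemma summable_sqrt_binom {L R : ℝ} (hL : 0 < L) (hR0 : 0 ≤ R) (hR : R < 1) :
    Summable fun n => Real.sqrt (binom L n) * R ^ n := by
  refine Summable.of_nonneg_of_le (fun n => by positivity) (fun n => ?_)
    ((summable_geometric_of_lt_one hR0 hR).add (summable_binom hL hR0 hR))
  have h : Real.sqrt (binom L n) ≤ 1 + binom L n := by
    refine Real.sqrt_le_iff.2 ⟨by have := binom_pos hL n; linarith, ?_⟩
    nlinarith [binom_pos hL n]
  calc Real.sqrt (binom L n) * R ^ n ≤ (1 + binom L n) * R ^ n := by gcongr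
    _ = _ := by ring

lemma absConvergent_of_dirac {L : ℝ} : AbsConvergent L (fun n => if n = 0 then 1 else 0) := by
  intro R _ _
  refine summable_of_ne_finset_zero (s := {0}) fun n hn => ?_
  rw [Finset.mem_singleton] at hn
  simp [hn]

section

variable {Ω : Type*} [MeasurableSpace Ω] {P : Measure Ω}

/-- For fixed R < 1 the sum of absolute values has finite expectation. The countably many radii 1 -
1/(k+1) suffice by monotonicity in R. -/
lemma ae_absConvergent [IsProbabilityMeasure P] {L : ℝ} (hL : 0 < L) {a : ℕ → Ω → ℂ}
    (ha : ∀ n, Measurable (a n)) (hlaw : ∀ n, P.map (a n) = stdComplexNormal) :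
    ∀ᵐ ω ∂P, AbsConvergent L (fun n => a n ω) := by
  set C := ∫⁻ z, ‖z‖ₑ ∂stdComplexNormal with hC
  have hCtop : C ≠ ⊤ := by
    have := integrable_norm_stdComplexNormal.2
    rw [HasFiniteIntegral] at this
    simpa only [enorm_norm] using this.ne
  have key (k : ℕ) : ∀ᵐ ω ∂P, Summable fun n =>
      ‖a n ω‖ * Real.sqrt (binom L n) * (1 - 1 / ((k : ℝ) + 1)) ^ n := by
    set R : ℝ := 1 - 1 / ((k : ℝ) + 1) with hR
    have hk : (0 : ℝ) < (k : ℝ) + 1 := by positivity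
    have hR0 : 0 ≤ R := by
      rw [hR, sub_nonneg, div_le_one hk]
      have : (0 : ℝ) ≤ k := k.cast_nonneg
      linarith
    have hR1 : R < 1 := by
      have : 0 < 1 / ((k : ℝ) + 1) := by positivity
      linarith
    have hfin : ∫⁻ ω, ∑' n, ENNReal.ofReal (Real.sqrt (binom L n) * R ^ n) * ‖a n ω‖ₑ ∂P ≠ ⊤ := by
      rw [lintegral_tsum fun n => ((ha n).enorm.const_mul _).aemeasurable]
      have e (n : ℕ) : ∫⁻ ω, ENNReal.ofReal (Real.sqrt (binom L n) * R ^ n) * ‖a n ω‖ₑ ∂P =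
          ENNReal.ofReal (Real.sqrt (binom L n) * R ^ n) * C := by
        rw [lintegral_const_mul _ (ha n).enorm, hC, ← hlaw n, lintegral_map (by fun_prop) (ha n)]
      simp_rw [e]
      rw [ENNReal.tsum_mul_right]
      exact ENNReal.mul_ne_top (summable_sqrt_binom hL hR0 hR1).tsum_ofReal_ne_top hCtop
    filter_upwards [ae_lt_top (by fun_prop) hfin] with ω hω
    have h := ENNReal.summable_toReal hω.ne
    refine h.congr fun n => ?_
    rw [ENNReal.toReal_mul, ENNReal.toReal_ofReal (by positivity), toReal_enorm]
    ring
  filter_upwards [ae_all_iff.2 key] with ω hω R hR0 hR1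
  obtain ⟨k, hk⟩ := exists_nat_one_div_lt (sub_pos.2 hR1)
  refine Summable.of_nonneg_of_le (fun n => by positivity) (fun n => ?_) (hω k)
  gcongr
  linarith

/-- A random coefficient sequence whose power series converges absolutely on the unit disc, with
non-vanishing constant term, for every outcome. -/
structure IsRegularSeq (P : Measure Ω) (L : ℝ) (a : ℕ → Ω → ℂ) : Prop where
  measurable : ∀ n, Measurable (a n)
  map_eq : ∀ n, P.map (a n) = stdComplexNormal
  indep : iIndepFun a P
  absConvergent : ∀ ω, AbsConvergent L fun n => a n ω
  ne_zero : ∀ ω, a 0 ω ≠ 0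

/-- On a null set the coefficients are replaced by 1, 0, 0, …, so that the field is constant 1
there. Analyticity and f(0) ≠ 0 then hold for every outcome, without changing the law or, almost
surely, the zero counts. -/
lemma exists_isRegularSeq [IsProbabilityMeasure P] {L : ℝ} (hL : 0 < L) {a : ℕ → Ω → ℂ}
    (ha_law : ∀ n, HasLaw (a n) stdComplexNormal P) (ha_indep : iIndepFun a P) :
    ∃ b : ℕ → Ω → ℂ, IsRegularSeq P L b ∧ ∀ r, numZeros a L r =ᵐ[P] numZeros b L r := by
  set a' : ℕ → Ω → ℂ := fun n => (ha_law n).aemeasurable.mk (a n) with ha'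
  have hae (n : ℕ) : a n =ᵐ[P] a' n := (ha_law n).aemeasurable.ae_eq_mk
  have hm (n : ℕ) : Measurable (a' n) := (ha_law n).aemeasurable.measurable_mk
  have hlaw (n : ℕ) : P.map (a' n) = stdComplexNormal := by
    rw [← Measure.map_congr (hae n), (ha_law n).map_eq]
  have h0 : ∀ᵐ ω ∂P, a' 0 ω ≠ 0 := by
    have h := ae_ne_zero_stdComplexNormal
    rw [← hlaw 0] at h
    exact ae_of_ae_map (hm 0).aemeasurable h
  have hgood : ∀ᵐ ω ∂P, AbsConvergent L (fun n => a' n ω) ∧ a' 0 ω ≠ 0 :=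
    (ae_absConvergent hL hm hlaw).and h0
  -- The exceptional set is not shown to be measurable; enlarging it to a measurable null set keeps
  -- the modified coefficients measurable.
  set T := toMeasurable P {ω | ¬(AbsConvergent L (fun n => a' n ω) ∧ a' 0 ω ≠ 0)} with hT
  have hTm : MeasurableSet T := measurableSet_toMeasurable _ _
  have hT0 : P T = 0 := by rw [hT, measure_toMeasurable]; exact hgood
  have hTc : ∀ᵐ ω ∂P, ω ∉ T := compl_mem_ae_iff.2 hT0
  have hTgood {ω : Ω} (hω : ω ∉ T) : AbsConvergent L (fun n => a' n ω) ∧ a' 0 ω ≠ 0 := by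
    by_contra h
    exact hω (subset_toMeasurable P _ h)
  classical
  set b : ℕ → Ω → ℂ := fun n ω => if ω ∈ T then (if n = 0 then 1 else 0) else a' n ω with hb
  have hab (n : ℕ) : a n =ᵐ[P] b n := by
    filter_upwards [hae n, hTc] with ω h1 h2
    rw [h1, hb]
    simp only [if_neg h2]
  refine ⟨b, ⟨fun n => Measurable.ite hTm measurable_const (hm n), fun n => ?_,
    ha_indep.congr hab, fun ω => ?_, fun ω => ?_⟩, fun r => ?_⟩
  · rw [← Measure.map_congr (hab n), (ha_law n).map_eq]
  · by_cases hω : ω ∈ T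
    · simp only [hb, if_pos hω]
      exact absConvergent_of_dirac
    · simp only [hb, if_neg hω]
      exact (hTgood hω).1
  · by_cases hω : ω ∈ T
    · simp [hb, hω]
    · simp only [hb, if_neg hω]
      exact (hTgood hω).2
  · filter_upwards [ae_all_iff.2 hab] with ω hω
    rw [numZeros, numZeros]
    simp_rw [hω]

end

section

variable {L : ℝ} {c : ℕ → ℂ}

lemma norm_gaf_term (c : ℕ → ℂ) (z : ℂ) (n : ℕ) :
    ‖c n * (Real.sqrt (binom L n) : ℂ) * z ^ n‖ = ‖c n‖ * Real.sqrt (binom L n) * ‖z‖ ^ n := by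
  rw [norm_mul, norm_mul, norm_pow, Complex.norm_real, Real.norm_of_nonneg (Real.sqrt_nonneg _)]

lemma AbsConvergent.hasSum_gaf (h : AbsConvergent L c) {z : ℂ} (hz : ‖z‖ < 1) :
    HasSum (fun n => c n * (Real.sqrt (binom L n) : ℂ) * z ^ n) (gaf L c z) := by
  refine Summable.hasSum (Summable.of_norm ?_)
  simp_rw [norm_gaf_term]
  exact h _ (norm_nonneg z) hz

lemma AbsConvergent.analyticOnNhd_gaf (h : AbsConvergent L c) :
    AnalyticOnNhd ℂ (gaf L c) (Metric.ball 0 1) := by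
  intro z hz
  rw [mem_ball_zero_iff] at hz
  obtain ⟨R, hR1, hR2⟩ := exists_between hz
  have hR0 : 0 ≤ R := (norm_nonneg z).trans hR1.le
  have hd : DifferentiableOn ℂ (gaf L c) (Metric.ball 0 R) := by
    refine Complex.differentiableOn_tsum_of_summable_norm (h R hR0 hR2)
      (fun n => by fun_prop) Metric.isOpen_ball fun n w hw => ?_
    rw [mem_ball_zero_iff] at hw
    rw [norm_gaf_term]
    gcongr
  exact hd.analyticAt (Metric.isOpen_ball.mem_nhds (by rwa [mem_ball_zero_iff]))

lemma gaf_zero (hL : 0 < L) : gaf L c 0 = c 0 := by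
  rw [gaf, tsum_eq_single 0 fun n hn => by simp [hn]]
  simp [binom_zero hL]

end

section

variable {Ω : Type*} [MeasurableSpace Ω] {P : Measure Ω} {L : ℝ} {a : ℕ → Ω → ℂ}

lemma IsRegularSeq.measurable_gaf_circleMap (h : IsRegularSeq P L a) {s : ℝ}
    (hs0 : 0 ≤ s) (hs : s < 1) :
    Measurable fun x : Ω × ℝ => gaf L (fun n => a n x.1) (circleMap 0 s x.2) := by
  have hz (θ : ℝ) : ‖circleMap 0 s θ‖ < 1 := by rwa [norm_circleMap_zero, abs_of_nonneg hs0]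
  refine measurable_of_tendsto_metrizable (f := fun (N : ℕ) (x : Ω × ℝ) =>
    ∑ n ∈ Finset.range N, a n x.1 * (Real.sqrt (binom L n) : ℂ) * circleMap 0 s x.2 ^ n)
    (fun N => ?_) ?_
  · refine Finset.measurable_sum _ fun n _ => ?_
    have h1 := (h.measurable n).comp (measurable_fst : Measurable fun x : Ω × ℝ => x.1)
    have h2 := (continuous_circleMap 0 s).measurable.comp
      (measurable_snd : Measurable fun x : Ω × ℝ => x.2)
    exact (h1.mul_const _).mul (h2.pow_const n)
  · rw [tendsto_pi_nhds]
    intro x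
    exact ((h.absConvergent x.1).hasSum_gaf (hz x.2)).tendsto_sum_nat

/-! ### Correlations of the normalized field. -/

/-- The orthonormalized monomials `(1-|z|²)^{L/2} √(binom L n) zⁿ`. -/
noncomputable def normMonomial (L : ℝ) (z : ℂ) (n : ℕ) : ℂ :=
  ((1 - ‖z‖ ^ 2) ^ (L / 2) : ℝ) * ((Real.sqrt (binom L n) : ℂ) * z ^ n)

/-- The correlation of the normalized hyperbolic GAF at two points. -/
noncomputable def corr (L : ℝ) (z w : ℂ) : ℂ :=
  ((1 - ‖z‖ ^ 2) ^ (L / 2) * (1 - ‖w‖ ^ 2) ^ (L / 2) : ℝ) *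
    (1 / (1 - starRingEnd ℂ z * w) ^ (L : ℂ))

lemma one_sub_norm_sq_pos {z : ℂ} (hz : ‖z‖ < 1) : 0 < 1 - ‖z‖ ^ 2 := by
  nlinarith [norm_nonneg z]

lemma norm_conj_mul_lt_one {z w : ℂ} (hz : ‖z‖ < 1) (hw : ‖w‖ < 1) : ‖starRingEnd ℂ z * w‖ < 1 := by
  rw [norm_mul, RCLike.norm_conj]
  nlinarith [norm_nonneg z, norm_nonneg w]

lemma hasSum_corr (hL : 0 < L) {z w : ℂ} (hz : ‖z‖ < 1) (hw : ‖w‖ < 1) :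
    HasSum (fun n => starRingEnd ℂ (normMonomial L z n) * normMonomial L w n) (corr L z w) := by
  refine ((hasSum_binom hL (norm_conj_mul_lt_one hz hw)).mul_left _).congr_fun fun n => ?_
  have hb : (Real.sqrt (binom L n) : ℂ) * Real.sqrt (binom L n) = binom L n := by
    rw [← Complex.ofReal_mul, Real.mul_self_sqrt (binom_pos hL n).le]
  rw [← hb]
  simp only [normMonomial, map_mul, map_pow, Complex.conj_ofReal]
  push_cast
  ring

lemma corr_self {z : ℂ} (hz : ‖z‖ < 1) : corr L z z = 1 := by
  have hp := one_sub_norm_sq_pos hz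
  have e : starRingEnd ℂ z * z = ((‖z‖ ^ 2 : ℝ) : ℂ) := by
    rw [mul_comm, Complex.mul_conj, Complex.normSq_eq_norm_sq]
  rw [corr, e, ← Complex.ofReal_one, ← Complex.ofReal_sub, ← Complex.ofReal_cpow hp.le,
    ← Complex.ofReal_div, ← Complex.ofReal_mul, ← Real.rpow_add hp, add_halves,
    mul_one_div_cancel (by positivity)]

lemma norm_corr_sq {z w : ℂ} (hz : ‖z‖ < 1) (hw : ‖w‖ < 1) :
    ‖corr L z w‖ ^ 2 = corrSq L z w := by
  have hp := one_sub_norm_sq_pos hz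
  have hq := one_sub_norm_sq_pos hw
  have e : ‖1 - z * starRingEnd ℂ w‖ = ‖1 - starRingEnd ℂ z * w‖ := by
    rw [← RCLike.norm_conj]
    simp
  have h2 {x : ℝ} (hx : 0 ≤ x) : (x ^ (L / 2)) ^ 2 = x ^ L := by
    rw [← Real.rpow_mul_natCast hx]
    congr 1
    push_cast
    ring
  rw [corr, corrSq, e, norm_mul, mul_pow, Complex.norm_real, Real.norm_eq_abs, sq_abs, mul_pow,
    h2 hp.le, h2 hq.le, norm_div, norm_one, Complex.norm_cpow_real, div_pow, one_pow,
    Real.div_rpow (by positivity) (by positivity), Real.mul_rpow hp.le hq.le, mul_one_div]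
  congr 1
  rw [← Real.rpow_mul_natCast (norm_nonneg _), ← Real.rpow_natCast_mul (norm_nonneg _), mul_comm L]

lemma corrSq_pos {z w : ℂ} (hz : ‖z‖ < 1) (hw : ‖w‖ < 1) : 0 < corrSq L z w := by
  have hp := one_sub_norm_sq_pos hz
  have hq := one_sub_norm_sq_pos hw
  have h := one_sub_ne_zero_of_norm_lt (norm_conj_mul_lt_one hw hz)
  rw [mul_comm] at h
  have := norm_pos_iff.2 h
  exact Real.rpow_pos_of_pos (by positivity) _

/-- Follows from |1 - z w̄|² - (1-|z|²)(1-|w|²) = |z - w|². -/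
lemma corrSq_base_lt_one {z w : ℂ} (hz : ‖z‖ < 1) (hw : ‖w‖ < 1) (hzw : z ≠ w) :
    (1 - ‖z‖ ^ 2) * (1 - ‖w‖ ^ 2) / ‖1 - z * starRingEnd ℂ w‖ ^ 2 < 1 := by
  have h := one_sub_ne_zero_of_norm_lt (norm_conj_mul_lt_one hw hz)
  rw [mul_comm] at h
  have h0 := norm_pos_iff.2 h
  rw [div_lt_one (by positivity)]
  have h1 : 0 < ‖z - w‖ ^ 2 := by
    have := norm_pos_iff.2 (sub_ne_zero.2 hzw)
    positivity
  rw [← Complex.normSq_eq_norm_sq, Complex.normSq_apply] at h1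
  rw [← Complex.normSq_eq_norm_sq, ← Complex.normSq_eq_norm_sq, ← Complex.normSq_eq_norm_sq,
    Complex.normSq_apply, Complex.normSq_apply, Complex.normSq_apply]
  simp only [Complex.sub_re, Complex.sub_im, Complex.mul_re, Complex.mul_im, Complex.conj_re,
    Complex.conj_im, Complex.one_re, Complex.one_im] at h1 ⊢
  nlinarith

lemma corrSq_lt_one (hL : 0 < L) {z w : ℂ} (hz : ‖z‖ < 1) (hw : ‖w‖ < 1) (hzw : z ≠ w) :
    corrSq L z w < 1 := by
  refine Real.rpow_lt_one ?_ (corrSq_base_lt_one hz hw hzw) hL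
  have hp := one_sub_norm_sq_pos hz
  have hq := one_sub_norm_sq_pos hw
  positivity

/-- The normalized field `(1-|z|²)^{L/2} f_L(z)`. -/
noncomputable def normGaf (L : ℝ) (c : ℕ → ℂ) (z : ℂ) : ℂ :=
  ((1 - ‖z‖ ^ 2) ^ (L / 2) : ℝ) * gaf L c z

lemma norm_add_sq_eq (x y : ℂ) :
    ‖x + y‖ ^ 2 = ‖x‖ ^ 2 + ‖y‖ ^ 2 + 2 * (starRingEnd ℂ x * y).re := by
  rw [← Complex.normSq_eq_norm_sq, ← Complex.normSq_eq_norm_sq, ← Complex.normSq_eq_norm_sq,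
    Complex.normSq_add, ← Complex.conj_re]
  simp

lemma hasSum_norm_normMonomial_sq (hL : 0 < L) {z : ℂ} (hz : ‖z‖ < 1) :
    HasSum (fun n => ‖normMonomial L z n‖ ^ 2) 1 := by
  have h := Complex.hasSum_re (hasSum_corr hL hz hz)
  rw [corr_self hz, Complex.one_re] at h
  refine h.congr_fun fun n => ?_
  rw [mul_comm, Complex.mul_conj, Complex.ofReal_re, Complex.normSq_eq_norm_sq]

/-- A combination p·f(z) + q·f(w) is again a series in the coefficients. The squared norms of its
coefficients sum to |p|² + |q|² + 2 Re(p̄ q · corr), which is the required exponent because |corr|²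
+ σ² = 1. -/
lemma IsRegularSeq.isGaussianPair [IsProbabilityMeasure P] (hL : 0 < L) (h : IsRegularSeq P L a)
    {z w : ℂ} (hz : ‖z‖ < 1) (hw : ‖w‖ < 1) {σ : ℝ} (hσ : ‖corr L z w‖ ^ 2 + σ ^ 2 = 1) :
    IsGaussianPair P (fun ω => normGaf L (fun n => a n ω) z)
      (fun ω => normGaf L (fun n => a n ω) w) (corr L z w) σ := by
  intro p q
  have hS : HasSum (fun n => ‖p * normMonomial L z n + q * normMonomial L w n‖ ^ 2)
      (‖p + q * corr L z w‖ ^ 2 + ‖q * σ‖ ^ 2) := by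
    have h1 := (((hasSum_norm_normMonomial_sq hL hz).mul_left (‖p‖ ^ 2)).add
      ((hasSum_norm_normMonomial_sq hL hw).mul_left (‖q‖ ^ 2))).add
      ((Complex.hasSum_re ((hasSum_corr hL hz hw).mul_left (starRingEnd ℂ p * q))).mul_left 2)
    have e : ‖p + q * corr L z w‖ ^ 2 + ‖q * σ‖ ^ 2 =
        ‖p‖ ^ 2 * 1 + ‖q‖ ^ 2 * 1 + 2 * (starRingEnd ℂ p * q * corr L z w).re := by
      rw [norm_add_sq_eq, norm_mul, norm_mul, mul_pow, mul_pow, Complex.norm_real,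
        Real.norm_eq_abs, sq_abs, mul_assoc (starRingEnd ℂ p)]
      linear_combination ‖q‖ ^ 2 * hσ
    rw [e]
    refine h1.congr_fun fun n => ?_
    rw [norm_add_sq_eq, norm_mul, norm_mul, mul_pow, mul_pow, map_mul]
    congr 3
    ring
  refine integral_expRe_series h.measurable h.map_eq h.indep hS fun ω => ?_
  have hf {z : ℂ} (hz : ‖z‖ < 1) := (h.absConvergent ω).hasSum_gaf hz
  have h2 := (((hf hz).mul_left (p * ((1 - ‖z‖ ^ 2) ^ (L / 2) : ℝ))).add
    ((hf hw).mul_left (q * ((1 - ‖w‖ ^ 2) ^ (L / 2) : ℝ))))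
  have e : p * normGaf L (fun n => a n ω) z + q * normGaf L (fun n => a n ω) w =
      p * ((1 - ‖z‖ ^ 2) ^ (L / 2) : ℝ) * gaf L (fun n => a n ω) z +
        q * ((1 - ‖w‖ ^ 2) ^ (L / 2) : ℝ) * gaf L (fun n => a n ω) w := by
    rw [normGaf, normGaf]
    ring
  rw [e]
  refine h2.congr_fun fun n => ?_
  rw [normMonomial, normMonomial]
  ring

end

/-! ### Second moments of angular averages. -/

section

variable {Ω Θ : Type*} [MeasurableSpace Ω] [MeasurableSpace Θ] {P : Measure Ω} {ν : Measure Θ}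
  [IsProbabilityMeasure P] [IsProbabilityMeasure ν] {h k : Ω × Θ → ℝ}

/-- A product of two averages is a double average over two independent angles. Forgetting either
angle preserves measure, so both factors stay square integrable on the triple product. -/
lemma integrable_mul_prod (hh : MemLp h 2 (P.prod ν)) (hk : MemLp k 2 (P.prod ν)) :
    Integrable (fun x : Ω × Θ × Θ => h (x.1, x.2.1) * k (x.1, x.2.2)) (P.prod (ν.prod ν)) := by
  have h1 : MeasurePreserving (fun x : Ω × Θ × Θ => (x.1, x.2.1)) (P.prod (ν.prod ν)) (P.prod ν) :=
    (MeasurePreserving.id P).prod measurePreserving_fst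
  have h2 : MeasurePreserving (fun x : Ω × Θ × Θ => (x.1, x.2.2)) (P.prod (ν.prod ν)) (P.prod ν) :=
    (MeasurePreserving.id P).prod measurePreserving_snd
  exact (hh.comp_measurePreserving h1).integrable_mul (hk.comp_measurePreserving h2)

lemma memLp_integral_right (hh : MemLp h 2 (P.prod ν)) :
    MemLp (fun ω => ∫ θ, h (ω, θ) ∂ν) 2 P := by
  refine (memLp_two_iff_integrable_sq hh.1.integral_prod_right').2 ?_
  refine (integrable_mul_prod hh hh).integral_prod_left.congr (ae_of_all _ fun ω => ?_)
  exact (integral_prod_mul (fun θ => h (ω, θ)) fun θ => h (ω, θ)).trans (sq _).symm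

lemma integral_integral_mul_integral (hh : MemLp h 2 (P.prod ν)) (hk : MemLp k 2 (P.prod ν)) :
    ∫ ω, (∫ θ, h (ω, θ) ∂ν) * (∫ θ, k (ω, θ) ∂ν) ∂P =
      ∫ x : Θ × Θ, ∫ ω, h (ω, x.1) * k (ω, x.2) ∂P ∂(ν.prod ν) := by
  rw [← integral_integral_swap (f := fun ω (x : Θ × Θ) => h (ω, x.1) * k (ω, x.2))
    (integrable_mul_prod hh hk)]
  refine integral_congr_ae (ae_of_all _ fun ω => ?_)
  exact (integral_prod_mul (fun θ => h (ω, θ)) fun θ => k (ω, θ)).symm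

end

/-- The uniform distribution of an angle. -/
noncomputable def angleLaw : Measure ℝ :=
  (ENNReal.ofReal (2 * Real.pi))⁻¹ • volume.restrict (Set.Ioc 0 (2 * Real.pi))

instance : IsProbabilityMeasure angleLaw := by
  refine ⟨?_⟩
  rw [angleLaw, Measure.smul_apply, Measure.restrict_apply_univ, Real.volume_Ioc, sub_zero,
    smul_eq_mul]
  exact ENNReal.inv_mul_cancel (ENNReal.ofReal_pos.2 (by positivity)).ne' ENNReal.ofReal_ne_top

lemma integral_angleLaw (f : ℝ → ℝ) :
    ∫ θ, f θ ∂angleLaw = (2 * Real.pi)⁻¹ * ∫ θ in (0 : ℝ)..(2 * Real.pi), f θ := by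
  rw [angleLaw, integral_smul_measure, intervalIntegral.integral_of_le (by positivity),
    ENNReal.toReal_inv, ENNReal.toReal_ofReal (by positivity), smul_eq_mul]

lemma ae_angleLaw_mem : ∀ᵐ θ ∂angleLaw, θ ∈ Set.Ioc 0 (2 * Real.pi) :=
  Measure.ae_smul_measure (ae_restrict_mem measurableSet_Ioc) _

lemma ae_angleLaw_ne (θ : ℝ) : ∀ᵐ φ ∂angleLaw, φ ≠ θ :=
  Measure.ae_smul_measure (ae_restrict_of_ae
    (compl_mem_ae_iff.2 (measure_singleton θ : volume {θ} = 0))) _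

/-- The covariance formula requires distinct points; for equal radii the coincidences form a null
diagonal. -/
lemma ae_circleMap_ne {s t : ℝ} (hs : 0 < s) (ht : 0 < t) :
    ∀ᵐ x ∂angleLaw.prod angleLaw, circleMap 0 s x.1 ≠ circleMap 0 t x.2 := by
  have hm : MeasurableSet {x : ℝ × ℝ | circleMap 0 s x.1 ≠ circleMap 0 t x.2} :=
    (isOpen_ne_fun (by fun_prop) (by fun_prop)).measurableSet
  rw [Measure.ae_prod_iff_ae_ae hm]
  filter_upwards [ae_angleLaw_mem] with θ hθ
  filter_upwards [ae_angleLaw_mem, ae_angleLaw_ne θ] with φ hφ hne heq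
  have hst : s = t := by
    have := congrArg norm heq
    rwa [norm_circleMap_zero, norm_circleMap_zero, abs_of_pos hs, abs_of_pos ht] at this
  subst hst
  have hinj := injOn_circleMap_of_abs_sub_le (a := 0) (b := 2 * Real.pi) (c := 0) hs.ne'
    (by rw [zero_sub, abs_neg, abs_of_pos (by positivity)])
  rw [Set.uIoc_of_le (by positivity)] at hinj
  exact hne (hinj hθ hφ heq).symm

lemma measurable_corrSq_circleMap (M s t : ℝ) :
    Measurable fun x : ℝ × ℝ => corrSq M (circleMap 0 s x.1) (circleMap 0 t x.2) := by
  unfold corrSq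
  have h1 : Continuous fun x : ℝ × ℝ => circleMap 0 s x.1 := by fun_prop
  have h2 : Continuous fun x : ℝ × ℝ => circleMap 0 t x.2 := by fun_prop
  have h3 : Measurable fun x : ℝ × ℝ =>
      (1 - ‖circleMap 0 s x.1‖ ^ 2) * (1 - ‖circleMap 0 t x.2‖ ^ 2) /
        ‖1 - circleMap 0 s x.1 * starRingEnd ℂ (circleMap 0 t x.2)‖ ^ 2 :=
    (((continuous_const.sub (h1.norm.pow 2)).mul
      (continuous_const.sub (h2.norm.pow 2))).measurable).div
      ((continuous_const.sub (h1.mul (Complex.continuous_conj.comp h2))).norm.pow 2).measurable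
  exact h3.pow_const M

lemma corrSq_le_one {L : ℝ} (hL : 0 < L) {z w : ℂ} (hz : ‖z‖ < 1) (hw : ‖w‖ < 1) :
    corrSq L z w ≤ 1 := by
  by_cases h : z = w
  · subst h
    rw [← norm_corr_sq hz hz, corr_self hz]
    simp
  · exact (corrSq_lt_one hL hz hw h).le

lemma corrSq_mul_natCast {L : ℝ} {z w : ℂ} (hz : ‖z‖ < 1) (hw : ‖w‖ < 1) (m : ℕ) :
    corrSq (L * m) z w = corrSq L z w ^ m := by
  have hp := one_sub_norm_sq_pos hz
  have hq := one_sub_norm_sq_pos hw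
  exact Real.rpow_mul_natCast (by positivity) L m

lemma norm_circleMap_lt_one {s : ℝ} (hs0 : 0 ≤ s) (hs : s < 1) (θ : ℝ) : ‖circleMap 0 s θ‖ < 1 := by
  rwa [norm_circleMap_zero, abs_of_nonneg hs0]

lemma summable_one_div_succ_sq : Summable fun m : ℕ => 1 / ((m : ℝ) + 1) ^ 2 := by
  refine (summable_four_div.mul_left (1 / 4)).congr fun m => ?_
  ring

/-- The m-th power of the squared correlation for L is the squared correlation for Lm, so each term
of the dilogarithm averages to a `corrAverage` at a new parameter. -/
lemma hasSum_corrAverage_div {L s t : ℝ} (hL : 0 < L) (hs0 : 0 ≤ s) (hs : s < 1) (ht0 : 0 ≤ t)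
    (ht : t < 1) :
    HasSum (fun m : ℕ => corrAverage (L * (m + 1 : ℕ)) s t / ((m : ℝ) + 1) ^ 2)
      (∫ x, ∑' m : ℕ, corrSq L (circleMap 0 s x.1) (circleMap 0 t x.2) ^ (m + 1) /
        ((m : ℝ) + 1) ^ 2 ∂angleLaw.prod angleLaw) := by
  have hb (m : ℕ) (x : ℝ × ℝ) :
      ‖corrSq L (circleMap 0 s x.1) (circleMap 0 t x.2) ^ (m + 1) / ((m : ℝ) + 1) ^ 2‖ ≤
        1 / ((m : ℝ) + 1) ^ 2 := by
    have h0 := (corrSq_pos (L := L) (norm_circleMap_lt_one hs0 hs x.1)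
      (norm_circleMap_lt_one ht0 ht x.2)).le
    have h1 := corrSq_le_one hL (norm_circleMap_lt_one hs0 hs x.1)
      (norm_circleMap_lt_one ht0 ht x.2)
    rw [Real.norm_of_nonneg (by positivity)]
    have := pow_le_one₀ (n := m + 1) h0 h1
    gcongr
  have hmeas (m : ℕ) : Measurable fun x : ℝ × ℝ =>
      corrSq L (circleMap 0 s x.1) (circleMap 0 t x.2) ^ (m + 1) / ((m : ℝ) + 1) ^ 2 :=
    ((measurable_corrSq_circleMap L s t).pow_const _).div_const _
  have h := hasSum_integral_of_dominated_convergence (μ := angleLaw.prod angleLaw)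
    (F := fun (m : ℕ) (x : ℝ × ℝ) =>
      corrSq L (circleMap 0 s x.1) (circleMap 0 t x.2) ^ (m + 1) / ((m : ℝ) + 1) ^ 2)
    (fun (m : ℕ) _ => 1 / ((m : ℝ) + 1) ^ 2) (fun m => (hmeas m).aestronglyMeasurable)
    (fun m => ae_of_all _ fun x => hb m x) (ae_of_all _ fun _ => summable_one_div_succ_sq)
    (integrable_const _)
    (ae_of_all _ fun x =>
      (Summable.of_norm_bounded summable_one_div_succ_sq fun m => hb m x).hasSum)
  refine h.congr_fun fun m => ?_
  have hint : Integrable (fun x : ℝ × ℝ =>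
      corrSq L (circleMap 0 s x.1) (circleMap 0 t x.2) ^ (m + 1) / ((m : ℝ) + 1) ^ 2)
      (angleLaw.prod angleLaw) :=
    (integrable_const (1 / ((m : ℝ) + 1) ^ 2)).mono' (hmeas m).aestronglyMeasurable
      (ae_of_all _ fun x => hb m x)
  rw [integral_prod _ hint, corrAverage]
  simp_rw [integral_div]
  congr 1
  rw [integral_angleLaw]
  simp_rw [integral_angleLaw, ← corrSq_mul_natCast (norm_circleMap_lt_one hs0 hs _)
    (norm_circleMap_lt_one ht0 ht _)]

/-! ### The centred logarithm of the field and its circle averages. -/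

section

variable {Ω : Type*} [MeasurableSpace Ω] {P : Measure Ω} [IsProbabilityMeasure P] {L : ℝ}
  {a : ℕ → Ω → ℂ}

/-- The logarithm of the modulus of the field, centred. -/
noncomputable def centeredLog (L : ℝ) (c : ℕ → ℂ) (z : ℂ) : ℝ :=
  Real.log ‖gaf L c z‖ - (1 / 2 * logMean - L / 2 * Real.log (1 - ‖z‖ ^ 2))

omit [IsProbabilityMeasure P] in
lemma IsRegularSeq.measurable_normGaf (h : IsRegularSeq P L a) {z : ℂ} (hz : ‖z‖ < 1) :
    Measurable fun ω => normGaf L (fun n => a n ω) z := by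
  have h1 := (h.measurable_gaf_circleMap (norm_nonneg z) hz).comp
    (measurable_id.prodMk (measurable_const (a := Complex.arg z)))
  have e : circleMap 0 ‖z‖ (Complex.arg z) = z := by
    rw [circleMap, zero_add, Complex.norm_mul_exp_arg_mul_I]
  simp only [Function.comp_def, id, e] at h1
  exact h1.const_mul _

/-- The point is paired with itself, with correlation 1 and σ = 0. -/
lemma IsRegularSeq.map_normGaf (hL : 0 < L) (h : IsRegularSeq P L a) {z : ℂ} (hz : ‖z‖ < 1) :
    P.map (fun ω => normGaf L (fun n => a n ω) z) = stdComplexNormal :=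
  (h.isGaussianPair hL hz hz (σ := 0) (by rw [corr_self hz]; simp)).map_fst
    (h.measurable_normGaf hz) (h.measurable_normGaf hz)

lemma IsRegularSeq.centeredLog_ae_eq (hL : 0 < L) (h : IsRegularSeq P L a) {z : ℂ} (hz : ‖z‖ < 1) :
    (fun ω => centeredLog L (fun n => a n ω) z) =ᵐ[P]
      fun ω => Real.log ‖normGaf L (fun n => a n ω) z‖ - 1 / 2 * logMean := by
  have h0 := ae_ne_zero_stdComplexNormal
  rw [← h.map_normGaf hL hz] at h0
  filter_upwards [ae_of_ae_map (h.measurable_normGaf hz).aemeasurable h0] with ω hω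
  have hp := one_sub_norm_sq_pos hz
  have h1 : gaf L (fun n => a n ω) z ≠ 0 := right_ne_zero_of_mul hω
  rw [centeredLog, normGaf, norm_mul, Complex.norm_real, Real.norm_of_nonneg (by positivity),
    Real.log_mul (by positivity) (norm_ne_zero_iff.2 h1), Real.log_rpow hp]
  ring

lemma IsRegularSeq.memLp_centeredLog (hL : 0 < L) (h : IsRegularSeq P L a) {z : ℂ} (hz : ‖z‖ < 1) :
    MemLp (fun ω => centeredLog L (fun n => a n ω) z) 2 P :=
  ((memLp_log_norm_of_map_eq (h.measurable_normGaf hz) (h.map_normGaf hL hz)).sub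
    (memLp_const (1 / 2 * logMean))).ae_eq (h.centeredLog_ae_eq hL hz).symm

lemma IsRegularSeq.integral_centeredLog (hL : 0 < L) (h : IsRegularSeq P L a) {z : ℂ}
    (hz : ‖z‖ < 1) : ∫ ω, centeredLog L (fun n => a n ω) z ∂P = 0 := by
  rw [integral_congr_ae (h.centeredLog_ae_eq hL hz), integral_sub
    ((memLp_log_norm_of_map_eq (h.measurable_normGaf hz) (h.map_normGaf hL hz)).integrable
      one_le_two) (integrable_const _),
    integral_log_norm_of_map_eq (h.measurable_normGaf hz) (h.map_normGaf hL hz)]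
  simp

lemma IsRegularSeq.integral_centeredLog_sq (hL : 0 < L) (h : IsRegularSeq P L a) {z : ℂ}
    (hz : ‖z‖ < 1) : ∫ ω, ‖centeredLog L (fun n => a n ω) z ^ 2‖ ∂P =
      ∫ x, (Real.log ‖x‖ - 1 / 2 * logMean) ^ 2 ∂stdComplexNormal := by
  rw [← h.map_normGaf hL hz, integral_map (h.measurable_normGaf hz).aemeasurable
    ((measurable_log_norm.sub_const _).pow_const 2).aestronglyMeasurable]
  refine integral_congr_ae ?_
  filter_upwards [h.centeredLog_ae_eq hL hz] with ω hω
  rw [hω, Real.norm_of_nonneg (sq_nonneg _)]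

lemma IsRegularSeq.integral_centeredLog_mul (hL : 0 < L) (h : IsRegularSeq P L a) {z w : ℂ}
    (hz : ‖z‖ < 1) (hw : ‖w‖ < 1) (hzw : z ≠ w) :
    ∫ ω, centeredLog L (fun n => a n ω) z * centeredLog L (fun n => a n ω) w ∂P =
      1 / 4 * ∑' m : ℕ, corrSq L z w ^ (m + 1) / ((m : ℝ) + 1) ^ 2 := by
  have hlt := corrSq_lt_one hL hz hw hzw
  have hpos := corrSq_pos (L := L) hz hw
  have hσ : 0 < Real.sqrt (1 - corrSq L z w) := Real.sqrt_pos.2 (by linarith)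
  have h1 : ‖corr L z w‖ ^ 2 + Real.sqrt (1 - corrSq L z w) ^ 2 = 1 := by
    rw [norm_corr_sq hz hw, Real.sq_sqrt (by linarith)]
    ring
  have hρ : corr L z w ≠ 0 := by
    intro h0
    rw [← norm_corr_sq hz hw, h0] at hpos
    simp at hpos
  have hmain := IsGaussianPair.integral_log_mul_log (h.measurable_normGaf hz)
    (h.measurable_normGaf hw) hσ hρ h1 (h.isGaussianPair hL hz hw h1)
  have hX := memLp_log_norm_of_map_eq (h.measurable_normGaf hz) (h.map_normGaf hL hz)
  have hY := memLp_log_norm_of_map_eq (h.measurable_normGaf hw) (h.map_normGaf hL hw)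
  have hXY : Integrable (fun ω => Real.log ‖normGaf L (fun n => a n ω) z‖ *
      Real.log ‖normGaf L (fun n => a n ω) w‖) P := hX.integrable_mul hY
  have hX1 := hX.integrable one_le_two
  have hY1 := hY.integrable one_le_two
  have e : (fun ω => centeredLog L (fun n => a n ω) z * centeredLog L (fun n => a n ω) w) =ᵐ[P]
      fun ω => Real.log ‖normGaf L (fun n => a n ω) z‖ * Real.log ‖normGaf L (fun n => a n ω) w‖ -
        (1 / 2 * logMean * Real.log ‖normGaf L (fun n => a n ω) z‖ +
          (1 / 2 * logMean * Real.log ‖normGaf L (fun n => a n ω) w‖ - (1 / 2 * logMean) ^ 2)) := by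
    filter_upwards [h.centeredLog_ae_eq hL hz, h.centeredLog_ae_eq hL hw] with ω h1 h2
    rw [h1, h2]
    ring
  have hA : Integrable (fun ω => 1 / 2 * logMean * Real.log ‖normGaf L (fun n => a n ω) w‖ -
      (1 / 2 * logMean) ^ 2) P := (hY1.const_mul _).sub (integrable_const _)
  have hB : Integrable (fun ω => 1 / 2 * logMean * Real.log ‖normGaf L (fun n => a n ω) z‖ +
      (1 / 2 * logMean * Real.log ‖normGaf L (fun n => a n ω) w‖ - (1 / 2 * logMean) ^ 2)) P :=
    (hX1.const_mul _).add hA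
  rw [integral_congr_ae e, integral_sub hXY hB, integral_add (hX1.const_mul _) hA,
    integral_sub (hY1.const_mul _) (integrable_const _), integral_const_mul, integral_const_mul,
    integral_log_norm_of_map_eq (h.measurable_normGaf hz) (h.map_normGaf hL hz),
    integral_log_norm_of_map_eq (h.measurable_normGaf hw) (h.map_normGaf hL hw), hmain,
    norm_corr_sq hz hw]
  simp only [integral_const, probReal_univ, one_smul]
  ring

/-- The circular average of the centred logarithm. -/
noncomputable def meanLog (L : ℝ) (c : ℕ → ℂ) (s : ℝ) : ℝ :=
  ∫ θ, centeredLog L c (circleMap 0 s θ) ∂angleLaw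

/-- The second moment of the centred logarithm is the same at every point of the disc, so
integrating it over the angle is trivial. -/
lemma IsRegularSeq.memLp_centeredLog_prod (hL : 0 < L) (h : IsRegularSeq P L a) {s : ℝ}
    (hs0 : 0 ≤ s) (hs : s < 1) :
    MemLp (fun x : Ω × ℝ => centeredLog L (fun n => a n x.1) (circleMap 0 s x.2)) 2
      (P.prod angleLaw) := by
  have hm : Measurable fun x : Ω × ℝ => centeredLog L (fun n => a n x.1) (circleMap 0 s x.2) := by
    simp only [centeredLog, norm_circleMap_zero]
    exact (measurable_log_norm.comp (h.measurable_gaf_circleMap hs0 hs)).sub_const _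
  rw [memLp_two_iff_integrable_sq hm.aestronglyMeasurable,
    integrable_prod_iff' (hm.pow_const 2).aestronglyMeasurable]
  refine ⟨ae_of_all _ fun θ => (h.memLp_centeredLog hL
    (norm_circleMap_lt_one hs0 hs θ)).integrable_sq, ?_⟩
  simp_rw [h.integral_centeredLog_sq hL (norm_circleMap_lt_one hs0 hs _)]
  exact integrable_const _

lemma IsRegularSeq.memLp_meanLog (hL : 0 < L) (h : IsRegularSeq P L a) {s : ℝ}
    (hs0 : 0 ≤ s) (hs : s < 1) : MemLp (fun ω => meanLog L (fun n => a n ω) s) 2 P :=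
  memLp_integral_right (h.memLp_centeredLog_prod hL hs0 hs)

lemma IsRegularSeq.integral_meanLog (hL : 0 < L) (h : IsRegularSeq P L a) {s : ℝ}
    (hs0 : 0 ≤ s) (hs : s < 1) : ∫ ω, meanLog L (fun n => a n ω) s ∂P = 0 := by
  unfold meanLog
  rw [integral_integral_swap ((h.memLp_centeredLog_prod hL hs0 hs).integrable one_le_two)]
  simp_rw [h.integral_centeredLog hL (norm_circleMap_lt_one hs0 hs _)]
  simp

lemma IsRegularSeq.hasSum_integral_meanLog_mul (hL : 0 < L) (h : IsRegularSeq P L a) {s t : ℝ}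
    (hs0 : 0 < s) (hs : s < 1) (ht0 : 0 < t) (ht : t < 1) :
    HasSum (fun m : ℕ => 1 / 4 * (corrAverage (L * (m + 1 : ℕ)) s t / ((m : ℝ) + 1) ^ 2))
      (∫ ω, meanLog L (fun n => a n ω) s * meanLog L (fun n => a n ω) t ∂P) := by
  have h1 := (hasSum_corrAverage_div hL hs0.le hs ht0.le ht).mul_left (1 / 4)
  have e : ∫ ω, meanLog L (fun n => a n ω) s * meanLog L (fun n => a n ω) t ∂P =
      1 / 4 * ∫ x, ∑' m : ℕ, corrSq L (circleMap 0 s x.1) (circleMap 0 t x.2) ^ (m + 1) /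
        ((m : ℝ) + 1) ^ 2 ∂angleLaw.prod angleLaw := by
    unfold meanLog
    rw [integral_integral_mul_integral (h.memLp_centeredLog_prod hL hs0.le hs)
      (h.memLp_centeredLog_prod hL ht0.le ht), ← integral_const_mul]
    refine integral_congr_ae ?_
    filter_upwards [ae_circleMap_ne hs0 ht0] with x hx
    exact h.integral_centeredLog_mul hL (norm_circleMap_lt_one hs0.le hs x.1)
      (norm_circleMap_lt_one ht0.le ht x.2) hx
  rw [e]
  exact h1

lemma IsRegularSeq.integral_meanLog_sub_sq (hL : 0 < L) (h : IsRegularSeq P L a) {s t : ℝ}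
    (hs0 : 0 < s) (hs : s < 1) (ht0 : 0 < t) (ht : t < 1) :
    ∫ ω, (meanLog L (fun n => a n ω) s - meanLog L (fun n => a n ω) t) ^ 2 ∂P =
      1 / 4 * ∑' m : ℕ, (corrAverage (L * (m + 1 : ℕ)) s s - 2 * corrAverage (L * (m + 1 : ℕ)) s t +
        corrAverage (L * (m + 1 : ℕ)) t t) / ((m : ℝ) + 1) ^ 2 := by
  have hS := h.memLp_meanLog hL hs0.le hs
  have hT := h.memLp_meanLog hL ht0.le ht
  have hSS : Integrable (fun ω => meanLog L (fun n => a n ω) s * meanLog L (fun n => a n ω) s) P :=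
    hS.integrable_mul hS
  have hST : Integrable (fun ω => 2 * (meanLog L (fun n => a n ω) s *
      meanLog L (fun n => a n ω) t)) P := (hS.integrable_mul hT).const_mul 2
  have hTT : Integrable (fun ω => meanLog L (fun n => a n ω) t * meanLog L (fun n => a n ω) t) P :=
    hT.integrable_mul hT
  have hD : Integrable (fun ω => meanLog L (fun n => a n ω) s * meanLog L (fun n => a n ω) s -
      2 * (meanLog L (fun n => a n ω) s * meanLog L (fun n => a n ω) t)) P := hSS.sub hST
  have e (ω : Ω) : (meanLog L (fun n => a n ω) s - meanLog L (fun n => a n ω) t) ^ 2 =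
      meanLog L (fun n => a n ω) s * meanLog L (fun n => a n ω) s -
        2 * (meanLog L (fun n => a n ω) s * meanLog L (fun n => a n ω) t) +
        meanLog L (fun n => a n ω) t * meanLog L (fun n => a n ω) t := by ring
  simp_rw [e]
  rw [integral_add hD hTT, integral_sub hSS hST, integral_const_mul, ← tsum_mul_left]
  refine (HasSum.tsum_eq ((((h.hasSum_integral_meanLog_mul hL hs0 hs hs0 hs).sub
    ((h.hasSum_integral_meanLog_mul hL hs0 hs ht0 ht).mul_left 2)).add
    (h.hasSum_integral_meanLog_mul hL ht0 ht ht0 ht)).congr_fun fun m => ?_)).symm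
  ring

end

/-! ### Jensen's formula and difference quotients in log s. -/

lemma divisor_eq_analyticOrderNatAt {f : ℂ → ℂ} {U : Set ℂ} (hf : AnalyticOnNhd ℂ f U) {u : ℂ}
    (hu : u ∈ U) : MeromorphicOn.divisor f U u = (analyticOrderNatAt f u : ℤ) := by
  rw [MeromorphicOn.AnalyticOnNhd.divisor_apply hf hu, analyticOrderNatAt]
  cases analyticOrderAt f u <;> rfl

/-- Jensen's formula on all circles inside a disc, in terms of the zeros in the disc. -/
lemma exists_jensen {f : ℂ → ℂ} {T : ℝ} (hf : AnalyticOnNhd ℂ f (Metric.closedBall 0 T))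
    (h0 : f 0 ≠ 0) :
    ∃ F : Finset ℂ, (∀ u ∈ F, u ≠ 0) ∧ ∀ s, 0 < s → s ≤ T →
      Real.circleAverage (fun z => Real.log ‖f z‖) 0 s =
        ∑ u ∈ F, (analyticOrderNatAt f u : ℝ) * Real.posLog (s * ‖u‖⁻¹) + Real.log ‖f 0‖ ∧
      zeroCount f s = ∑ u ∈ F with ‖u‖ < s, analyticOrderNatAt f u := by
  -- One finite set, the zeros in the largest closed disc, serves all radii s ≤ T: the positive part
  -- of the logarithm kills those with |u| ≥ s.
  have hfin := (MeromorphicOn.divisor f (Metric.closedBall 0 T)).finiteSupport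
    (isCompact_closedBall 0 T)
  have hmem {u : ℂ} : u ∈ hfin.toFinset ↔ ‖u‖ ≤ T ∧ analyticOrderNatAt f u ≠ 0 := by
    rw [Set.Finite.mem_toFinset, Function.mem_support]
    by_cases hu : u ∈ Metric.closedBall 0 T
    · rw [divisor_eq_analyticOrderNatAt hf hu]
      rw [mem_closedBall_zero_iff] at hu
      simp [hu]
    · rw [Function.locallyFinsuppWithin.apply_eq_zero_of_notMem _ hu]
      rw [mem_closedBall_zero_iff] at hu
      simp [hu]
  have hne {u : ℂ} (hu : u ∈ hfin.toFinset) : u ≠ 0 := by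
    rintro rfl
    exact h0 (apply_eq_zero_of_analyticOrderNatAt_ne_zero (hmem.1 hu).2)
  refine ⟨hfin.toFinset, fun u hu => hne hu, fun s hs0 hs => ⟨?_, ?_⟩⟩
  · have hfs : AnalyticOnNhd ℂ f (Metric.closedBall 0 |s|) := by
      rw [abs_of_pos hs0]
      exact hf.mono (Metric.closedBall_subset_closedBall hs)
    rw [hfs.circleAverage_log_norm hs0.ne' h0, abs_of_pos hs0]
    rw [abs_of_pos hs0] at hfs
    congr 1
    have hval (u : ℂ) : (MeromorphicOn.divisor f (Metric.closedBall 0 s) u : ℝ) *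
        Real.log (s * ‖0 - u‖⁻¹) = if ‖u‖ ≤ T then
          (analyticOrderNatAt f u : ℝ) * Real.posLog (s * ‖u‖⁻¹) else 0 := by
      rw [zero_sub, norm_neg]
      by_cases hu : u ∈ Metric.closedBall 0 s
      · rw [divisor_eq_analyticOrderNatAt hfs hu]
        rw [mem_closedBall_zero_iff] at hu
        rw [if_pos (hu.trans hs)]
        push_cast
        by_cases hu0 : u = 0
        · rw [hu0, norm_zero, inv_zero, mul_zero, Real.log_zero, Real.posLog_zero]
        · have hpos := norm_pos_iff.2 hu0
          rw [Real.posLog_eq_log]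
          rw [← div_eq_mul_inv, abs_of_pos (by positivity), one_le_div hpos]
          exact hu
      · rw [Function.locallyFinsuppWithin.apply_eq_zero_of_notMem _ hu]
        rw [mem_closedBall_zero_iff, not_le] at hu
        have hpos : 0 < ‖u‖ := hs0.trans hu
        have : Real.posLog (s * ‖u‖⁻¹) = 0 := by
          rw [Real.posLog_eq_zero_iff, ← div_eq_mul_inv, abs_of_pos (by positivity),
            div_le_one hpos]
          exact hu.le
        simp [this]
    simp_rw [hval]
    rw [finsum_eq_sum_of_support_subset (s := hfin.toFinset)]
    · refine Finset.sum_congr rfl fun u hu => ?_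
      rw [if_pos (hmem.1 hu).1]
    · intro u hu
      rw [Function.mem_support] at hu
      rw [Finset.mem_coe, hmem]
      by_cases h : ‖u‖ ≤ T
      · rw [if_pos h] at hu
        refine ⟨h, fun h2 => hu ?_⟩
        rw [h2, Nat.cast_zero, zero_mul]
      · rw [if_neg h] at hu
        exact absurd rfl hu
  · rw [zeroCount]
    refine finsum_mem_eq_sum_of_inter_support_eq _ ?_
    ext u
    simp only [Set.mem_inter_iff, mem_ball_zero_iff, Function.mem_support, Finset.coe_filter,
      Set.mem_ofPred_eq, hmem]
    constructor
    · rintro ⟨h1, h2⟩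
      exact ⟨⟨⟨h1.le.trans hs, h2⟩, h1⟩, h2⟩
    · rintro ⟨⟨_, h1⟩, h2⟩
      exact ⟨h1, h2⟩

lemma posLog_div_eq_zero {x y : ℝ} (hx : 0 < x) (hy : 0 < y) (h : x ≤ y) :
    Real.posLog (x * y⁻¹) = 0 := by
  rw [Real.posLog_eq_zero_iff, ← div_eq_mul_inv, abs_of_pos (by positivity), div_le_one hy]
  exact h

lemma posLog_div_eq_sub {x y : ℝ} (hx : 0 < x) (hy : 0 < y) (h : y ≤ x) :
    Real.posLog (x * y⁻¹) = Real.log x - Real.log y := by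
  rw [Real.posLog_eq_log, ← div_eq_mul_inv, Real.log_div hx.ne' hy.ne']
  rw [← div_eq_mul_inv, abs_of_pos (by positivity), one_le_div hy]
  exact h

lemma posLog_sub_nonneg {s r y : ℝ} (hs : 0 < s) (hsr : s ≤ r) (hy : 0 < y) :
    0 ≤ Real.posLog (r * y⁻¹) - Real.posLog (s * y⁻¹) := by
  have hr := hs.trans_le hsr
  have hl := Real.log_le_log hs hsr
  rcases le_total s y with h | h
  · rw [posLog_div_eq_zero hs hy h, sub_zero]
    exact Real.posLog_nonneg
  · rw [posLog_div_eq_sub hs hy h, posLog_div_eq_sub hr hy (h.trans hsr)]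
    linarith

lemma posLog_sub_le {s r y : ℝ} (hs : 0 < s) (hsr : s ≤ r) (hy : 0 < y) :
    Real.posLog (r * y⁻¹) - Real.posLog (s * y⁻¹) ≤ if y < r then Real.log (r / s) else 0 := by
  have hr := hs.trans_le hsr
  rw [Real.log_div hr.ne' hs.ne']
  split_ifs with h
  · rw [posLog_div_eq_sub hr hy h.le]
    rcases le_total s y with h2 | h2
    · rw [posLog_div_eq_zero hs hy h2]
      have := Real.log_le_log hs h2
      linarith
    · rw [posLog_div_eq_sub hs hy h2]
      linarith
  · rw [not_lt] at h
    rw [posLog_div_eq_zero hr hy h, posLog_div_eq_zero hs hy (hsr.trans h), sub_zero]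

/-- In the variable log s, the function log⁺(s/y) is 0 up to log y and has slope 1 afterwards;
without a kink strictly between s and r the increment is exact. -/
lemma posLog_sub_eq {s r y : ℝ} (hs : 0 < s) (hsr : s ≤ r) (hy : 0 < y) (h : y ≤ s ∨ r ≤ y) :
    Real.posLog (r * y⁻¹) - Real.posLog (s * y⁻¹) = if y < r then Real.log (r / s) else 0 := by
  have hr := hs.trans_le hsr
  split_ifs with h2
  · rcases h with h | h
    · rw [posLog_div_eq_sub hr hy h2.le, posLog_div_eq_sub hs hy h, Real.log_div hr.ne' hs.ne']
      ring
    · exact absurd h2 h.not_gt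
  · rw [not_lt] at h2
    rw [posLog_div_eq_zero hr hy h2, posLog_div_eq_zero hs hy (hsr.trans h2), sub_zero]

section

variable {f : ℂ → ℂ}

lemma exists_circleAverage_sub {t : ℝ} (hf : AnalyticOnNhd ℂ f (Metric.closedBall 0 t))
    (h0 : f 0 ≠ 0) : ∃ F : Finset ℂ, (∀ u ∈ F, u ≠ 0) ∧
      (∀ s r, 0 < s → s ≤ r → r ≤ t → Real.circleAverage (fun z => Real.log ‖f z‖) 0 r -
        Real.circleAverage (fun z => Real.log ‖f z‖) 0 s =
        ∑ u ∈ F, (analyticOrderNatAt f u : ℝ) *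
          (Real.posLog (r * ‖u‖⁻¹) - Real.posLog (s * ‖u‖⁻¹))) ∧
      ∀ r c, 0 < r → r ≤ t → (zeroCount f r : ℝ) * c =
        ∑ u ∈ F, (analyticOrderNatAt f u : ℝ) * if ‖u‖ < r then c else 0 := by
  obtain ⟨F, hF, h⟩ := exists_jensen hf h0
  refine ⟨F, hF, fun s r hs hsr hrt => ?_, fun r c hr hrt => ?_⟩
  · rw [(h r (hs.trans_le hsr) hrt).1, (h s hs (hsr.trans hrt)).1, add_sub_add_right_eq_sub,
      ← Finset.sum_sub_distrib]
    exact Finset.sum_congr rfl fun u _ => by ring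
  · rw [(h r hr hrt).2, Nat.cast_sum, Finset.sum_mul, Finset.sum_filter]
    exact Finset.sum_congr rfl fun u _ => by split_ifs <;> simp

lemma circleAverage_sub_nonneg {s r : ℝ} (hf : AnalyticOnNhd ℂ f (Metric.closedBall 0 r))
    (h0 : f 0 ≠ 0) (hs : 0 < s) (hsr : s ≤ r) :
    0 ≤ Real.circleAverage (fun z => Real.log ‖f z‖) 0 r -
      Real.circleAverage (fun z => Real.log ‖f z‖) 0 s := by
  obtain ⟨F, hF, h1, -⟩ := exists_circleAverage_sub hf h0
  rw [h1 s r hs hsr le_rfl]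
  exact Finset.sum_nonneg fun u hu => mul_nonneg (Nat.cast_nonneg _)
    (posLog_sub_nonneg hs hsr (norm_pos_iff.2 (hF u hu)))

lemma circleAverage_sub_le {s r : ℝ} (hf : AnalyticOnNhd ℂ f (Metric.closedBall 0 r))
    (h0 : f 0 ≠ 0) (hs : 0 < s) (hsr : s ≤ r) :
    Real.circleAverage (fun z => Real.log ‖f z‖) 0 r -
      Real.circleAverage (fun z => Real.log ‖f z‖) 0 s ≤ zeroCount f r * Real.log (r / s) := by
  obtain ⟨F, hF, h1, h2⟩ := exists_circleAverage_sub hf h0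
  rw [h1 s r hs hsr le_rfl, h2 r _ (hs.trans_le hsr) le_rfl]
  exact Finset.sum_le_sum fun u hu => mul_le_mul_of_nonneg_left
    (posLog_sub_le hs hsr (norm_pos_iff.2 (hF u hu))) (Nat.cast_nonneg _)

/-- Supplies the majorant: zeros in the open disc of radius r contribute the full increment
log(t/r), the others a nonnegative one. -/
lemma zeroCount_mul_log_le {r t : ℝ} (hf : AnalyticOnNhd ℂ f (Metric.closedBall 0 t))
    (h0 : f 0 ≠ 0) (hr : 0 < r) (hrt : r ≤ t) :
    zeroCount f r * Real.log (t / r) ≤ Real.circleAverage (fun z => Real.log ‖f z‖) 0 t -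
      Real.circleAverage (fun z => Real.log ‖f z‖) 0 r := by
  obtain ⟨F, hF, h1, h2⟩ := exists_circleAverage_sub hf h0
  rw [h1 r t hr hrt le_rfl, h2 r _ hr hrt]
  refine Finset.sum_le_sum fun u hu => mul_le_mul_of_nonneg_left ?_ (Nat.cast_nonneg _)
  have hu0 := norm_pos_iff.2 (hF u hu)
  split_ifs with h
  · rw [posLog_sub_eq hr hrt hu0 (Or.inl h.le), if_pos (h.trans_le hrt)]
  · exact posLog_sub_nonneg hr hrt hu0

/-- There are finitely many zeros, so for s close to r no modulus lies in (s, r). Zeros on |u| = r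
contribute nothing, matching the count in the open disc; this is why the limit is taken from the
left. -/
lemma eventually_circleAverage_sub_eq {r : ℝ} (hf : AnalyticOnNhd ℂ f (Metric.closedBall 0 r))
    (h0 : f 0 ≠ 0) (hr : 0 < r) :
    ∀ᶠ s in 𝓝[<] r, Real.circleAverage (fun z => Real.log ‖f z‖) 0 r -
      Real.circleAverage (fun z => Real.log ‖f z‖) 0 s = zeroCount f r * Real.log (r / s) := by
  obtain ⟨F, hF, h1, h2⟩ := exists_circleAverage_sub hf h0
  have hev : ∀ᶠ s in 𝓝[<] r, ∀ u ∈ F, ‖u‖ ≤ s ∨ r ≤ ‖u‖ := by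
    rw [Finset.eventually_all]
    intro u _
    rcases lt_or_ge ‖u‖ r with h | h
    · filter_upwards [Ioo_mem_nhdsLT h] with s hs using Or.inl hs.1.le
    · exact Eventually.of_forall fun s => Or.inr h
  filter_upwards [hev, Ioo_mem_nhdsLT hr] with s h3 hs
  rw [h1 s r hs.1 hs.2.le le_rfl, h2 r _ hr le_rfl]
  exact Finset.sum_congr rfl fun u hu => by
    rw [posLog_sub_eq hs.1 hs.2.le (norm_pos_iff.2 (hF u hu)) (h3 u hu)]

end

/-! ### From difference quotients to the zero count. -/

section

variable {Ω : Type*} [MeasurableSpace Ω] {P : Measure Ω} [IsProbabilityMeasure P] {L : ℝ}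
  {a : ℕ → Ω → ℂ}

lemma AbsConvergent.circleAverage_eq {c : ℕ → ℂ} (h : AbsConvergent L c) {s : ℝ} (hs0 : 0 ≤ s)
    (hs : s < 1) : Real.circleAverage (fun z => Real.log ‖gaf L c z‖) 0 s =
      meanLog L c s + (1 / 2 * logMean - L / 2 * Real.log (1 - s ^ 2)) := by
  have hmer : MeromorphicOn (gaf L c) (Metric.sphere 0 |s|) := by
    refine AnalyticOnNhd.meromorphicOn (h.analyticOnNhd_gaf.mono fun z hz => ?_)
    rw [mem_sphere_zero_iff_norm, abs_of_nonneg hs0] at hz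
    rwa [mem_ball_zero_iff, hz]
  have hint : IntervalIntegrable (fun θ => Real.log ‖gaf L c (circleMap 0 s θ)‖) volume 0
      (2 * Real.pi) := hmer.circleIntegrable_log_norm
  rw [meanLog, integral_angleLaw, Real.circleAverage, smul_eq_mul]
  simp only [centeredLog, norm_circleMap_zero, sq_abs]
  rw [intervalIntegral.integral_sub hint intervalIntegrable_const, intervalIntegral.integral_const,
    smul_eq_mul, sub_zero, mul_sub, inv_mul_cancel_left₀ (by positivity)]
  ring

/-- The number of zeros is approximated by the difference quotients of the circular averages of
`log |f|` as a function of the logarithm of the radius. -/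
noncomputable def zeroQuotient (L : ℝ) (c : ℕ → ℂ) (r s : ℝ) : ℝ :=
  (Real.circleAverage (fun z => Real.log ‖gaf L c z‖) 0 r -
    Real.circleAverage (fun z => Real.log ‖gaf L c z‖) 0 s) / Real.log (r / s)

lemma IsRegularSeq.memLp_zeroQuotient (hL : 0 < L) (h : IsRegularSeq P L a) {r s : ℝ}
    (hr0 : 0 ≤ r) (hr : r < 1) (hs0 : 0 ≤ s) (hs : s < 1) :
    MemLp (fun ω => zeroQuotient L (fun n => a n ω) r s) 2 P := by
  have h1 : MemLp (fun ω => (meanLog L (fun n => a n ω) r +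
      (1 / 2 * logMean - L / 2 * Real.log (1 - r ^ 2)) - (meanLog L (fun n => a n ω) s +
      (1 / 2 * logMean - L / 2 * Real.log (1 - s ^ 2)))) * (Real.log (r / s))⁻¹) 2 P :=
    (((h.memLp_meanLog hL hr0 hr).add (memLp_const _)).sub
      ((h.memLp_meanLog hL hs0 hs).add (memLp_const _))).mul_const _
  refine h1.ae_eq (ae_of_all _ fun ω => ?_)
  simp only [zeroQuotient, (h.absConvergent ω).circleAverage_eq hr0 hr,
    (h.absConvergent ω).circleAverage_eq hs0 hs]
  exact (div_eq_mul_inv _ _).symm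

/-- The circle average differs from the centred one by a deterministic function of the radius, which
does not affect the variance. -/
lemma IsRegularSeq.variance_zeroQuotient (hL : 0 < L) (h : IsRegularSeq P L a) {r s : ℝ}
    (hr0 : 0 < r) (hr : r < 1) (hs0 : 0 < s) (hs : s < 1) :
    variance (fun ω => zeroQuotient L (fun n => a n ω) r s) P =
      1 / 4 * (∑' m : ℕ, (corrAverage (L * (m + 1 : ℕ)) r r -
        2 * corrAverage (L * (m + 1 : ℕ)) r s + corrAverage (L * (m + 1 : ℕ)) s s) /
        ((m : ℝ) + 1) ^ 2) / Real.log (r / s) ^ 2 := by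
  have hR := h.memLp_meanLog hL hr0.le hr
  have hS := h.memLp_meanLog hL hs0.le hs
  have hD : MemLp (fun ω => meanLog L (fun n => a n ω) r - meanLog L (fun n => a n ω) s) 2 P :=
    hR.sub hS
  have e : (fun ω => zeroQuotient L (fun n => a n ω) r s) = fun ω =>
      ((meanLog L (fun n => a n ω) r - meanLog L (fun n => a n ω) s) +
        (L / 2 * Real.log (1 - s ^ 2) - L / 2 * Real.log (1 - r ^ 2))) * (Real.log (r / s))⁻¹ := by
    ext ω
    rw [zeroQuotient, (h.absConvergent ω).circleAverage_eq hr0.le hr,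
      (h.absConvergent ω).circleAverage_eq hs0.le hs]
    ring
  have h0 : ∫ ω, (meanLog L (fun n => a n ω) r - meanLog L (fun n => a n ω) s) ∂P = 0 := by
    rw [integral_sub (hR.integrable one_le_two) (hS.integrable one_le_two),
      h.integral_meanLog hL hr0.le hr, h.integral_meanLog hL hs0.le hs, sub_zero]
  rw [e, variance_mul_const, variance_add_const hD.1,
    variance_of_integral_eq_zero hD.1.aemeasurable h0,
    h.integral_meanLog_sub_sq hL hr0 hr hs0 hs, inv_pow, ← div_eq_mul_inv]

lemma AbsConvergent.analyticOnNhd_closedBall {c : ℕ → ℂ} (h : AbsConvergent L c) {r : ℝ}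
    (hr : r < 1) : AnalyticOnNhd ℂ (gaf L c) (Metric.closedBall 0 r) :=
  h.analyticOnNhd_gaf.mono (Metric.closedBall_subset_ball hr)

/-- The quotients from the left are nonnegative, bounded by the count and eventually equal to it for
each outcome, so first and second moments converge. Their variances also converge to
`varianceFormula` by `tendsto_second_difference`, and limits are unique. -/
lemma IsRegularSeq.memLp_and_variance (hL : 0 < L) (h : IsRegularSeq P L a) {r : ℝ} (hr0 : 0 < r)
    (hr : r < 1) :
    MemLp (numZeros a L r) 2 P ∧ variance (numZeros a L r) P = varianceFormula L r := by
  obtain ⟨t, hrt, ht⟩ := exists_between hr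
  obtain ⟨u, -, hu, hulim⟩ := exists_seq_strictMono_tendsto' hr0
  have hulim' : Tendsto u atTop (𝓝[<] r) :=
    tendsto_nhdsWithin_iff.2 ⟨hulim, Eventually.of_forall fun k => (hu k).2⟩
  have hlog (k : ℕ) : 0 < Real.log (r / u k) := Real.log_pos ((one_lt_div (hu k).1).2 (hu k).2)
  have hlogt : 0 < Real.log (t / r) := Real.log_pos ((one_lt_div hr0).2 hrt)
  have hne (ω : Ω) : gaf L (fun n => a n ω) 0 ≠ 0 := by rw [gaf_zero hL]; exact h.ne_zero ω
  set X : ℕ → Ω → ℝ := fun k ω => zeroQuotient L (fun n => a n ω) r (u k) with hX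
  have hXmem (k : ℕ) : MemLp (X k) 2 P :=
    h.memLp_zeroQuotient hL hr0.le hr (hu k).1.le ((hu k).2.trans hr)
  have hX0 (k : ℕ) (ω : Ω) : 0 ≤ X k ω :=
    div_nonneg (circleAverage_sub_nonneg ((h.absConvergent ω).analyticOnNhd_closedBall hr) (hne ω)
      (hu k).1 (hu k).2.le) (hlog k).le
  have hX1 (k : ℕ) (ω : Ω) : X k ω ≤ numZeros a L r ω := by
    simp only [hX, zeroQuotient]
    rw [div_le_iff₀ (hlog k)]
    exact circleAverage_sub_le ((h.absConvergent ω).analyticOnNhd_closedBall hr) (hne ω)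
      (hu k).1 (hu k).2.le
  have hXlim (ω : Ω) : Tendsto (fun k => X k ω) atTop (𝓝 (numZeros a L r ω)) := by
    refine tendsto_const_nhds.congr' ?_
    filter_upwards [hulim'.eventually (eventually_circleAverage_sub_eq
      ((h.absConvergent ω).analyticOnNhd_closedBall hr) (hne ω) hr0)] with k hk
    simp only [hX, zeroQuotient]
    rw [hk, mul_div_cancel_right₀ _ (hlog k).ne', numZeros]
  -- The quotient over the fixed annulus r < |z| < t with t < 1 is square integrable and dominates
  -- the count, hence also every X k.
  set W : Ω → ℝ := fun ω => zeroQuotient L (fun n => a n ω) t r with hW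
  have hWmem : MemLp W 2 P := h.memLp_zeroQuotient hL (hr0.trans hrt).le ht hr0.le hr
  have hnW (ω : Ω) : numZeros a L r ω ≤ W ω := by
    simp only [hW, zeroQuotient]
    rw [le_div_iff₀ hlogt]
    exact zeroCount_mul_log_le ((h.absConvergent ω).analyticOnNhd_closedBall ht) (hne ω) hr0 hrt.le
  have hn0 (ω : Ω) : 0 ≤ numZeros a L r ω := Nat.cast_nonneg _
  have hnmeas : AEStronglyMeasurable (numZeros a L r) P :=
    aestronglyMeasurable_of_tendsto_ae atTop (fun k => (hXmem k).1) (ae_of_all _ hXlim)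
  have hnmem : MemLp (numZeros a L r) 2 P := hWmem.mono hnmeas (ae_of_all _ fun ω => by
    rw [Real.norm_of_nonneg (hn0 ω), Real.norm_of_nonneg ((hn0 ω).trans (hnW ω))]
    exact hnW ω)
  refine ⟨hnmem, ?_⟩
  have hE1 : Tendsto (fun k => ∫ ω, X k ω ∂P) atTop (𝓝 (∫ ω, numZeros a L r ω ∂P)) :=
    tendsto_integral_of_dominated_convergence W (fun k => (hXmem k).1)
      (hWmem.integrable one_le_two) (fun k => ae_of_all _ fun ω => by
        rw [Real.norm_of_nonneg (hX0 k ω)]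
        exact (hX1 k ω).trans (hnW ω)) (ae_of_all _ hXlim)
  have hE2 : Tendsto (fun k => ∫ ω, (X k ^ 2) ω ∂P) atTop
      (𝓝 (∫ ω, (numZeros a L r ^ 2) ω ∂P)) :=
    tendsto_integral_of_dominated_convergence (fun ω => W ω ^ 2) (fun k => (hXmem k).1.pow 2)
      hWmem.integrable_sq (fun k => ae_of_all _ fun ω => by
        rw [Pi.pow_apply, Real.norm_of_nonneg (sq_nonneg _)]
        exact pow_le_pow_left₀ (hX0 k ω) ((hX1 k ω).trans (hnW ω)) 2)
      (ae_of_all _ fun ω => (hXlim ω).pow 2)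
  have hV : Tendsto (fun k => variance (X k) P) atTop (𝓝 (variance (numZeros a L r) P)) := by
    rw [variance_eq_sub hnmem]
    simp_rw [variance_eq_sub (hXmem _)]
    exact hE2.sub (hE1.pow 2)
  refine tendsto_nhds_unique hV (((tendsto_second_difference hL hr0 hr).comp hulim').congr
    fun k => ?_)
  exact (h.variance_zeroQuotient hL hr0 hr (hu k).1 ((hu k).2.trans hr)).symm

end

lemma memLp_numZeros_and_variance {Ω : Type*} [MeasurableSpace Ω] {P : Measure Ω}
    [IsProbabilityMeasure P] {a : ℕ → Ω → ℂ} (ha_law : ∀ n, HasLaw (a n) stdComplexNormal P)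
    (ha_indep : iIndepFun a P) {L r : ℝ} (hL : 0 < L) (hr0 : 0 < r) (hr : r < 1) :
    MemLp (numZeros a L r) 2 P ∧ variance (numZeros a L r) P = varianceFormula L r := by
  obtain ⟨b, hb, hab⟩ := exists_isRegularSeq hL ha_law ha_indep
  obtain ⟨h1, h2⟩ := hb.memLp_and_variance hL hr0 hr
  exact ⟨h1.ae_eq (hab r).symm, by rw [variance_congr (hab r), h2]⟩

end HyperbolicGAF

/-! ### Assembly of the regimes. -/

theorem theorem1p1 {Ω : Type*} [MeasurableSpace Ω] (P : Measure Ω) [IsProbabilityMeasure P]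
    (a : ℕ → Ω → ℂ)
    (ha_law : ∀ n, HasLaw (a n) HyperbolicGAF.stdComplexNormal P)
    (ha_indep : iIndepFun a P) :
    -- the variances below are genuine: `n_L(r)` is square integrable
    (∀ L : ℝ, 0 < L → ∀ r : ℝ, 0 < r → r < 1 → MemLp (HyperbolicGAF.numZeros a L r) 2 P) ∧
    -- (a) the asymptotics for fixed `L > 1/2`, with both expressions for `c_L`
    (∀ L : ℝ, 1 / 2 < L →
      IntegrableOn (HyperbolicGAF.integrand L) (Set.Ioi 0) ∧
      Summable (fun n : ℕ => HyperbolicGAF.gammaTerm L (n + 1)) ∧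
      HyperbolicGAF.cHigh L =
        L ^ 2 / (8 * Real.sqrt Real.pi) * ∑' n : ℕ, HyperbolicGAF.gammaTerm L (n + 1) ∧
      Tendsto
        (fun r : ℝ => variance (HyperbolicGAF.numZeros a L r) P / (HyperbolicGAF.cHigh L / (1 - r)))
        (𝓝[<] 1) (𝓝 1)) ∧
    -- (a) uniformity in `L > 1`
    (∀ ε : ℝ, 0 < ε → ∃ δ : ℝ, 0 < δ ∧ ∀ L : ℝ, 1 < L → ∀ r : ℝ, 0 < r → 1 - δ < r → r < 1 →
      |variance (HyperbolicGAF.numZeros a L r) P / (HyperbolicGAF.cHigh L / (1 - r)) - 1| < ε) ∧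
    -- (b) `L = 1/2`
    Tendsto
      (fun r : ℝ => variance (HyperbolicGAF.numZeros a (1 / 2) r) P /
        (1 / (8 * Real.pi) * (1 / (1 - r)) * Real.log (1 / (1 - r))))
      (𝓝[<] 1) (𝓝 1) ∧
    -- (c) fixed `0 < L < 1/2`
    (∀ L : ℝ, 0 < L → L < 1 / 2 →
      Tendsto
        (fun r : ℝ => variance (HyperbolicGAF.numZeros a L r) P /
          (HyperbolicGAF.cLow L / (1 - r) ^ (2 - 2 * L)))
        (𝓝[<] 1) (𝓝 1)) := by
  -- The closed form holds for all r in (0,1), hence eventually as r → 1 from the left, and the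
  -- random field disappears from the limits.
  have hvar {L : ℝ} (hL : 0 < L) : ∀ᶠ r in 𝓝[<] (1 : ℝ),
      HyperbolicGAF.varianceFormula L r = variance (HyperbolicGAF.numZeros a L r) P := by
    filter_upwards [Ioo_mem_nhdsLT one_pos] with r hr
    exact (HyperbolicGAF.memLp_numZeros_and_variance ha_law ha_indep hL hr.1 hr.2).2.symm
  refine ⟨fun L hL r hr0 hr =>
    (HyperbolicGAF.memLp_numZeros_and_variance ha_law ha_indep hL hr0 hr).1,
    fun L hL => ⟨(HyperbolicGAF.integrableOn_integrand hL).integrableOn,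
      HyperbolicGAF.summable_gammaTerm hL, HyperbolicGAF.cHigh_eq_tsum hL, ?_⟩, ?_, ?_, ?_⟩
  · have hlim : Tendsto (fun r => HyperbolicGAF.varianceFormula L r /
        (HyperbolicGAF.cHigh L / (1 - r))) (𝓝[<] 1) (𝓝 1) := by
      rw [Metric.tendsto_nhds]
      intro ε hε
      obtain ⟨δ, hδ, h⟩ := HyperbolicGAF.varianceFormula_uniform (S := {L})
        (fun M hM => by rw [Set.mem_singleton_iff] at hM; rwa [hM])
        (HyperbolicGAF.uniformTails_singleton hL) ε hε
      filter_upwards [Ioo_mem_nhdsLT one_pos, Ioo_mem_nhdsLT (sub_lt_self 1 hδ)] with r h1 h2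
      exact h L rfl r h1.1 h2.1 h2.2
    refine hlim.congr' ?_
    filter_upwards [hvar (show 0 < L by linarith)] with r hr
    rw [hr]
  · intro ε hε
    obtain ⟨δ, hδ, h⟩ := HyperbolicGAF.varianceFormula_uniform (S := Set.Ioi 1)
      (fun M (hM : 1 < M) => by linarith) HyperbolicGAF.uniformTails_Ioi_one ε hε
    refine ⟨δ, hδ, fun L hL r hr0 hrδ hr => ?_⟩
    rw [(HyperbolicGAF.memLp_numZeros_and_variance ha_law ha_indep (by linarith) hr0 hr).2]
    exact h L hL r hr0 hrδ hr
  · refine HyperbolicGAF.tendsto_varianceFormula_half.congr' ?_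
    filter_upwards [hvar (show (0 : ℝ) < 1 / 2 by norm_num)] with r hr
    rw [hr]
  · intro L h0 hL
    refine (HyperbolicGAF.tendsto_varianceFormula_low h0 hL).congr' ?_
    filter_upwards [hvar h0] with r hr
    rw [hr]
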